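/- **Theorem 1.3.** Let $k\ge 2$, let $\Sigma$ be a $C^k$-smooth surface with a $C^k$-smooth Riemannian metric, and let $\gamma\subset\Sigma$ be a germ at $O\in\Sigma$ of regular $C^k$-smooth curve with positive geodesic curvature $\kappa=|\nabla_T T|$ ($T$ the unit tangent). Let $\mathcal U$ denote the (germ at $O$ of the) domain adjacent to $\gamma$ from the concave side, that is, from the side opposite to the vector $\nabla_TT$, and let $\overline{\mathcal U}=\mathcal U\cup\gamma$. Through every $C\in\mathcal U$ close to $O$ pass exactly two (short) geodesics tangent to $\gamma$ at points close to $O$; let $A\ne B$ be the tangency points, let $\zeta_A,\zeta_B\in T_C\Sigma$ be the unit vectors at $C$ directing the geodesic segments $CA$, $CB$, and let $\Lambda(C)=\mathbb R(\zeta_A-\zeta_B)\subset T_C\Sigma$ be the exterior bisector of the angle $ACB$. For $C\in\gamma$ let $\Lambda(C)=T_C\gamma$. For $A\neq B$ in $\gamma$ close to $O$ let $C_{AB}$ be the intersection point, close to $O$, of the geodesics tangent to $\gamma$ at $A$ and at $B$, let $\lambda(A,B)$ be the length of the arc $AB$ of $\gamma$, and for $p>0$ let $$\Gamma_p=\{C_{AB}\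 :\ |AC_{AB}|+|BC_{AB}|-\lambda(A,B)=p\},\qquad \Gamma_0=\gamma ,$$ where $|XY|$ is the length of the small geodesic segment joining $X$ and $Y$. Put $r(k)=[k/2]-1$. Then, in a sufficiently small neighbourhood of $O$: 1. $\Lambda$ is a line field that is $C^{k-1}$-smooth on $\mathcal U$ and $C^{r(k)}$-smooth on $\overline{\mathcal U}$. 2. Through every $C\in\overline{\mathcal U}$ passes exactly one of the sets $\Gamma_p$, $p\ge0$. Near $C$ it is an embedded $C^{r(k)+1}$-smooth curve, it is tangent to $\Lambda$, and its $(r(k)+1)$-jet at $C$ depends continuously on $C\in\overline{\mathcal U}$: these curves have local parametrizations $t\mapsto c_C(t)$ by arc length, with $c_C(0)=C$, such that, in local coordinates, $\partial_t^jc_C(0)$ is continuous in $C\in\overline{\mathcal U}$ for every $0\le j\le r(k)+1=[k/2]$. -/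

import Mathlib

open Set Filter Topology Manifold
open scoped ContDiff

noncomputable section

namespace StringFoliation

/-- The coordinate plane `ℝ²`. -/
abbrev Plane : Type := EuclideanSpace ℝ (Fin 2)

/-- The coordinate vectors `∂₁`, `∂₂` of the plane. -/
def coordVec (i : Fin 2) : Plane := EuclideanSpace.single i (1 : ℝ)

/-- A Riemannian metric written in local coordinates: the coordinate domain and the coefficient
matrix `(g_{ij}(u))`. (The coefficients outside the domain are irrelevant.) -/
structure LocalMetric where
  domain : Set Plane
  coeff : Plane → Matrix (Fin 2) (Fin 2) ℝ

section Surface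

variable {M : Type*} [TopologicalSpace M] [ChartedSpace Plane M] [IsManifold (𝓡 2) 1 M]

/-- The coordinate expression, in the chart at `O`, of a Riemannian metric `g` on a surface `M`:
`g_{ij} = g(∂_i, ∂_j)`, where `∂_i` is the `i`-th coordinate vector field of the chart. -/
def localMetric {n : ℕ∞ω}
    (g : Bundle.ContMDiffRiemannianMetric (𝓡 2) n Plane (fun x : M => TangentSpace (𝓡 2) x))
    (O : M) : LocalMetric where
  domain := (extChartAt (𝓡 2) O).target
  coeff u := Matrix.of fun i j =>
    g.inner ((extChartAt (𝓡 2) O).symm u)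
      (mfderiv (𝓡 2) (𝓡 2) (extChartAt (𝓡 2) O).symm u (coordVec i))
      (mfderiv (𝓡 2) (𝓡 2) (extChartAt (𝓡 2) O).symm u (coordVec j))

end Surface

/-- A curve in the surface, read in the chart at `O`. -/
def localCurve {M : Type*} [TopologicalSpace M] [ChartedSpace Plane M] (O : M) (γ : ℝ → M) :
    ℝ → Plane :=
  fun t => extChartAt (𝓡 2) O (γ t)

/-- The scalar product `g_u(v, w)`. -/
def LocalMetric.ip (h : LocalMetric) (u v w : Plane) : ℝ :=
  ∑ i, ∑ j, h.coeff u i j * v i * w j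

/-- The Riemannian norm `|v|` of a tangent vector `v` at `u`. -/
def LocalMetric.norm (h : LocalMetric) (u v : Plane) : ℝ :=
  Real.sqrt (h.ip u v v)

/-- The partial derivative `∂_l g_{ij}` at `u`. -/
def LocalMetric.dcoeff (h : LocalMetric) (u : Plane) (l i j : Fin 2) : ℝ :=
  fderiv ℝ (fun w => h.coeff w i j) u (coordVec l)

/-- The Christoffel symbols
`Γ^m_{ij} = ½ ∑_l g^{ml} (∂_i g_{jl} + ∂_j g_{il} - ∂_l g_{ij})`. -/
def LocalMetric.christoffel (h : LocalMetric) (u : Plane) (m i j : Fin 2) : ℝ :=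
  (1 / 2 : ℝ) * ∑ l, (h.coeff u)⁻¹ m l * (h.dcoeff u i j l + h.dcoeff u j i l - h.dcoeff u l i j)

/-- The vector with coordinates `∑_{ij} Γ^m_{ij} v^i w^j`, `m = 1, 2`. -/
def LocalMetric.christoffelVec (h : LocalMetric) (u v w : Plane) : Plane :=
  WithLp.toLp 2 fun m => ∑ i, ∑ j, h.christoffel u m i j * v i * w j

/-- The covariant derivative `∇_{ċ} V` at time `t` of a vector field `V` along the curve `c`. -/
def LocalMetric.covDeriv (h : LocalMetric) (c V : ℝ → Plane) (t : ℝ) : Plane :=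
  deriv V t + h.christoffelVec (c t) (deriv c t) (V t)

/-- The unit tangent vector `T` of a curve. -/
def LocalMetric.unitTangent (h : LocalMetric) (c : ℝ → Plane) (t : ℝ) : Plane :=
  (h.norm (c t) (deriv c t))⁻¹ • deriv c t

/-- The geodesic curvature vector `∇_T T` of a regular curve with an arbitrary parameter. -/
def LocalMetric.curvatureVec (h : LocalMetric) (c : ℝ → Plane) (t : ℝ) : Plane :=
  (h.norm (c t) (deriv c t))⁻¹ • h.covDeriv c (h.unitTangent c) t

/-- The geodesic curvature `κ = |∇_T T|`. -/
def LocalMetric.geodesicCurvature (h : LocalMetric) (c : ℝ → Plane) (t : ℝ) : ℝ :=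
  h.norm (c t) (h.curvatureVec c t)

/-- `λ(a, b)`: the length of the arc of `c` between the parameters `a ≤ b`. -/
def LocalMetric.arcLength (h : LocalMetric) (c : ℝ → Plane) (a b : ℝ) : ℝ :=
  ∫ t in a..b, h.norm (c t) (deriv c t)

/-- `c` is a geodesic on the set of times `I`: it stays in the coordinate domain and
`∇_{ċ} ċ = 0`, i.e. `c'' + Γ(c)(c', c') = 0`. -/
def LocalMetric.IsGeodesicOn (h : LocalMetric) (c : ℝ → Plane) (I : Set ℝ) : Prop :=
  ∀ t ∈ I, c t ∈ h.domain ∧ DifferentiableAt ℝ c t ∧ DifferentiableAt ℝ (deriv c) t ∧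
    h.covDeriv c (deriv c) t = 0

/-- There is a (small) geodesic segment from `C`, of length `ℓ ∈ (0, ε)`, with unit direction
`ζ` at `C`, which ends at the point `γ a`, `a ∈ (-ε, ε)`, and is tangent there to `γ`.
For a geodesic of unit speed the length is the elapsed time. -/
def IsTangentSegment (h : LocalMetric) (γ : ℝ → Plane) (ε : ℝ) (C : Plane) (a ℓ : ℝ)
    (ζ : Plane) : Prop :=
  a ∈ Ioo (-ε) ε ∧ ℓ ∈ Ioo 0 ε ∧ h.norm C ζ = 1 ∧
    ∃ c : ℝ → Plane, h.IsGeodesicOn c (Icc 0 ℓ) ∧ c 0 = C ∧ deriv c 0 = ζ ∧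
      c ℓ = γ a ∧ deriv c ℓ ∈ Submodule.span ℝ {deriv γ a}

/-- The parameters of the points of tangency with `γ` of the geodesics through `C` that are tangent
to `γ`. -/
def tangencySet (h : LocalMetric) (γ : ℝ → Plane) (ε : ℝ) (C : Plane) : Set ℝ :=
  {a | ∃ ℓ ζ, IsTangentSegment h γ ε C a ℓ ζ}

open Classical in
/-- The field `Λ`. At a point `C` off the curve, `Λ(C)` is the exterior bisector of the angle `ACB`
formed by the two geodesic segments `CA`, `CB` tangent to `γ` at `A ≠ B`: for unit vectors `ζ`, `ζ'`
directing the sides of an angle, the exterior bisector is the line spanned by `ζ - ζ'`.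
At a point of the curve `γ`, it is the tangent line of `γ`. -/
def bisectorField (h : LocalMetric) (γ : ℝ → Plane) (ε : ℝ) (C : Plane) : Submodule ℝ Plane :=
  if C ∈ γ '' Ioo (-ε) ε then
    Submodule.span ℝ {v | ∃ s ∈ Ioo (-ε) ε, γ s = C ∧ v = deriv γ s}
  else
    Submodule.span ℝ {v | ∃ a a' ℓ ℓ' ζ ζ', a ≠ a' ∧ IsTangentSegment h γ ε C a ℓ ζ ∧
      IsTangentSegment h γ ε C a' ℓ' ζ' ∧ v = ζ - ζ'}

open Classical in
/-- The string construction
`Γ_p = {C_{AB} | A ≠ B, |A C_{AB}| + |B C_{AB}| - λ(A, B) = p}`, where `C_{AB}` is the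
intersection point of the geodesics tangent to `γ` at `A` and `B`; and `Γ_0 = γ`. -/
def stringCurve (h : LocalMetric) (γ : ℝ → Plane) (ε p : ℝ) : Set Plane :=
  if p = 0 then γ '' Ioo (-ε) ε
  else {C | ∃ a b ℓ ℓ' ζ ζ', a < b ∧ IsTangentSegment h γ ε C a ℓ ζ ∧
    IsTangentSegment h γ ε C b ℓ' ζ' ∧ ℓ + ℓ' - h.arcLength γ a b = p}

/-- The domain `𝒰` adjacent to `γ` (near `γ 0`) from the concave side, i.e. from the side
opposite to the geodesic curvature vector. The curvature vector at `γ 0` is transversal to `γ`, so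
for small `δ` this is a one-sided open neighbourhood of a small arc of `γ`. -/
def concaveSide (h : LocalMetric) (γ : ℝ → Plane) (δ : ℝ) : Set Plane :=
  {C | ∃ s ∈ Ioo (-δ) δ, ∃ t ∈ Ioo 0 δ, C = γ s - t • h.curvatureVec γ 0}

/-- The domain `𝒰` together with its boundary arc of `γ`, as a germ `𝒰 ∪ γ`. -/
def closedConcaveSide (h : LocalMetric) (γ : ℝ → Plane) (δ : ℝ) : Set Plane :=
  {C | ∃ s ∈ Ioo (-δ) δ, ∃ t ∈ Ico 0 δ, C = γ s - t • h.curvatureVec γ 0}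

/-- `Λ` is a `C^n` line field on `S`: near each point of `S` it is generated by a non-vanishing
vector field that is `C^n` on `S`. -/
def IsLineFieldOn (n : ℕ) (Λ : Plane → Submodule ℝ Plane) (S : Set Plane) : Prop :=
  ∀ C ∈ S, ∃ X : Plane → Plane, ContDiffWithinAt ℝ n X S C ∧
    ∀ᶠ D in 𝓝[S] C, X D ≠ 0 ∧ Λ D = Submodule.span ℝ {X D}

/-- `c` is a regular `C^n` parametrization by Riemannian arc length, near `c 0 = C`, of the curve
`Γ` (as a subset, near `C`), and this curve is tangent to `Λ`. The equality of filters says that,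
for every small `η`, the arc `c (-η, η)` is contained in `Γ` and is a neighbourhood of `C` in `Γ`,
and that these arcs shrink to `C`. -/
def IsArcTangentTo (h : LocalMetric) (n : ℕ) (Λ : Plane → Submodule ℝ Plane) (Γ : Set Plane)
    (C : Plane) (c : ℝ → Plane) : Prop :=
  c 0 = C ∧ Filter.map c (𝓝 0) = 𝓝[Γ] C ∧ ContDiffAt ℝ n c 0 ∧
    ∀ᶠ t in 𝓝 (0 : ℝ), h.norm (c t) (deriv c t) = 1 ∧ deriv c t ∈ Λ (c t)

end StringFoliation

end

/-! Everything is local, so the surface becomes a plane domain with a `C^k` metric. Let `n` be the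
curvature vector at `O` and use the coordinates `(σ, t) ↦ γ(σ) - t n`, in which the concave side is
`t > 0`. The unit speed geodesic tangent to `γ` at `γ(s)` crosses the line with coordinate `σ` at a
height `t = f(s, σ)`, at a time `τ(s, σ)`, with velocity `w(s, σ)`; all three are `C^(k-1)`
(`exists_slicing`). On the diagonal `f` and `∂_σ f` vanish, and positive curvature gives `f = (s -
σ)² R` with `R(0, 0) > 0`. Hence for `t > 0` the equation `f(s, σ) = t` has exactly two small roots
`a < σ < b` (`exists_rootPair`): these are the two tangency points. The unit vectors from `C`
towards them are `-w_a` and `w_b`, so the exterior bisector is spanned by `X = w_a + w_b`.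

Off `γ` the roots are simple and `X` is `C^(k-1)` by the implicit function theorem. Up to `γ`, the
function `z = (s - σ)√R` is only `C^(k-2)`: the slope `∂_σ f` is again `C^(k-1)`, so division by the
square costs a single derivative. The roots are `z = ±√t`, so `X(σ, t) = W(σ, √t)` with `W` even in
its second variable and of class `C^(k-2)`. An even function of class `C^(2m)` is a `C^m` function
of the square (`contDiffOn_comp_sqrt`); this is the origin of the exponent `[k/2] - 1`.

Let `P(C) = |AC| + |BC| - λ(A, B)`. The Gauss lemma gives `dτ + |γ'| ds = ⟨w, dC⟩`. The displacement
of the tangency points therefore drops out and `dP = ⟨w_a - w_b, dC⟩` (`hasFDerivAt_stringLength`).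
Since `w_a` and `w_b` are unit vectors, `dP(X) = 0`, so `P` is constant along the integral curves of
`X`; moreover `P` increases strictly with `t`. A level set of `P` is thus a graph over `σ` and
agrees locally with an integral curve of the normalized field. Such a curve has one derivative more
than the field, and its derivatives are iterated derivatives of the coordinate map along the field,
evaluated at the point (`iteratedDeriv_integralCurve`); these are continuous up to `γ`. For `k < 4`
the field is only claimed to be continuous up to `γ`, so uniqueness of its integral curves there is
not available; the monotonicity of `P` replaces it. -/

noncomputable section

namespace StringFoliation

/-! ### Smoothness of superposition operators on spaces of continuous maps. -/

section Superposition

variable {K : Type} [TopologicalSpace K] [CompactSpace K]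
  {E F : Type} [NormedAddCommGroup E] [NormedAddCommGroup F]

open Classical in
/-- The superposition operator `α ↦ f ∘ α` on continuous maps. -/
def superpos (K : Type) [TopologicalSpace K] [CompactSpace K] (f : E → F) (α : C(K, E)) : C(K, F) :=
  -- The default 0 plays no role: near the base maps considered below, `f` is continuous at every
  -- point of the range, so the first branch applies.
  if h : Continuous (f ∘ α) then ⟨f ∘ α, h⟩ else 0

theorem superpos_apply {f : E → F} {α : C(K, E)} (h : ∀ θ, ContinuousAt f (α θ)) (θ : K) :
    superpos K f α θ = f (α θ) := by
  have : Continuous (f ∘ α) :=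
    continuous_iff_continuousAt.2 fun θ => (h θ).comp α.continuous.continuousAt
  simp [superpos, this]

/-- The uniform topology is the compact-open one, and `K` is itself compact, so mapping all of `K`
into an open set is an open condition. -/
theorem eventually_forall_continuousMap {α₀ : C(K, E)} {p : E → Prop}
    (h : ∀ θ, ∀ᶠ y in 𝓝 (α₀ θ), p y) : ∀ᶠ α in 𝓝 α₀, ∀ θ, p (α θ) := by
  have hU : IsOpen (interior {y | p y}) := isOpen_interior
  have := (ContinuousMap.isOpen_setOfPred_mapsTo (X := K) isCompact_univ hU).mem_nhds
    (x := α₀) (fun θ _ => mem_interior_iff_mem_nhds.2 (h θ))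
  filter_upwards [this] with α hα θ using interior_subset (hα (mem_univ θ))

/-- Continuity of `f` at each point of the compact range of `α₀` is automatically uniform along that
range. -/
theorem continuousAt_superpos {f : E → F} {α₀ : C(K, E)}
    (h : ∀ θ, ∀ᶠ y in 𝓝 (α₀ θ), ContinuousAt f y) : ContinuousAt (superpos K f) α₀ := by
  rw [Metric.continuousAt_iff']
  intro ε hε
  have hc : IsCompact (range α₀) := isCompact_range α₀.continuous
  have h1 := hc.uniformContinuousAt_of_continuousAt f
    (by rintro _ ⟨θ, rfl⟩; exact (h θ).self_of_nhds) (Metric.dist_mem_uniformity (half_pos hε))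
  obtain ⟨δ, hδ, h2⟩ := Metric.mem_uniformity_dist.1 h1
  filter_upwards [eventually_forall_continuousMap h, Metric.ball_mem_nhds α₀ hδ] with α hα hd
  refine lt_of_le_of_lt ((ContinuousMap.dist_le (half_pos hε).le).2 fun θ => ?_) (half_lt_self hε)
  rw [superpos_apply hα, superpos_apply fun θ => (h θ).self_of_nhds, dist_comm]
  exact (h2 (a := α₀ θ) (b := α θ) (by
    rw [dist_comm]; exact lt_of_le_of_lt (ContinuousMap.dist_apply_le_dist θ) hd)
    (mem_range_self θ)).le

variable [NormedSpace ℝ E] [NormedSpace ℝ F]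

/-- Pointwise application of operator-valued maps, as a bilinear map. -/
def pointwiseApply (K : Type) [TopologicalSpace K] [CompactSpace K] (E F : Type)
    [NormedAddCommGroup E] [NormedSpace ℝ E] [NormedAddCommGroup F] [NormedSpace ℝ F] :
    C(K, E →L[ℝ] F) →L[ℝ] C(K, E) →L[ℝ] C(K, F) :=
  LinearMap.mkContinuous₂
    (LinearMap.mk₂ ℝ (fun (A : C(K, E →L[ℝ] F)) (β : C(K, E)) =>
        (⟨fun θ => A θ (β θ), by fun_prop⟩ : C(K, F)))
      (fun _ _ _ => by ext; simp) (fun _ _ _ => by ext; simp)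
      (fun _ _ _ => by ext; simp) (fun _ _ _ => by ext; simp)) 1
    (fun A β => by
      refine (ContinuousMap.norm_le _ (by positivity)).2 fun θ => ?_
      simp only [LinearMap.mk₂_apply, ContinuousMap.coe_mk, one_mul]
      exact (ContinuousLinearMap.le_opNorm _ _).trans
        (mul_le_mul (A.norm_coe_le_norm θ) (β.norm_coe_le_norm θ) (norm_nonneg _)
          (by positivity)))

@[simp]
theorem pointwiseApply_apply (A : C(K, E →L[ℝ] F)) (β : C(K, E)) (θ : K) :
    pointwiseApply K E F A β θ = A θ (β θ) := rfl

/-- The mean value inequality is applied on balls around the points `α₀ θ`. Their radius can be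
chosen independent of `θ`, because `fderiv ℝ f` is uniformly continuous along the compact range, and
this makes the remainder small in sup norm. -/
theorem hasFDerivAt_superpos {f : E → F} {α₀ : C(K, E)}
    (h : ∀ θ, ∀ᶠ y in 𝓝 (α₀ θ), DifferentiableAt ℝ f y)
    (h' : ∀ θ, ∀ᶠ y in 𝓝 (α₀ θ), ContinuousAt (fderiv ℝ f) y) :
    HasFDerivAt (superpos K f) (pointwiseApply K E F (superpos K (fderiv ℝ f) α₀)) α₀ := by
  rw [hasFDerivAt_iff_isLittleO, Asymptotics.isLittleO_iff]
  intro ε hε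
  have hc : IsCompact (range α₀) := isCompact_range α₀.continuous
  have h1 := hc.uniformContinuousAt_of_continuousAt (fderiv ℝ f)
    (by rintro _ ⟨θ, rfl⟩; exact (h' θ).self_of_nhds) (Metric.dist_mem_uniformity hε)
  obtain ⟨δ, hδ, h2⟩ := Metric.mem_uniformity_dist.1 h1
  have hU : IsOpen (interior {y | DifferentiableAt ℝ f y}) := isOpen_interior
  obtain ⟨δ', hδ', h3⟩ := hc.exists_thickening_subset_open hU (by
    rintro _ ⟨θ, rfl⟩; exact mem_interior_iff_mem_nhds.2 (h θ))
  filter_upwards [eventually_forall_continuousMap h, Metric.ball_mem_nhds α₀ (lt_min hδ hδ')]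
    with α hα hd
  refine (ContinuousMap.norm_le _ (by positivity)).2 fun θ => ?_
  have hθ : ‖(α - α₀) θ‖ ≤ ‖α - α₀‖ := (α - α₀).norm_coe_le_norm θ
  have hdist : dist (α θ) (α₀ θ) < min δ δ' :=
    lt_of_le_of_lt (ContinuousMap.dist_apply_le_dist θ) hd
  simp only [ContinuousMap.sub_apply, pointwiseApply_apply]
  rw [superpos_apply (fun θ => (hα θ).continuousAt),
    superpos_apply (fun θ => (h θ).self_of_nhds.continuousAt),
    superpos_apply (fun θ => (h' θ).self_of_nhds)]
  refine le_trans ?_ (mul_le_mul_of_nonneg_left hθ hε.le)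
  refine Convex.norm_image_sub_le_of_norm_hasFDerivWithin_le' (s := Metric.ball (α₀ θ) (min δ δ'))
    (f' := fderiv ℝ f) (fun y hy => ?_) (fun y hy => ?_) (convex_ball _ _)
    (Metric.mem_ball_self (lt_min hδ hδ')) hdist
  · have : y ∈ Metric.thickening δ' (range α₀) :=
      Metric.mem_thickening_iff.2 ⟨α₀ θ, mem_range_self θ, lt_of_lt_of_le hy (min_le_right _ _)⟩
    exact (interior_subset (h3 this)).hasFDerivAt.hasFDerivWithinAt
  · rw [← dist_eq_norm, dist_comm]
    exact (h2 (a := α₀ θ) (b := y) (by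
      rw [dist_comm]; exact lt_of_lt_of_le hy (min_le_left _ _)) (mem_range_self θ)).le

/-- Induction on `n`: the derivative is the superposition operator of `fderiv ℝ f`, one order less
smooth, followed by the fixed bounded linear map `pointwiseApply`. The target space varies in the
induction because `fderiv ℝ f` is operator valued. -/
theorem contDiffAt_superpos (n : ℕ) {F : Type} [NormedAddCommGroup F] [NormedSpace ℝ F]
    {f : E → F} {α₀ : C(K, E)} (h : ∀ θ, ContDiffAt ℝ n f (α₀ θ)) :
    ContDiffAt ℝ n (superpos K f) α₀ := by
  induction n generalizing F α₀ with
  | zero =>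
    have hev : ∀ θ, ∀ᶠ y in 𝓝 (α₀ θ), ∀ᶠ z in 𝓝 y, ContinuousAt f z := fun θ =>
      (((h θ).eventually (by simp)).mono fun y hy => hy.continuousAt).eventually_nhds
    refine contDiffAt_zero.2 ⟨_, eventually_forall_continuousMap hev, fun α hα => ?_⟩
    exact (continuousAt_superpos hα).continuousWithinAt
  | succ n ih =>
    have hev : ∀ θ, ∀ᶠ y in 𝓝 (α₀ θ), ContDiffAt ℝ (n + 1 : ℕ) f y := fun θ =>
      (h θ).eventually (by simp)
    push_cast
    refine (contDiffAt_succ_iff_hasFDerivAt).2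
      ⟨fun α => pointwiseApply K E F (superpos K (fderiv ℝ f) α), ?_, ?_⟩
    · refine ⟨_, eventually_forall_continuousMap fun θ => (hev θ).eventually_nhds, fun α hα => ?_⟩
      refine hasFDerivAt_superpos (fun θ => (hα θ).mono fun y hy => ?_)
        (fun θ => (hα θ).mono fun y hy => ?_)
      · exact hy.differentiableAt (by simp)
      · exact (hy.fderiv_right (m := n) (by simp)).continuousAt
    · exact (pointwiseApply K E F).contDiff.contDiffAt.comp α₀
        (ih fun θ => (h θ).fderiv_right (by simp))

end Superposition

/-! ### Integrals depending on a parameter. -/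

section ParametricIntegral

open unitInterval

variable {P E : Type} [NormedAddCommGroup P] [NormedSpace ℝ P]
  [NormedAddCommGroup E] [NormedSpace ℝ E] [CompleteSpace E]

/-- The primitive `θ ↦ ∫₀^θ α` of a continuous function on the unit interval. -/
def primitive (E : Type) [NormedAddCommGroup E] [NormedSpace ℝ E] [CompleteSpace E] :
    C(I, E) →L[ℝ] C(I, E) :=
  LinearMap.mkContinuous
    { toFun := fun α => ⟨fun θ => ∫ s in (0 : ℝ)..θ, IccExtend zero_le_one α s, by
        have := intervalIntegral.continuous_primitive (μ := MeasureTheory.volume)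
          (f := IccExtend zero_le_one α)
          (fun a b => (Continuous.Icc_extend' α.continuous).intervalIntegrable a b) 0
        exact this.comp continuous_subtype_val⟩
      map_add' := fun α β => by
        ext θ
        simp only [ContinuousMap.coe_mk, ContinuousMap.add_apply]
        rw [← intervalIntegral.integral_add
          ((Continuous.Icc_extend' α.continuous).intervalIntegrable _ _)
          ((Continuous.Icc_extend' β.continuous).intervalIntegrable _ _)]
        rfl
      map_smul' := fun c α => by
        ext θ
        simp only [ContinuousMap.coe_mk, ContinuousMap.smul_apply, RingHom.id_apply]
        rw [← intervalIntegral.integral_smul]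
        rfl } 1
    (fun α => by
      refine (ContinuousMap.norm_le _ (by positivity)).2 fun θ => ?_
      have := intervalIntegral.norm_integral_le_of_norm_le_const (a := 0) (b := θ) (C := ‖α‖)
        (f := IccExtend zero_le_one α) (fun s _ => α.norm_coe_le_norm _)
      refine this.trans ?_
      rw [sub_zero, abs_of_nonneg θ.2.1, mul_comm]
      exact mul_le_mul_of_nonneg_right θ.2.2 (norm_nonneg _))

theorem primitive_apply (α : C(I, E)) (θ : I) :
    primitive E α θ = ∫ s in (0 : ℝ)..θ, IccExtend zero_le_one α s := rfl

/-- The integral is a composition of an affine map `p ↦ (θ ↦ (θ, p))`, the superposition operator of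
`H`, and the bounded linear map of integration; only the middle one limits the smoothness. -/
theorem contDiffAt_parametric_integral {n : ℕ} {H : ℝ × P → E} {p₀ : P}
    (h : ∀ θ ∈ Icc (0 : ℝ) 1, ContDiffAt ℝ n H (θ, p₀)) :
    ContDiffAt ℝ n (fun p => ∫ θ in (0 : ℝ)..1, H (θ, p)) p₀ := by
  let A : P → C(I, ℝ × P) := fun p => ⟨fun θ => ((θ : ℝ), p), by fun_prop⟩
  have hA : ContDiff ℝ n A := by
    let L : P →L[ℝ] C(I, ℝ × P) := LinearMap.mkContinuous
      { toFun := fun p => ⟨fun _ => ((0 : ℝ), p), by fun_prop⟩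
        map_add' := fun _ _ => by ext <;> simp
        map_smul' := fun _ _ => by ext <;> simp } 1
      (fun p => (ContinuousMap.norm_le _ (by positivity)).2 fun θ => by simp [Prod.norm_def])
    have : A = fun p => A 0 + L p := by
      funext p; ext θ <;> simp [A, L]
    rw [this]
    exact contDiff_const.add L.contDiff
  have h1 : ContDiffAt ℝ n (fun p => primitive E (superpos I H (A p)) 1) p₀ := by
    have h2 : ContDiffAt ℝ n (superpos I H) (A p₀) := contDiffAt_superpos n fun θ => h θ θ.2
    have h3 : ContDiffAt ℝ n (fun p => superpos I H (A p)) p₀ := h2.comp p₀ hA.contDiffAt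
    have h4 := (primitive E).contDiff.contDiffAt.comp p₀ h3
    exact (ContinuousMap.evalCLM ℝ (1 : I)).contDiff.contDiffAt.comp p₀ h4
  refine h1.congr_of_eventuallyEq ?_
  have hev : ∀ᶠ α in 𝓝 (A p₀), ∀ θ, ContinuousAt H (α θ) :=
    eventually_forall_continuousMap fun θ =>
      ((h θ θ.2).eventually (by simp)).mono fun y hy => hy.continuousAt
  filter_upwards [hA.continuous.continuousAt.eventually hev] with p hp
  rw [primitive_apply]
  refine intervalIntegral.integral_congr fun s hs => ?_
  replace hs : s ∈ Icc (0 : ℝ) 1 := by simpa [uIcc_of_le] using hs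
  simp only [IccExtend_of_mem zero_le_one _ hs]
  rw [superpos_apply hp]
  rfl

end ParametricIntegral

/-! ### Smooth dependence of a flow on its initial point. -/

section Flow

open unitInterval

variable {E : Type} [NormedAddCommGroup E] [NormedSpace ℝ E] [CompleteSpace E]

/-- The rescaled trajectory `α(θ) = φ(x, θ t)` solves `α = x + t ∫ Y ∘ α` in a fixed Banach space of
curves, an equation of class `C^n` in `(x, t, α)`. Picard–Lindelöf supplies a continuous flow, and
the implicit function theorem upgrades its regularity. -/
theorem exists_contDiffAt_flow {Y : E → E} {x₀ : E} {n : ℕ} (hn : 1 ≤ n)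
    (hY : ContDiffAt ℝ n Y x₀) :
    ∃ φ : E × ℝ → E, ContDiffAt ℝ n φ (x₀, 0) ∧
      ∀ᶠ p in 𝓝 (x₀, (0 : ℝ)), φ (p.1, 0) = p.1 ∧
        HasDerivAt (fun t => φ (p.1, t)) (Y (φ p)) p.2 := by
  have hn0 : ((n : ℕ) : ℕ∞ω) ≠ 0 := by
    have : n ≠ 0 := by omega
    exact_mod_cast this
  have hY1 : ContDiffAt ℝ 1 Y x₀ := hY.of_le (by exact_mod_cast hn)
  obtain ⟨e, he, a, r, L, K, hr, hpl⟩ := IsPicardLindelof.of_contDiffAt_one hY1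
  obtain ⟨φ, hφ, hφc⟩ := (hpl 0).exists_forall_mem_closedBall_eq_hasDerivWithinAt_continuousOn
  simp only [zero_sub, zero_add] at hφ hφc
  have hr' : (0 : ℝ) < r := hr
  have hx₀ : x₀ ∈ Metric.closedBall x₀ (r : ℝ) := Metric.mem_closedBall_self hr'.le
  have hφ0 : φ (x₀, 0) = x₀ := (hφ x₀ hx₀).1
  have hnhds : Metric.closedBall x₀ (r : ℝ) ×ˢ Icc (-e) e ∈ 𝓝 (x₀, (0 : ℝ)) :=
    prod_mem_nhds (Metric.closedBall_mem_nhds _ hr') (Icc_mem_nhds (by linarith) he)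
  have hφca : ContinuousAt φ (x₀, 0) := hφc.continuousAt hnhds
  -- the equation of which the rescaled flow is the implicit function
  let Φ : (E × ℝ) × C(I, E) → C(I, E) := fun v =>
    v.2 - ContinuousMap.const I v.1.1 - v.1.2 • primitive E (superpos I Y v.2)
  let c₀ : C(I, E) := ContinuousMap.const I x₀
  have hcst : ContDiff ℝ n (fun x : E => (ContinuousMap.const I x : C(I, E))) := by
    let T : E →L[ℝ] C(I, E) := LinearMap.mkContinuous
      { toFun := fun x => ContinuousMap.const I x
        map_add' := fun _ _ => rfl
        map_smul' := fun _ _ => rfl } 1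
      (fun x => (ContinuousMap.norm_le _ (by positivity)).2 fun θ => by rw [one_mul]; exact le_rfl)
    exact T.contDiff
  have hsup : ContDiffAt ℝ n (superpos I Y) c₀ := contDiffAt_superpos n fun θ => hY
  have hΦ : ContDiffAt ℝ n Φ ((x₀, 0), c₀) := by
    have h2 : ContDiffAt ℝ n (fun v : (E × ℝ) × C(I, E) => superpos I Y v.2) ((x₀, 0), c₀) :=
      ContDiffAt.comp (x := ((x₀, (0 : ℝ)), c₀)) (g := superpos I Y) (f := Prod.snd) hsup
        contDiffAt_snd
    have h3 : ContDiffAt ℝ n (fun v : (E × ℝ) × C(I, E) => primitive E (superpos I Y v.2))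
        ((x₀, 0), c₀) := (primitive E).contDiff.contDiffAt.comp _ h2
    have h4 : ContDiffAt ℝ n (fun v : (E × ℝ) × C(I, E) =>
        (ContinuousMap.const I v.1.1 : C(I, E))) ((x₀, 0), c₀) :=
      hcst.contDiffAt.comp ((x₀, (0 : ℝ)), c₀) (contDiffAt_fst.comp _ contDiffAt_fst)
    exact (contDiffAt_snd.sub h4).sub
      ((contDiffAt_snd.comp ((x₀, (0 : ℝ)), c₀) contDiffAt_fst).smul h3)
  -- At `t = 0` the integral term disappears, so the partial derivative in the curve is the identity
  -- and nothing has to be estimated.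
  have hinr : fderiv ℝ Φ ((x₀, 0), c₀) ∘L .inr ℝ (E × ℝ) C(I, E) = ContinuousLinearMap.id ℝ _ := by
    have h1 : HasFDerivAt Φ (fderiv ℝ Φ ((x₀, 0), c₀)) ((x₀, (0 : ℝ)), c₀) :=
      (hΦ.differentiableAt hn0).hasFDerivAt
    have h2 := h1.comp c₀ (hasFDerivAt_prodMk_right (x₀, (0 : ℝ)) c₀)
    have h3 : Φ ∘ (fun y => ((x₀, (0 : ℝ)), y)) = fun y => y - c₀ := by
      funext y; simp [Φ, c₀]
    rw [h3] at h2
    exact h2.unique ((hasFDerivAt_id c₀).sub_const c₀)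
  have hinv : (fderiv ℝ Φ ((x₀, 0), c₀) ∘L .inr ℝ (E × ℝ) C(I, E)).IsInvertible := by
    rw [hinr]; exact ⟨ContinuousLinearEquiv.refl ℝ _, rfl⟩
  have hψ := hΦ.contDiffAt_implicitFunction hn0 hinv
  have hiff := hΦ.eventually_apply_eq_iff_implicitFunction hn0 hinv
  set ψ := hΦ.implicitFunction hn0 hinv
  have hΦ0 : Φ ((x₀, 0), c₀) = 0 := by simp [Φ, c₀]
  rw [hΦ0] at hiff
  -- the rescaled flow
  open Classical in
  let A : E × ℝ → C(I, E) := fun p =>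
    if h : Continuous (fun θ : I => φ (p.1, θ * p.2)) then ⟨_, h⟩ else 0
  have hmem : ∀ p ∈ Metric.closedBall x₀ (r : ℝ) ×ˢ Icc (-e) e, ∀ θ ∈ Icc (0 : ℝ) 1,
      θ * p.2 ∈ Icc (-e) e := by
    rintro p ⟨-, hp⟩ θ ⟨h0, h1⟩
    have := abs_le.2 ⟨hp.1, hp.2⟩
    refine abs_le.1 ?_
    rw [abs_mul, abs_of_nonneg h0]
    nlinarith [abs_nonneg p.2]
  have hcon : ∀ p ∈ Metric.closedBall x₀ (r : ℝ) ×ˢ Icc (-e) e,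
      ContinuousOn (fun θ : ℝ => φ (p.1, θ * p.2)) (Icc 0 1) := by
    intro p hp
    exact hφc.comp (by fun_prop) fun θ hθ => ⟨hp.1, hmem p hp θ hθ⟩
  have hA : ∀ p ∈ Metric.closedBall x₀ (r : ℝ) ×ˢ Icc (-e) e, ∀ θ : I,
      A p θ = φ (p.1, θ * p.2) := by
    intro p hp θ
    have : Continuous (fun θ : I => φ (p.1, θ * p.2)) :=
      (hcon p hp).comp_continuous continuous_subtype_val fun θ => θ.2
    simp only [A, this, dite_true]
    rfl
  have hsmall : ∀ U ∈ 𝓝 x₀, ∀ᶠ p in 𝓝 (x₀, (0 : ℝ)), ∀ θ ∈ Icc (0 : ℝ) 1,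
      φ (p.1, θ * p.2) ∈ U := by
    intro U hU
    have h1 : ∀ᶠ q in 𝓝 (x₀, (0 : ℝ)), φ q ∈ U := hφca (by rwa [hφ0])
    obtain ⟨δ, hδ, h2⟩ := Metric.eventually_nhds_iff_ball.1 h1
    filter_upwards [Metric.ball_mem_nhds _ hδ] with p hp θ hθ
    refine h2 _ ?_
    rw [← ball_prod_same] at hp ⊢
    refine ⟨hp.1, ?_⟩
    have := hp.2
    simp only [Metric.mem_ball, dist_zero_right, Real.norm_eq_abs, abs_mul] at this ⊢
    rw [abs_of_nonneg hθ.1]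
    nlinarith [abs_nonneg p.2, hθ.2]
  have hAt : Tendsto A (𝓝 (x₀, 0)) (𝓝 c₀) := by
    rw [Metric.tendsto_nhds]
    intro η hη
    filter_upwards [hsmall _ (Metric.ball_mem_nhds x₀ (half_pos hη)), hnhds] with p hp hp'
    refine lt_of_le_of_lt ((ContinuousMap.dist_le (half_pos hη).le).2 fun θ => ?_) (half_lt_self hη)
    rw [hA p hp' θ]
    exact (hp θ θ.2).le
  have hcontY : ∀ᶠ y in 𝓝 x₀, ContinuousAt Y y :=
    (hY.eventually (by simp)).mono fun y hy => hy.continuousAt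
  -- The flow satisfies the integral equation: integrate `d/ds φ(x, s t) = t Y(φ(x, s t))` from 0 to
  -- `θ`.
  have hzero : ∀ᶠ p in 𝓝 (x₀, (0 : ℝ)), Φ (p, A p) = 0 := by
    have hIoo : ∀ᶠ p in 𝓝 (x₀, (0 : ℝ)), p.2 ∈ Ioo (-e) e :=
      continuousAt_snd.eventually (Ioo_mem_nhds (by simpa using he) he)
    filter_upwards [hsmall _ hcontY, hnhds, hIoo] with p hp hp' hp2
    ext θ
    have hYA : ∀ θ, ContinuousAt Y (A p θ) := fun θ => by rw [hA p hp' θ]; exact hp θ θ.2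
    have hd : ∀ s ∈ uIcc (0 : ℝ) θ, HasDerivAt (fun s => φ (p.1, s * p.2))
        (p.2 • Y (φ (p.1, s * p.2))) s := by
      intro s hs
      rw [uIcc_of_le θ.2.1] at hs
      have hs' : s * p.2 ∈ Ioo (-e) e := by
        have := abs_lt.2 ⟨hp2.1, hp2.2⟩
        refine abs_lt.1 ?_
        rw [abs_mul, abs_of_nonneg hs.1]
        nlinarith [abs_nonneg p.2, hs.2.trans θ.2.2]
      have h1 := ((hφ p.1 hp'.1).2 (s * p.2) (Ioo_subset_Icc_self hs')).hasDerivAt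
        (Icc_mem_nhds hs'.1 hs'.2)
      have h2 : HasDerivAt (fun s : ℝ => s * p.2) p.2 s := by
        simpa using (hasDerivAt_id s).mul_const p.2
      exact h1.scomp s h2
    have hint : ContinuousOn (fun s => p.2 • Y (φ (p.1, s * p.2))) (uIcc (0 : ℝ) θ) := by
      rw [uIcc_of_le θ.2.1]
      refine continuousOn_const.smul fun s hs => ?_
      have hs1 : s ∈ Icc (0 : ℝ) 1 := ⟨hs.1, hs.2.trans θ.2.2⟩
      exact ContinuousAt.comp_continuousWithinAt (hp s hs1)
        ((hcon p hp').mono (Icc_subset_Icc_right θ.2.2) s hs)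
    have h1 := intervalIntegral.integral_eq_sub_of_hasDerivAt hd hint.intervalIntegrable
    rw [intervalIntegral.integral_smul] at h1
    simp only [Φ, ContinuousMap.sub_apply, ContinuousMap.const_apply, ContinuousMap.smul_apply,
      primitive_apply, ContinuousMap.zero_apply]
    have h2 : ∫ s in (0 : ℝ)..θ, IccExtend zero_le_one (superpos I Y (A p)) s =
        ∫ s in (0 : ℝ)..θ, Y (φ (p.1, s * p.2)) := by
      refine intervalIntegral.integral_congr fun s hs => ?_
      rw [uIcc_of_le θ.2.1] at hs
      have hs1 : s ∈ Icc (0 : ℝ) 1 := ⟨hs.1, hs.2.trans θ.2.2⟩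
      simp only [IccExtend_of_mem zero_le_one _ hs1]
      rw [superpos_apply hYA, hA p hp']
    rw [h2, h1, hA p hp' θ]
    simp [(hφ p.1 hp'.1).1]
  -- The rescaled flow is uniformly close to the constant curve, where the implicit function is the
  -- only solution.
  have hev : ∀ᶠ p in 𝓝 (x₀, (0 : ℝ)), ψ p = A p := by
    have h1 : Tendsto (fun p => (p, A p)) (𝓝 (x₀, (0 : ℝ))) (𝓝 ((x₀, 0), c₀)) :=
      tendsto_id.prodMk_nhds hAt
    filter_upwards [h1.eventually hiff, hzero] with p hp h0 using hp.1 h0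
  refine ⟨φ, ?_, ?_⟩
  · have heval : ContDiff ℝ n (fun α : C(I, E) => α 1) :=
      (ContinuousMap.evalCLM (M := E) ℝ (1 : I)).contDiff
    have h1 : ContDiffAt ℝ n (fun p => ψ p 1) (x₀, 0) :=
      ContDiffAt.comp (g := fun α : C(I, E) => α 1) (x₀, (0 : ℝ))
        heval.contDiffAt hψ
    refine h1.congr_of_eventuallyEq ?_
    filter_upwards [hev, hnhds] with p hp hp'
    rw [hp, hA p hp']
    simp
  · have h1 : Metric.closedBall x₀ (r : ℝ) ×ˢ Ioo (-e) e ∈ 𝓝 (x₀, (0 : ℝ)) :=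
      prod_mem_nhds (Metric.closedBall_mem_nhds _ hr') (Ioo_mem_nhds (by linarith) he)
    filter_upwards [h1] with p hp
    exact ⟨(hφ p.1 hp.1).1, ((hφ p.1 hp.1).2 p.2 (Ioo_subset_Icc_self hp.2)).hasDerivAt
      (Icc_mem_nhds hp.2.1 hp.2.2)⟩

end Flow

/-! ### Even functions as smooth functions of the square. -/

section EvenFunction

variable {E : Type} [NormedAddCommGroup E] [NormedSpace ℝ E] [CompleteSpace E]

/-- Composition of a `C^{2m}` function, even in its second variable, with the square root. -/
theorem contDiffOn_comp_sqrt (m : ℕ) {η : ℝ} {W : ℝ × ℝ → E}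
    (hW : ContDiffOn ℝ (2 * m : ℕ) W (Ioo (-η) η ×ˢ Ioo (-η) η))
    (heven : ∀ σ ∈ Ioo (-η) η, ∀ z ∈ Ioo (-η) η, W (σ, -z) = W (σ, z)) :
    ContDiffOn ℝ m (fun q : ℝ × ℝ => W (q.1, √q.2)) (Ioo (-η) η ×ˢ Ico 0 (η ^ 2)) := by
  have hsqrt : ∀ η' : ℝ, 0 < η' → ∀ t ∈ Ico 0 (η' ^ 2), √t ∈ Ioo (-η') η' := by
    intro η' hη' t ht
    exact ⟨by linarith [Real.sqrt_nonneg t], (Real.sqrt_lt' hη').2 ht.2⟩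
  rcases le_or_gt η 0 with hη | hη
  · rw [Ioo_eq_empty (by linarith), empty_prod]; exact contDiffOn_empty
  have hmaps : MapsTo (fun q : ℝ × ℝ => (q.1, √q.2)) (Ioo (-η) η ×ˢ Ico 0 (η ^ 2))
      (Ioo (-η) η ×ˢ Ioo (-η) η) := fun q hq => ⟨hq.1, hsqrt η hη _ hq.2⟩
  have hopen : IsOpen (Ioo (-η) η ×ˢ Ioo (-η) η) := isOpen_Ioo.prod isOpen_Ioo
  induction m generalizing W with
  | zero =>
    have h0 := hW.continuousOn.comp (f := fun q : ℝ × ℝ => (q.1, √q.2)) (by fun_prop) hmaps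
    exact contDiffOn_zero.2 h0
  | succ m ih =>
    have hWat : ∀ q ∈ Ioo (-η) η ×ˢ Ioo (-η) η, ContDiffAt ℝ (2 * (m + 1) : ℕ) W q := fun q hq =>
      (hW q hq).contDiffAt (hopen.mem_nhds hq)
    have hWd : ∀ q ∈ Ioo (-η) η ×ˢ Ioo (-η) η, HasFDerivAt W (fderiv ℝ W q) q := fun q hq =>
      ((hWat q hq).differentiableAt (by simp)).hasFDerivAt
    have hdW : ∀ q ∈ Ioo (-η) η ×ˢ Ioo (-η) η, ContDiffAt ℝ (2 * m + 1 : ℕ) (fderiv ℝ W) q :=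
      fun q hq => (hWat q hq).fderiv_right (by norm_cast)
    -- For `Q(σ, t) = W(σ, √t)` the partial derivatives are `A(σ, √t)` and `½ B(σ, √t)`, where `∂_z
    -- W = z B`. Both `A` and `B` are even and at least `C^(2m)`, so the induction hypothesis
    -- applies to each of them.
    let A : ℝ × ℝ → E := fun q => fderiv ℝ W q (1, 0)
    let g : ℝ × ℝ → E := fun q => fderiv ℝ W q (0, 1)
    let B : ℝ × ℝ → E := fun q => ∫ θ in (0 : ℝ)..1, fderiv ℝ g (q.1, θ * q.2) (0, 1)
    have hA : ∀ q ∈ Ioo (-η) η ×ˢ Ioo (-η) η, ContDiffAt ℝ (2 * m + 1 : ℕ) A q :=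
      fun q hq => (hdW q hq).clm_apply contDiffAt_const
    have hg : ∀ q ∈ Ioo (-η) η ×ˢ Ioo (-η) η, ContDiffAt ℝ (2 * m + 1 : ℕ) g q :=
      fun q hq => (hdW q hq).clm_apply contDiffAt_const
    have hneg : ∀ z ∈ Ioo (-η) η, -z ∈ Ioo (-η) η := fun z hz => ⟨by linarith [hz.2], by
      linarith [hz.1]⟩
    have hscale : ∀ θ ∈ Icc (0 : ℝ) 1, ∀ z ∈ Ioo (-η) η, θ * z ∈ Ioo (-η) η := by
      intro θ hθ z hz
      have := abs_lt.2 ⟨hz.1, hz.2⟩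
      refine abs_lt.1 ?_
      rw [abs_mul, abs_of_nonneg hθ.1]
      nlinarith [abs_nonneg z, hθ.2]
    have hdg : ∀ q ∈ Ioo (-η) η ×ˢ Ioo (-η) η,
        ContDiffAt ℝ (2 * m : ℕ) (fun q => fderiv ℝ g q (0, 1)) q := fun q hq =>
      ((hg q hq).fderiv_right (m := (2 * m : ℕ)) (by norm_cast)).clm_apply contDiffAt_const
    have hB : ∀ q ∈ Ioo (-η) η ×ˢ Ioo (-η) η, ContDiffAt ℝ (2 * m : ℕ) B q := by
      intro q hq
      refine contDiffAt_parametric_integral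
        (H := fun v : ℝ × (ℝ × ℝ) => fderiv ℝ g (v.2.1, v.1 * v.2.2) (0, 1)) fun θ hθ => ?_
      refine ContDiffAt.comp (g := fun q => fderiv ℝ g q (0, 1)) (θ, q)
        (f := fun v : ℝ × (ℝ × ℝ) => (v.2.1, v.1 * v.2.2)) ?_ (by fun_prop)
      exact hdg _ ⟨hq.1, hscale θ hθ _ hq.2⟩
    have hAeven : ∀ σ ∈ Ioo (-η) η, ∀ z ∈ Ioo (-η) η, fderiv ℝ W (σ, -z) (1, 0) =
        fderiv ℝ W (σ, z) (1, 0) ∧ fderiv ℝ W (σ, -z) (0, 1) = - fderiv ℝ W (σ, z) (0, 1) := by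
      intro σ hσ z hz
      let R : ℝ × ℝ →L[ℝ] ℝ × ℝ :=
        (ContinuousLinearMap.fst ℝ ℝ ℝ).prod (-ContinuousLinearMap.snd ℝ ℝ ℝ)
      have h1 : HasFDerivAt (W ∘ R) ((fderiv ℝ W (σ, -z)).comp R) (σ, z) :=
        HasFDerivAt.comp (σ, z) (g := W) (hWd (σ, -z) ⟨hσ, hneg z hz⟩) R.hasFDerivAt
      have h2 : HasFDerivAt (W ∘ R) (fderiv ℝ W (σ, z)) (σ, z) := by
        refine (hWd (σ, z) ⟨hσ, hz⟩).congr_of_eventuallyEq ?_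
        filter_upwards [hopen.mem_nhds ⟨hσ, hz⟩] with q hq using heven q.1 hq.1 q.2 hq.2
      have h3 := h1.unique h2
      rw [← h3]
      refine ⟨by simp [R], ?_⟩
      have : R (0, 1) = -(0, 1) := by simp [R]
      rw [ContinuousLinearMap.comp_apply, this, map_neg, neg_neg]
    have hg0 : ∀ σ ∈ Ioo (-η) η, g (σ, 0) = 0 := by
      intro σ hσ
      have h := (hAeven σ hσ 0 ⟨by linarith, hη⟩).2
      rw [neg_zero] at h
      have h2 : (2 : ℝ) • g (σ, 0) = 0 := by
        rw [two_smul]; nth_rewrite 1 [show g (σ, 0) = -g (σ, 0) from h]; simp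
      exact (smul_eq_zero.1 h2).resolve_left two_ne_zero
    -- Hadamard's lemma for `g = ∂_z W`, which is odd in `z` and so vanishes at `z = 0`.
    have hgB : ∀ q ∈ Ioo (-η) η ×ˢ Ioo (-η) η, g q = q.2 • B q := by
      intro q hq
      have hd : ∀ θ ∈ uIcc (0 : ℝ) 1, HasDerivAt (fun θ => g (q.1, θ * q.2))
          (q.2 • fderiv ℝ g (q.1, θ * q.2) (0, 1)) θ := by
        intro θ hθ
        rw [uIcc_of_le zero_le_one] at hθ
        have h1 : HasFDerivAt g (fderiv ℝ g (q.1, θ * q.2)) (q.1, θ * q.2) :=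
          ((hg (q.1, θ * q.2) ⟨hq.1, hscale θ hθ _ hq.2⟩).differentiableAt (by simp)).hasFDerivAt
        have h2 : HasDerivAt (fun θ : ℝ => (q.1, θ * q.2)) ((0 : ℝ), q.2) θ :=
          (hasDerivAt_const θ q.1).prodMk (by simpa using (hasDerivAt_id θ).mul_const q.2)
        have h3 := h1.comp_hasDerivAt θ h2
        have h4 : ((0 : ℝ), q.2) = q.2 • ((0 : ℝ), (1 : ℝ)) := by simp
        rw [h4, map_smul] at h3
        exact h3
      have hc : ContinuousOn (fun θ => q.2 • fderiv ℝ g (q.1, θ * q.2) (0, 1)) (uIcc (0 : ℝ) 1) := by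
        rw [uIcc_of_le zero_le_one]
        refine continuousOn_const.smul fun θ hθ => ?_
        exact ContinuousAt.comp_continuousWithinAt (g := fun q => fderiv ℝ g q (0, 1))
          (f := fun θ => (q.1, θ * q.2)) (hdg (q.1, θ * q.2) ⟨hq.1, hscale θ hθ _ hq.2⟩).continuousAt
          (by fun_prop)
      have h1 := intervalIntegral.integral_eq_sub_of_hasDerivAt hd hc.intervalIntegrable
      rw [intervalIntegral.integral_smul] at h1
      simp only [one_mul, zero_mul, hg0 _ hq.1, sub_zero] at h1
      exact h1.symm
    have hBeven : ∀ σ ∈ Ioo (-η) η, ∀ z ∈ Ioo (-η) η, B (σ, -z) = B (σ, z) := by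
      intro σ hσ z hz
      -- The identity `g = z B` determines `B` only for `z ≠ 0`; at `z = 0` evenness is trivial.
      rcases eq_or_ne z 0 with rfl | hz0
      · simp
      have h1 := hgB (σ, -z) ⟨hσ, hneg z hz⟩
      have h2 := hgB (σ, z) ⟨hσ, hz⟩
      have h3 : g (σ, -z) = - g (σ, z) := (hAeven σ hσ z hz).2
      rw [h1, h2] at h3
      simp only [neg_smul, neg_inj] at h3
      exact smul_right_injective E hz0 h3
    have ihA := ih (W := A) (fun q hq => ((hA q hq).of_le (by norm_cast; omega)).contDiffWithinAt)
      (fun σ hσ z hz => (hAeven σ hσ z hz).1)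
    have ihB := ih (W := B) (fun q hq => (hB q hq).contDiffWithinAt) hBeven
    let Q' : ℝ × ℝ → ℝ × ℝ →L[ℝ] E := fun q =>
      (ContinuousLinearMap.fst ℝ ℝ ℝ).smulRight (A (q.1, √q.2)) +
      (ContinuousLinearMap.snd ℝ ℝ ℝ).smulRight ((1 / 2 : ℝ) • B (q.1, √q.2))
    have hQ' : ContDiffOn ℝ m Q' (Ioo (-η) η ×ˢ Ico 0 (η ^ 2)) :=
      (contDiffOn_const.smulRight ihA).add (contDiffOn_const.smulRight (contDiffOn_const.smul ihB))
    have hQcont : ContinuousOn (fun q : ℝ × ℝ => W (q.1, √q.2)) (Ioo (-η) η ×ˢ Ico 0 (η ^ 2)) :=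
      hW.continuousOn.comp (f := fun q : ℝ × ℝ => (q.1, √q.2)) (by fun_prop) hmaps
    have hint : ∀ q ∈ Ioo (-η) η ×ˢ Ioo 0 (η ^ 2),
        HasFDerivAt (fun q : ℝ × ℝ => W (q.1, √q.2)) (Q' q) q := by
      intro q hq
      have hq' := hmaps ⟨hq.1, Ioo_subset_Ico_self hq.2⟩
      have hpos : 0 < √q.2 := Real.sqrt_pos.2 hq.2.1
      have h1 : HasFDerivAt (fun q : ℝ × ℝ => (q.1, √q.2))
          ((ContinuousLinearMap.fst ℝ ℝ ℝ).prod
            ((1 / (2 * √q.2)) • ContinuousLinearMap.snd ℝ ℝ ℝ)) q :=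
        hasFDerivAt_fst.prodMk (hasFDerivAt_snd.sqrt hq.2.1.ne')
      have h2 := (hWd _ hq').comp q h1
      refine h2.congr_fderiv ?_
      refine ContinuousLinearMap.ext fun v => ?_
      have h3 : fderiv ℝ W (q.1, √q.2) (0, 1) = √q.2 • B (q.1, √q.2) := hgB _ hq'
      have h4 : (v.1, 1 / (2 * √q.2) * v.2) =
          v.1 • ((1 : ℝ), (0 : ℝ)) + (1 / (2 * √q.2) * v.2) • ((0 : ℝ), (1 : ℝ)) := by simp
      simp only [ContinuousLinearMap.comp_apply, ContinuousLinearMap.prod_apply,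
        ContinuousLinearMap.coe_fst', smul_apply,
        ContinuousLinearMap.coe_snd', smul_eq_mul, Q', add_apply,
        ContinuousLinearMap.smulRight_apply]
      rw [h4, map_add, map_smul, map_smul, h3, smul_smul, smul_smul]
      congr 2
      field_simp
    have hud : UniqueDiffOn ℝ (Ioo (-η) η ×ˢ Ico 0 (η ^ 2)) :=
      (uniqueDiffOn_Ioo _ _).prod (uniqueDiffOn_Ico _ _)
    push_cast
    refine (contDiffOn_succ_iff_hasFDerivWithinAt_of_uniqueDiffOn hud).2 ⟨by simp, Q', hQ', ?_⟩
    rintro ⟨σ, t⟩ hq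
    rcases hq.2.1.eq_or_lt with ht | ht
    -- At a boundary point differentiability follows from the extension theorem: `Q` is continuous
    -- up to `t = 0` and its interior derivative has the limit `Q'`. The box is shrunk so that its
    -- closure stays in the domain.
    · obtain ⟨η', h1, h2⟩ := exists_between (abs_lt.2 ⟨hq.1.1, hq.1.2⟩)
      have hη' : 0 < η' := (abs_nonneg _).trans_lt h1
      have hη2 : η' ^ 2 < η ^ 2 := by nlinarith
      have hcl : closure (Ioo (-η') η' ×ˢ Ioo 0 (η' ^ 2)) = Icc (-η') η' ×ˢ Icc 0 (η' ^ 2) := by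
        rw [closure_prod_eq, closure_Ioo (by linarith), closure_Ioo (by positivity)]
      have hsub : Icc (-η') η' ×ˢ Icc 0 (η' ^ 2) ⊆ Ioo (-η) η ×ˢ Ico 0 (η ^ 2) := by
        rintro ⟨a, b⟩ ⟨ha, hb⟩
        exact ⟨⟨by linarith [ha.1], by linarith [ha.2]⟩, hb.1, by linarith [hb.2]⟩
      have hsub' : Ioo (-η') η' ×ˢ Ioo 0 (η' ^ 2) ⊆ Ioo (-η) η ×ˢ Ioo 0 (η ^ 2) := by
        rintro ⟨a, b⟩ ⟨ha, hb⟩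
        exact ⟨⟨by linarith [ha.1], by linarith [ha.2]⟩, hb.1, by linarith [hb.2]⟩
      have hmain : HasFDerivWithinAt (fun q : ℝ × ℝ => W (q.1, √q.2)) (Q' (σ, t))
          (closure (Ioo (-η') η' ×ˢ Ioo 0 (η' ^ 2))) (σ, t) := by
        refine hasFDerivWithinAt_closure_of_tendsto_fderiv
          (fun q hq => (hint q (hsub' hq)).differentiableAt.differentiableWithinAt)
          ((convex_Ioo _ _).prod (convex_Ioo _ _)) (isOpen_Ioo.prod isOpen_Ioo) ?_ ?_
        · intro y hy
          rw [hcl] at hy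
          exact (hQcont y (hsub hy)).mono
            (hsub'.trans (prod_mono subset_rfl Ioo_subset_Ico_self))
        · have h3 : Tendsto Q' (𝓝[Ioo (-η') η' ×ˢ Ioo 0 (η' ^ 2)] (σ, t)) (𝓝 (Q' (σ, t))) :=
            (hQ'.continuousOn (σ, t) hq).mono
              (hsub'.trans (prod_mono subset_rfl Ioo_subset_Ico_self))
          refine h3.congr' ?_
          filter_upwards [self_mem_nhdsWithin] with q hq using (hint q (hsub' hq)).fderiv.symm
      rw [hcl] at hmain
      refine hmain.mono_of_mem_nhdsWithin ?_
      have h4 : Ioo (-η') η' ×ˢ Iio (η' ^ 2) ∈ 𝓝 (σ, t) :=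
        prod_mem_nhds (Ioo_mem_nhds (abs_lt.1 h1).1 (abs_lt.1 h1).2)
          (Iio_mem_nhds (by simp only at ht; rw [← ht]; positivity))
      filter_upwards [mem_nhdsWithin_of_mem_nhds h4, self_mem_nhdsWithin] with q hq hq'
      exact ⟨Ioo_subset_Icc_self hq.1, hq'.2.1, le_of_lt hq.2⟩
    · exact (hint (σ, t) ⟨hq.1, ht, hq.2.2⟩).hasFDerivWithinAt

end EvenFunction

/-! ### The metric and its Levi-Civita connection in coordinates. -/

/-- The coefficients of the metric are `C^k`, symmetric and positive definite near `u`. -/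
structure LocalMetric.IsRegularAt (h : LocalMetric) (k : ℕ) (u : Plane) : Prop where
  domain : h.domain ∈ 𝓝 u
  smooth : ∀ i j, ContDiffAt ℝ k (fun w => h.coeff w i j) u
  symm : ∀ᶠ w in 𝓝 u, ∀ i j, h.coeff w i j = h.coeff w j i
  pos : ∀ᶠ w in 𝓝 u, ∀ v ≠ 0, 0 < h.ip w v v

namespace LocalMetric

variable {h : LocalMetric} {k : ℕ} {u v w z : Plane}

theorem IsRegularAt.eventually (H : h.IsRegularAt k u) : ∀ᶠ w in 𝓝 u, h.IsRegularAt k w := by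
  have h1 : ∀ᶠ w in 𝓝 u, ∀ i j, ContDiffAt ℝ k (fun w => h.coeff w i j) w :=
    eventually_all.2 fun i => eventually_all.2 fun j => (H.smooth i j).eventually (by simp)
  filter_upwards [eventually_mem_nhds_iff.2 H.domain, h1, H.symm.eventually_nhds,
    H.pos.eventually_nhds] with w a b c d using ⟨a, b, c, d⟩

theorem ip_eq (h : LocalMetric) (u v w : Plane) :
    h.ip u v w = h.coeff u 0 0 * v 0 * w 0 + h.coeff u 0 1 * v 0 * w 1 +
      (h.coeff u 1 0 * v 1 * w 0 + h.coeff u 1 1 * v 1 * w 1) := by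
  simp [ip, Fin.sum_univ_two]

theorem ip_add_left (h : LocalMetric) (u v v' w : Plane) :
    h.ip u (v + v') w = h.ip u v w + h.ip u v' w := by
  simp only [ip_eq, PiLp.add_apply]; ring

theorem ip_add_right (h : LocalMetric) (u v w w' : Plane) :
    h.ip u v (w + w') = h.ip u v w + h.ip u v w' := by
  simp only [ip_eq, PiLp.add_apply]; ring

theorem ip_sub_left (h : LocalMetric) (u v v' w : Plane) :
    h.ip u (v - v') w = h.ip u v w - h.ip u v' w := by
  simp only [ip_eq, PiLp.sub_apply]; ring

theorem ip_smul_left (h : LocalMetric) (u : Plane) (a : ℝ) (v w : Plane) :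
    h.ip u (a • v) w = a * h.ip u v w := by
  simp only [ip_eq, PiLp.smul_apply, smul_eq_mul]; ring

theorem ip_smul_right (h : LocalMetric) (u : Plane) (a : ℝ) (v w : Plane) :
    h.ip u v (a • w) = a * h.ip u v w := by
  simp only [ip_eq, PiLp.smul_apply, smul_eq_mul]; ring

theorem ip_neg_left (h : LocalMetric) (u v w : Plane) : h.ip u (-v) w = - h.ip u v w := by
  simp only [ip_eq, PiLp.neg_apply]; ring

theorem ip_neg_right (h : LocalMetric) (u v w : Plane) : h.ip u v (-w) = - h.ip u v w := by
  simp only [ip_eq, PiLp.neg_apply]; ring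

theorem IsRegularAt.ip_symm (H : h.IsRegularAt k u) (v w : Plane) : h.ip u v w = h.ip u w v := by
  have h1 := H.symm.self_of_nhds 0 1
  simp only [ip_eq, h1]; ring

theorem IsRegularAt.ip_pos (H : h.IsRegularAt k u) (hv : v ≠ 0) : 0 < h.ip u v v :=
  H.pos.self_of_nhds v hv

theorem IsRegularAt.norm_pos (H : h.IsRegularAt k u) (hv : v ≠ 0) : 0 < h.norm u v :=
  Real.sqrt_pos.2 (H.ip_pos hv)

theorem IsRegularAt.norm_sq (H : h.IsRegularAt k u) (v : Plane) : h.norm u v ^ 2 = h.ip u v v := by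
  rcases eq_or_ne v 0 with rfl | hv
  · simp [norm, ip_eq]
  · exact Real.sq_sqrt (H.ip_pos hv).le

theorem IsRegularAt.norm_eq_one_iff (H : h.IsRegularAt k u) (v : Plane) :
    h.norm u v = 1 ↔ h.ip u v v = 1 := by
  have : 0 ≤ h.norm u v := Real.sqrt_nonneg _
  rw [← H.norm_sq, pow_eq_one_iff_of_nonneg this two_ne_zero]

theorem norm_smul (h : LocalMetric) (u : Plane) (a : ℝ) (v : Plane) :
    h.norm u (a • v) = |a| * h.norm u v := by
  rw [norm, norm, ip_smul_left, ip_smul_right, ← mul_assoc, Real.sqrt_mul (mul_self_nonneg a),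
    Real.sqrt_mul_self_eq_abs]

theorem norm_neg (h : LocalMetric) (u : Plane) (v : Plane) : h.norm u (-v) = h.norm u v := by
  rw [norm, norm, ip_neg_left, ip_neg_right, neg_neg]

theorem contDiffAt_ip {E : Type} [NormedAddCommGroup E] [NormedSpace ℝ E] {n : ℕ}
    {c V W : E → Plane} {e : E} (hn : n ≤ k) (H : h.IsRegularAt k (c e))
    (hc : ContDiffAt ℝ n c e) (hV : ContDiffAt ℝ n V e) (hW : ContDiffAt ℝ n W e) :
    ContDiffAt ℝ n (fun t => h.ip (c t) (V t) (W t)) e := by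
  have hco : ∀ i j, ContDiffAt ℝ n (fun t => h.coeff (c t) i j) e := fun i j =>
    ((H.smooth i j).of_le (by exact_mod_cast hn)).comp e hc
  have hV' : ∀ i, ContDiffAt ℝ n (fun t => V t i) e := fun i => by fun_prop
  have hW' : ∀ i, ContDiffAt ℝ n (fun t => W t i) e := fun i => by fun_prop
  unfold ip
  exact ContDiffAt.sum fun i _ => ContDiffAt.sum fun j _ =>
    ((hco i j).mul (hV' i)).mul (hW' j)

theorem contDiffAt_norm {E : Type} [NormedAddCommGroup E] [NormedSpace ℝ E] {n : ℕ}
    {c V : E → Plane} {e : E} (hn : n ≤ k) (H : h.IsRegularAt k (c e))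
    (hc : ContDiffAt ℝ n c e) (hV : ContDiffAt ℝ n V e) (hne : V e ≠ 0) :
    ContDiffAt ℝ n (fun t => h.norm (c t) (V t)) e :=
  (contDiffAt_ip hn H hc hV hV).sqrt (H.ip_pos hne).ne'

theorem IsRegularAt.det_ne_zero (H : h.IsRegularAt k u) : (h.coeff u).det ≠ 0 := by
  intro h0
  obtain ⟨v, hv, hv0⟩ := Matrix.exists_mulVec_eq_zero_iff.2 h0
  have hv' : (WithLp.toLp 2 v : Plane) ≠ 0 := by simpa using hv
  have h1 := H.ip_pos hv'
  have h2 := congrFun hv0 0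
  have h3 := congrFun hv0 1
  have h01 := H.symm.self_of_nhds 0 1
  simp only [Matrix.mulVec, dotProduct, Fin.sum_univ_two, Pi.zero_apply] at h2 h3
  rw [ip_eq] at h1
  simp only at h1
  have : h.coeff u 0 0 * v 0 * v 0 + h.coeff u 0 1 * v 0 * v 1 +
      (h.coeff u 1 0 * v 1 * v 0 + h.coeff u 1 1 * v 1 * v 1) = 0 := by
    linear_combination v 0 * h2 + v 1 * h3
  linarith

theorem IsRegularAt.contDiffAt_dcoeff {n : ℕ} (H : h.IsRegularAt k u) (hn : n + 1 ≤ k)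
    (l i j : Fin 2) : ContDiffAt ℝ n (fun w => h.dcoeff w l i j) u :=
  ((H.smooth i j).fderiv_right (m := n) (by exact_mod_cast hn)).clm_apply contDiffAt_const

theorem IsRegularAt.contDiffAt_inv {n : ℕ} (H : h.IsRegularAt k u) (hn : n ≤ k)
    (i j : Fin 2) : ContDiffAt ℝ n (fun w => (h.coeff w)⁻¹ i j) u := by
  have hs : ∀ i j, ContDiffAt ℝ n (fun w => h.coeff w i j) u := fun i j =>
    (H.smooth i j).of_le (by exact_mod_cast hn)
  have hdet : ContDiffAt ℝ n (fun w => (h.coeff w).det) u := by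
    simp only [Matrix.det_fin_two]
    exact ((hs 0 0).mul (hs 1 1)).sub ((hs 0 1).mul (hs 1 0))
  have hinv : ContDiffAt ℝ n (fun w => ((h.coeff w).det)⁻¹) u := hdet.inv H.det_ne_zero
  simp only [Matrix.inv_def, Ring.inverse_eq_inv', Matrix.smul_apply, Matrix.adjugate_fin_two,
    smul_eq_mul]
  refine hinv.mul ?_
  fin_cases i <;> fin_cases j
  · exact hs 1 1
  · exact (hs 0 1).neg
  · exact (hs 1 0).neg
  · exact hs 0 0

theorem IsRegularAt.contDiffAt_christoffel {n : ℕ} (H : h.IsRegularAt k u) (hn : n + 1 ≤ k)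
    (m i j : Fin 2) : ContDiffAt ℝ n (fun w => h.christoffel w m i j) u := by
  unfold christoffel
  refine contDiffAt_const.mul (ContDiffAt.sum fun l _ => ?_)
  exact (H.contDiffAt_inv (by omega) m l).mul (((H.contDiffAt_dcoeff hn i j l).add
    (H.contDiffAt_dcoeff hn j i l)).sub (H.contDiffAt_dcoeff hn l i j))

theorem contDiffAt_christoffelVec {E : Type} [NormedAddCommGroup E] [NormedSpace ℝ E] {n : ℕ}
    {c V W : E → Plane} {e : E} (hn : n + 1 ≤ k) (H : h.IsRegularAt k (c e))
    (hc : ContDiffAt ℝ n c e) (hV : ContDiffAt ℝ n V e) (hW : ContDiffAt ℝ n W e) :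
    ContDiffAt ℝ n (fun t => h.christoffelVec (c t) (V t) (W t)) e := by
  have hV' : ∀ i, ContDiffAt ℝ n (fun t => V t i) e := fun i => by fun_prop
  have hW' : ∀ i, ContDiffAt ℝ n (fun t => W t i) e := fun i => by fun_prop
  rw [contDiffAt_euclidean]
  intro m
  simp only [christoffelVec]
  refine ContDiffAt.sum fun i _ => ContDiffAt.sum fun j _ => ?_
  exact (((H.contDiffAt_christoffel hn m i j).comp e hc).mul (hV' i)).mul (hW' j)

theorem christoffelVec_smul_left (h : LocalMetric) (u : Plane) (a : ℝ) (v w : Plane) :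
    h.christoffelVec u (a • v) w = a • h.christoffelVec u v w := by
  ext m
  simp only [christoffelVec, Fin.sum_univ_two, PiLp.smul_apply, smul_eq_mul]
  ring

theorem christoffelVec_smul_right (h : LocalMetric) (u : Plane) (a : ℝ) (v w : Plane) :
    h.christoffelVec u v (a • w) = a • h.christoffelVec u v w := by
  ext m
  simp only [christoffelVec, Fin.sum_univ_two, PiLp.smul_apply, smul_eq_mul]
  ring

theorem IsRegularAt.dcoeff_symm (H : h.IsRegularAt k u) (l i j : Fin 2) :
    h.dcoeff u l i j = h.dcoeff u l j i := by
  have : (fun w => h.coeff w i j) =ᶠ[𝓝 u] fun w => h.coeff w j i := H.symm.mono fun w hw => hw i j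
  rw [dcoeff, dcoeff, this.fderiv_eq]

theorem IsRegularAt.christoffelVec_symm (H : h.IsRegularAt k u) (v w : Plane) :
    h.christoffelVec u v w = h.christoffelVec u w v := by
  ext m
  have h1 := H.dcoeff_symm 0 0 1
  have h2 := H.dcoeff_symm 1 0 1
  simp only [christoffelVec, christoffel, Fin.sum_univ_two, h1, h2]
  ring

/-- Lowering the upper index cancels the inverse matrix and leaves the Christoffel symbols of the
first kind; metric compatibility is then linear algebra in the derivatives `∂_l g_{ij}`. -/
theorem IsRegularAt.ip_christoffelVec (H : h.IsRegularAt k u) (v w z : Plane) :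
    h.ip u (h.christoffelVec u v w) z = (1 / 2) * ∑ i, ∑ j, ∑ l,
      (h.dcoeff u i j l + h.dcoeff u j i l - h.dcoeff u l i j) * v i * w j * z l := by
  have hA : h.coeff u * (h.coeff u)⁻¹ = 1 :=
    Matrix.mul_nonsing_inv _ (isUnit_iff_ne_zero.2 H.det_ne_zero)
  have h01 := H.symm.self_of_nhds 0 1
  have e00 := congrFun (congrFun hA 0) 0
  have e01 := congrFun (congrFun hA 0) 1
  have e10 := congrFun (congrFun hA 1) 0
  have e11 := congrFun (congrFun hA 1) 1
  simp only [Matrix.mul_apply, Fin.sum_univ_two, Matrix.one_apply] at e00 e01 e10 e11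
  norm_num at e00 e01 e10 e11
  rw [ip_eq]
  simp only [christoffelVec, christoffel, Fin.sum_univ_two]
  rw [← h01] at e10 e11 ⊢
  generalize (h.coeff u)⁻¹ 0 0 = b00 at *
  generalize (h.coeff u)⁻¹ 0 1 = b01 at *
  generalize (h.coeff u)⁻¹ 1 0 = b10 at *
  generalize (h.coeff u)⁻¹ 1 1 = b11 at *
  generalize h.coeff u 0 0 = a00 at *
  generalize h.coeff u 0 1 = a01 at *
  generalize h.coeff u 1 1 = a11 at *
  generalize h.dcoeff u 0 0 0 = d000
  generalize h.dcoeff u 0 0 1 = d001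
  generalize h.dcoeff u 0 1 0 = d010
  generalize h.dcoeff u 0 1 1 = d011
  generalize h.dcoeff u 1 0 0 = d100
  generalize h.dcoeff u 1 0 1 = d101
  generalize h.dcoeff u 1 1 0 = d110
  generalize h.dcoeff u 1 1 1 = d111
  generalize v.ofLp 0 = v0
  generalize v.ofLp 1 = v1
  generalize w.ofLp 0 = w0
  generalize w.ofLp 1 = w1
  generalize z.ofLp 0 = z0
  generalize z.ofLp 1 = z1
  -- The equations `e00`, …, `e11` are the entries of `g g⁻¹ = 1`; their multipliers are the
  -- first-kind symbols contracted with `v`, `w` and `z`.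
  linear_combination
    (1 / 2) * ((d000 + d000 - d000) * v0 * w0 + (d010 + d100 - d001) * v0 * w1 +
      (d100 + d010 - d010) * v1 * w0 + (d110 + d110 - d011) * v1 * w1) * (z0 * e00 + z1 * e10) +
    (1 / 2) * ((d001 + d001 - d100) * v0 * w0 + (d011 + d101 - d101) * v0 * w1 +
      (d101 + d011 - d110) * v1 * w0 + (d111 + d111 - d111) * v1 * w1) * (z0 * e01 + z1 * e11)

/-- Compatibility of the covariant derivative with the metric. -/
theorem IsRegularAt.hasDerivAt_ip {c V W : ℝ → Plane} {c' V' W' : Plane} {t : ℝ} (hk : 1 ≤ k)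
    (H : h.IsRegularAt k (c t)) (hc : HasDerivAt c c' t) (hV : HasDerivAt V V' t)
    (hW : HasDerivAt W W' t) :
    HasDerivAt (fun s => h.ip (c s) (V s) (W s))
      (h.ip (c t) (V' + h.christoffelVec (c t) c' (V t)) (W t) +
        h.ip (c t) (V t) (W' + h.christoffelVec (c t) c' (W t))) t := by
  have hco : ∀ i j, HasDerivAt (fun s => h.coeff (c s) i j)
      (c' 0 * h.dcoeff (c t) 0 i j + c' 1 * h.dcoeff (c t) 1 i j) t := by
    intro i j
    have h1 := ((H.smooth i j).differentiableAt (by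
      have : k ≠ 0 := by omega
      exact_mod_cast this)).hasFDerivAt.comp_hasDerivAt t hc
    have h2 : c' = c' 0 • coordVec 0 + c' 1 • coordVec 1 := by
      ext m; fin_cases m <;> simp [coordVec]
    have h3 : fderiv ℝ (fun w => h.coeff w i j) (c t) c' =
        c' 0 * h.dcoeff (c t) 0 i j + c' 1 * h.dcoeff (c t) 1 i j := by
      conv_lhs => rw [h2]
      rw [map_add, map_smul, map_smul]
      rfl
    rw [h3] at h1
    exact h1
  have hV1 : ∀ i, HasDerivAt (fun s => V s i) (V' i) t := fun i => 
    (EuclideanSpace.proj i : Plane →L[ℝ] ℝ).hasFDerivAt.comp_hasDerivAt t hV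
  have hW1 : ∀ i, HasDerivAt (fun s => W s i) (W' i) t := fun i => 
    (EuclideanSpace.proj i : Plane →L[ℝ] ℝ).hasFDerivAt.comp_hasDerivAt t hW
  have h1 := ((((hco 0 0).mul (hV1 0)).mul (hW1 0)).add (((hco 0 1).mul (hV1 0)).mul (hW1 1))).add
    ((((hco 1 0).mul (hV1 1)).mul (hW1 0)).add (((hco 1 1).mul (hV1 1)).mul (hW1 1)))
  have h2 : (fun s => h.ip (c s) (V s) (W s)) = fun s =>
      h.coeff (c s) 0 0 * V s 0 * W s 0 + h.coeff (c s) 0 1 * V s 0 * W s 1 +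
      (h.coeff (c s) 1 0 * V s 1 * W s 0 + h.coeff (c s) 1 1 * V s 1 * W s 1) := by
    funext s; rw [ip_eq]
  rw [h2]
  refine h1.congr_deriv ?_
  have e1 := H.dcoeff_symm 0 0 1
  have e2 := H.dcoeff_symm 1 0 1
  rw [ip_add_left, ip_add_right, H.ip_christoffelVec,
    H.ip_symm (V t) (h.christoffelVec (c t) c' (W t)), H.ip_christoffelVec, ip_eq, ip_eq]
  simp only [Fin.sum_univ_two, e1, e2, Pi.mul_apply]
  ring

end LocalMetric

/-! ### Mixed partial derivatives of functions that are only `C^1`. -/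

section MixedPartials

variable {E : Type} [NormedAddCommGroup E] [NormedSpace ℝ E]

theorem hasDerivAt_fst_slice {F : ℝ × ℝ → E} {q : ℝ × ℝ} (hF : DifferentiableAt ℝ F q) :
    HasDerivAt (fun s => F (s, q.2)) (fderiv ℝ F q (1, 0)) q.1 :=
  hF.hasFDerivAt.comp_hasDerivAt (f := fun s => (s, q.2)) q.1
    ((hasDerivAt_id q.1).prodMk (hasDerivAt_const q.1 q.2))

theorem contDiffAt_deriv {c : ℝ → E} {t : ℝ} {k : ℕ} (hc : ContDiffAt ℝ k c t) (hk : 1 ≤ k) :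
    ContDiffAt ℝ (k - 1 : ℕ) (deriv c) t := by
  have h1 : deriv c = fun s => fderiv ℝ c s 1 := by funext s; simp
  rw [h1]
  exact (hc.fderiv_right (m := (k - 1 : ℕ)) (by norm_cast; omega)).clm_apply contDiffAt_const

theorem hasDerivAt_snd_slice {F : ℝ × ℝ → E} {q : ℝ × ℝ} (hF : DifferentiableAt ℝ F q) :
    HasDerivAt (fun u => F (q.1, u)) (fderiv ℝ F q (0, 1)) q.2 :=
  hF.hasFDerivAt.comp_hasDerivAt (f := fun u => (q.1, u)) q.2
    ((hasDerivAt_const q.2 q.1).prodMk (hasDerivAt_id q.2))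

/-- Interchange of partial derivatives, when one of the two mixed derivatives is continuous. -/
theorem hasDerivAt_fderiv_fst {F M : ℝ × ℝ → E} {p : ℝ × ℝ} (hF : ContDiffAt ℝ 1 F p)
    (hM : ContDiffAt ℝ 1 M p)
    (hFM : ∀ᶠ q in 𝓝 p, HasDerivAt (fun u => F (q.1, u)) (M q) q.2) :
    HasDerivAt (fun u => fderiv ℝ F (p.1, u) (1, 0)) (fderiv ℝ M p (1, 0)) p.2 := by
  rw [hasDerivAt_iff_isLittleO, Asymptotics.isLittleO_iff]
  intro ε hε
  have hFd : ∀ᶠ q in 𝓝 p, DifferentiableAt ℝ F q :=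
    (hF.eventually (by simp)).mono fun q hq => hq.differentiableAt (by simp)
  have hMd : ∀ᶠ q in 𝓝 p, DifferentiableAt ℝ M q :=
    (hM.eventually (by simp)).mono fun q hq => hq.differentiableAt (by simp)
  have hM' : ContinuousAt (fun q => fderiv ℝ M q (1, 0)) p :=
    ((hM.fderiv_right (m := 0) (by simp)).continuousAt).clm_apply continuousAt_const
  have hMc : ∀ᶠ q in 𝓝 p, ‖fderiv ℝ M q (1, 0) - fderiv ℝ M p (1, 0)‖ ≤ ε := by
    filter_upwards [hM'.eventually (Metric.closedBall_mem_nhds _ hε)] with q hq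
    rwa [← dist_eq_norm]
  obtain ⟨η, hη, hB⟩ := Metric.eventually_nhds_iff_ball.1 (hFM.and (hFd.and (hMd.and hMc)))
  obtain ⟨s₀, u₀⟩ := p
  have hB' : ∀ s ∈ Metric.ball s₀ η, ∀ u ∈ Metric.ball u₀ η, (s, u) ∈ Metric.ball (s₀, u₀) η := by
    intro s hs u hu
    rw [← ball_prod_same]; exact ⟨hs, hu⟩
  have hs₀ : s₀ ∈ Metric.ball s₀ η := Metric.mem_ball_self hη
  have hu₀ : u₀ ∈ Metric.ball u₀ η := Metric.mem_ball_self hη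
  set A := fderiv ℝ M (s₀, u₀) (1, 0)
  filter_upwards [Metric.ball_mem_nhds u₀ hη] with u hu
  -- The mean value inequality, first in `s` for `M` and then in `u` for differences of `F`, keeps
  -- the second difference of `F` within `ε |s - s₀| |u - u₀|` of `(s - s₀)(u - u₀) A`.
  have h1 : ∀ s ∈ Metric.ball s₀ η, ∀ r ∈ Metric.ball u₀ η,
      ‖M (s, r) - M (s₀, r) - (s - s₀) • A‖ ≤ ε * ‖s - s₀‖ := by
    intro s hs r hr
    have := Convex.norm_image_sub_le_of_norm_hasDerivWithin_le (s := Metric.ball s₀ η)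
      (f := fun s => M (s, r) - s • A) (f' := fun s => fderiv ℝ M (s, r) (1, 0) - (1 : ℝ) • A)
      (C := ε) (fun y hy => ((hasDerivAt_fst_slice
        (hB _ (hB' y hy r hr)).2.2.1).sub ((hasDerivAt_id y).smul_const A)).hasDerivWithinAt)
      (fun y hy => by rw [one_smul]; exact (hB _ (hB' y hy r hr)).2.2.2) (convex_ball _ _) hs₀ hs
    convert! this using 2
    rw [sub_smul]; abel
  have h2 : ∀ s ∈ Metric.ball s₀ η,
      ‖(F (s, u) - F (s₀, u)) - (F (s, u₀) - F (s₀, u₀)) - (u - u₀) • ((s - s₀) • A)‖ ≤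
        ε * ‖s - s₀‖ * ‖u - u₀‖ := by
    intro s hs
    have := Convex.norm_image_sub_le_of_norm_hasDerivWithin_le (s := Metric.ball u₀ η)
      (f := fun r => F (s, r) - F (s₀, r) - r • ((s - s₀) • A))
      (f' := fun r => M (s, r) - M (s₀, r) - (1 : ℝ) • ((s - s₀) • A))
      (C := ε * ‖s - s₀‖) (fun y hy => ((((hB _ (hB' s hs y hy)).1).sub
        ((hB _ (hB' s₀ hs₀ y hy)).1)).sub ((hasDerivAt_id y).smul_const _)).hasDerivWithinAt)
      (fun y hy => by rw [one_smul]; exact h1 s hs y hy) (convex_ball _ _) hu₀ hu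
    convert! this using 2
    rw [sub_smul]; abel
  have h3 : HasDerivAt (fun s => F (s, u) - F (s, u₀) - (s * (u - u₀)) • A)
      (fderiv ℝ F (s₀, u) (1, 0) - fderiv ℝ F (s₀, u₀) (1, 0) - (1 * (u - u₀)) • A) s₀ := by
    have ha : HasDerivAt (fun s => F (s, u)) (fderiv ℝ F (s₀, u) (1, 0)) s₀ :=
      hasDerivAt_fst_slice (hB _ (hB' s₀ hs₀ u hu)).2.1
    have hb : HasDerivAt (fun s => F (s, u₀)) (fderiv ℝ F (s₀, u₀) (1, 0)) s₀ :=
      hasDerivAt_fst_slice (hB _ (hB' s₀ hs₀ u₀ hu₀)).2.1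
    exact (ha.sub hb).sub (((hasDerivAt_id s₀).mul_const (u - u₀)).smul_const A)
  rw [one_mul] at h3
  -- Divide the second-difference estimate by `s - s₀` and let `s → s₀`.
  refine le_of_tendsto (hasDerivAt_iff_tendsto_slope.1 h3).norm ?_
  filter_upwards [self_mem_nhdsWithin, mem_nhdsWithin_of_mem_nhds (Metric.ball_mem_nhds s₀ hη)]
    with s hs hs'
  have hne : 0 < ‖s - s₀‖ := norm_pos_iff.2 (sub_ne_zero.2 hs)
  rw [slope_def_module, norm_smul, norm_inv, inv_mul_le_iff₀ hne]
  refine le_trans (le_of_eq ?_) ((h2 s hs').trans (le_of_eq (by ring)))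
  congr 1
  module

end MixedPartials

/-! ### The geodesics tangent to the curve. -/

/-- The hypotheses on the metric and on the curve, at the parameter `0`. -/
structure IsCurvedAt (h : LocalMetric) (k : ℕ) (x : ℝ → Plane) : Prop where
  two_le : 2 ≤ k
  metric : h.IsRegularAt k (x 0)
  smooth : ContDiffAt ℝ k x 0
  deriv_ne : deriv x 0 ≠ 0
  curv : 0 < h.geodesicCurvature x 0

namespace LocalMetric

variable {h : LocalMetric} {k : ℕ}

/-- The vector field of the geodesic flow. -/
def spray (h : LocalMetric) (p : Plane × Plane) : Plane × Plane :=
  (p.2, -h.christoffelVec p.1 p.2 p.2)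

theorem IsRegularAt.contDiffAt_spray {p : Plane × Plane} {n : ℕ} (hn : n + 1 ≤ k)
    (H : h.IsRegularAt k p.1) : ContDiffAt ℝ n h.spray p :=
  contDiffAt_snd.prodMk
    (contDiffAt_christoffelVec (c := Prod.fst) (V := Prod.snd) (W := Prod.snd) hn H
      contDiffAt_fst contDiffAt_snd contDiffAt_snd).neg

/-- Near a point, the Euclidean norm is controlled by the Riemannian one. -/
theorem IsRegularAt.exists_ball {o : Plane} (H : h.IsRegularAt k o) :
    ∃ ρ > 0, ∃ R > 0, ∀ u ∈ Metric.closedBall o ρ, h.IsRegularAt k u ∧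
      ∀ v, h.ip u v v = 1 → ‖v‖ ≤ R := by
  obtain ⟨ρ, hρ, hball⟩ := Metric.nhds_basis_closedBall.eventually_iff.1 H.eventually
  have hK : IsCompact (Metric.closedBall o ρ ×ˢ Metric.sphere (0 : Plane) 1) :=
    (isCompact_closedBall _ _).prod (isCompact_sphere _ _)
  have hcont : ContinuousOn (fun p : Plane × Plane => h.ip p.1 p.2 p.2)
      (Metric.closedBall o ρ ×ˢ Metric.sphere (0 : Plane) 1) := fun p hp =>
    (contDiffAt_ip (n := 0) (c := Prod.fst) (V := Prod.snd) (W := Prod.snd) (Nat.zero_le k)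
      (hball hp.1) contDiffAt_fst contDiffAt_snd contDiffAt_snd).continuousAt.continuousWithinAt
  have hne : (Metric.closedBall o ρ ×ˢ Metric.sphere (0 : Plane) 1).Nonempty :=
    (Metric.nonempty_closedBall.2 hρ.le).prod (NormedSpace.sphere_nonempty.2 zero_le_one)
  -- The metric has a positive minimum on pairs (point of the ball, Euclidean unit vector); its
  -- inverse square root is the constant `R`.
  obtain ⟨p, hp, hmin⟩ := hK.exists_isMinOn hne hcont
  have hpos : 0 < h.ip p.1 p.2 p.2 := (hball hp.1).ip_pos (by
    intro h0; have := hp.2; simp [h0] at this)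
  refine ⟨ρ, hρ, 1 / √(h.ip p.1 p.2 p.2), by positivity, fun u hu => ⟨hball hu, fun v hv => ?_⟩⟩
  rcases eq_or_ne v 0 with rfl | hv0
  · simp
  have hvn : 0 < ‖v‖ := norm_pos_iff.2 hv0
  have h1 := hmin (show (u, ‖v‖⁻¹ • v) ∈ Metric.closedBall o ρ ×ˢ Metric.sphere (0 : Plane) 1 from
    ⟨hu, by simp [_root_.norm_smul, hvn.ne']⟩)
  simp only [mem_ofPred_eq, ip_smul_left, ip_smul_right, hv, mul_one] at h1
  rw [le_div_iff₀ (Real.sqrt_pos.2 hpos), ← Real.sqrt_sq hvn.le, ← Real.sqrt_mul (by positivity)]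
  refine Real.sqrt_le_iff.2 ⟨zero_le_one, ?_⟩
  rw [one_pow]
  calc ‖v‖ ^ 2 * h.ip p.1 p.2 p.2 ≤ ‖v‖ ^ 2 * (‖v‖⁻¹ * ‖v‖⁻¹) := by gcongr
    _ = 1 := by field_simp

end LocalMetric

variable {h : LocalMetric} {k : ℕ} {x : ℝ → Plane}

theorem IsCurvedAt.contDiffAt_unitTangent (H : IsCurvedAt h k x) :
    ContDiffAt ℝ (k - 1 : ℕ) (h.unitTangent x) 0 := by
  have h2 := H.two_le
  have hd : ContDiffAt ℝ (k - 1 : ℕ) (deriv x) 0 := contDiffAt_deriv H.smooth (by omega)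
  have hx : ContDiffAt ℝ (k - 1 : ℕ) x 0 := H.smooth.of_le (by norm_cast; omega)
  have hn := LocalMetric.contDiffAt_norm (by omega) H.metric hx hd H.deriv_ne
  exact (hn.inv (H.metric.norm_pos H.deriv_ne).ne').smul hd

/-- The properties, at time `p.2`, of the unit speed geodesic `G (p.1, ·)`, with velocity
`V (p.1, ·)`, which is tangent to the curve `x` at the point with parameter `p.1`. -/
structure IsTangentFlowAt (h : LocalMetric) (k : ℕ) (x : ℝ → Plane) (G V : ℝ × ℝ → Plane)
    (p : ℝ × ℝ) : Prop where
  regular : h.IsRegularAt k (G p)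
  base : G (p.1, 0) = x p.1
  vel : V (p.1, 0) = h.unitTangent x p.1
  deriv_ne : deriv x p.1 ≠ 0
  contDiffG : ContDiffAt ℝ (k - 1 : ℕ) G p
  contDiffV : ContDiffAt ℝ (k - 1 : ℕ) V p
  derivG : HasDerivAt (fun u => G (p.1, u)) (V p) p.2
  derivV : HasDerivAt (fun u => V (p.1, u)) (-h.christoffelVec (G p) (V p) (V p)) p.2
  unit : h.ip (G p) (V p) (V p) = 1
  gauss : h.ip (G p) (fderiv ℝ G p (1, 0)) (V p) = h.norm (x p.1) (deriv x p.1)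

theorem eq_of_hasDerivAt_zero_ball {f : ℝ → ℝ} {c η : ℝ}
    (hf : ∀ r ∈ Metric.ball c η, HasDerivAt f 0 r) :
    ∀ r ∈ Metric.ball c η, ∀ s ∈ Metric.ball c η, f r = f s := by
  intro r hr s hs
  have := Convex.norm_image_sub_le_of_norm_hasDerivWithin_le (s := Metric.ball c η) (f := f)
    (f' := fun _ => 0) (C := 0) (fun y hy => (hf y hy).hasDerivWithinAt) (fun y _ => by simp)
    (convex_ball _ _) hs hr
  rw [zero_mul, norm_le_zero_iff, sub_eq_zero] at this
  exact this

/-- The geodesic flow is started at `(x s, T s)`. Both the unit tangent and the spray are `C^(k-1)`,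
which fixes the order of `G` and of the velocity `V`. -/
theorem IsCurvedAt.exists_tangentFlow (H : IsCurvedAt h k x) :
    ∃ G V : ℝ × ℝ → Plane, ∀ᶠ p in 𝓝 ((0 : ℝ), (0 : ℝ)), IsTangentFlowAt h k x G V p := by
  have h2 := H.two_le
  obtain ⟨φ, hφ, hflow⟩ := exists_contDiffAt_flow (n := k - 1) (by omega)
    (LocalMetric.IsRegularAt.contDiffAt_spray (n := k - 1) (p := (x 0, h.unitTangent x 0))
      (by omega) H.metric)
  have hT := H.contDiffAt_unitTangent
  have hx : ContDiffAt ℝ (k - 1 : ℕ) x 0 := H.smooth.of_le (by norm_cast; omega)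
  let Z : ℝ × ℝ → (Plane × Plane) × ℝ := fun p => ((x p.1, h.unitTangent x p.1), p.2)
  have hZ : ContDiffAt ℝ (k - 1 : ℕ) Z (0, 0) :=
    ((hx.comp ((0 : ℝ), (0 : ℝ)) contDiffAt_fst).prodMk
      (hT.comp ((0 : ℝ), (0 : ℝ)) contDiffAt_fst)).prodMk contDiffAt_snd
  have hφZ : ContDiffAt ℝ (k - 1 : ℕ) (fun p => φ (Z p)) (0, 0) := hφ.comp ((0 : ℝ), (0 : ℝ)) hZ
  let G : ℝ × ℝ → Plane := fun p => (φ (Z p)).1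
  let V : ℝ × ℝ → Plane := fun p => (φ (Z p)).2
  have hG : ContDiffAt ℝ (k - 1 : ℕ) G (0, 0) := contDiffAt_fst.comp _ hφZ
  have hV : ContDiffAt ℝ (k - 1 : ℕ) V (0, 0) := contDiffAt_snd.comp _ hφZ
  have hev := hZ.continuousAt.eventually hflow
  have hG0 : G (0, 0) = x 0 := by
    have := hev.self_of_nhds.1
    simp only [G, Z] at this ⊢
    rw [this]
  have hreg : ∀ᶠ p in 𝓝 ((0 : ℝ), (0 : ℝ)), h.IsRegularAt k (G p) :=
    hG.continuousAt.eventually (by rw [hG0]; exact H.metric.eventually)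
  have hdx : ∀ᶠ s in 𝓝 (0 : ℝ), deriv x s ≠ 0 ∧ ContDiffAt ℝ k x s := by
    have hd : ContinuousAt (deriv x) 0 :=
      (contDiffAt_deriv H.smooth (by omega)).continuousAt
    exact (hd.eventually_ne H.deriv_ne).and (H.smooth.eventually (by simp))
  have hdx' := (continuousAt_fst (p := ((0 : ℝ), (0 : ℝ)))).eventually hdx
  have hall := hev.and (hreg.and (hdx'.and ((hG.eventually (by simp)).and
    (hV.eventually (by simp)))))
  obtain ⟨η, hη, hB⟩ := Metric.eventually_nhds_iff_ball.1 hall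
  have hB' : ∀ s ∈ Metric.ball (0 : ℝ) η, ∀ u ∈ Metric.ball (0 : ℝ) η,
      (s, u) ∈ Metric.ball ((0 : ℝ), (0 : ℝ)) η := by
    intro s hs u hu
    rw [← ball_prod_same]; exact ⟨hs, hu⟩
  have h0 : (0 : ℝ) ∈ Metric.ball (0 : ℝ) η := Metric.mem_ball_self hη
  have hbase : ∀ s ∈ Metric.ball (0 : ℝ) η, G (s, 0) = x s ∧ V (s, 0) = h.unitTangent x s := by
    intro s hs
    have := (hB _ (hB' s hs 0 h0)).1.1
    simp only [G, V, Z] at this ⊢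
    rw [this]
    exact ⟨rfl, rfl⟩
  have hdG : ∀ p ∈ Metric.ball ((0 : ℝ), (0 : ℝ)) η,
      HasDerivAt (fun u => G (p.1, u)) (V p) p.2 ∧
      HasDerivAt (fun u => V (p.1, u)) (-h.christoffelVec (G p) (V p) (V p)) p.2 := by
    intro p hp
    have h1 := (hB p hp).1.2
    exact ⟨(ContinuousLinearMap.fst ℝ Plane Plane).hasFDerivAt.comp_hasDerivAt p.2 h1,
      (ContinuousLinearMap.snd ℝ Plane Plane).hasFDerivAt.comp_hasDerivAt p.2 h1⟩
  have hunit : ∀ s ∈ Metric.ball (0 : ℝ) η, ∀ u ∈ Metric.ball (0 : ℝ) η,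
      h.ip (G (s, u)) (V (s, u)) (V (s, u)) = 1 := by
    intro s hs u hu
    have h1 : ∀ r ∈ Metric.ball (0 : ℝ) η,
        HasDerivAt (fun r => h.ip (G (s, r)) (V (s, r)) (V (s, r))) 0 r := by
      intro r hr
      have hm := hB' s hs r hr
      have := (hB _ hm).2.1.hasDerivAt_ip (by omega) (hdG _ hm).1 (hdG _ hm).2 (hdG _ hm).2
      refine this.congr_deriv ?_
      simp [LocalMetric.ip_eq]
    rw [eq_of_hasDerivAt_zero_ball h1 u hu 0 h0, (hbase s hs).1, (hbase s hs).2]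
    have hr : h.IsRegularAt k (x s) := by
      have := (hB _ (hB' s hs 0 h0)).2.1; rwa [(hbase s hs).1] at this
    have hne := (hB _ (hB' s hs 0 h0)).2.2.1.1
    have hn := hr.norm_pos hne
    rw [LocalMetric.unitTangent, LocalMetric.ip_smul_left, LocalMetric.ip_smul_right,
      ← hr.norm_sq]
    field_simp
  -- Gauss lemma: `∂_u ⟨∂_s G, V⟩ = ⟨∇_u ∂_s G, V⟩ = ⟨∇_s V, V⟩ = ½ ∂_s |V|² = 0`, by the geodesic
  -- equation, the symmetry of the connection and unit speed. At `u = 0` the product is `⟨x', T⟩ =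
  -- |x'|`.
  have hgauss : ∀ s ∈ Metric.ball (0 : ℝ) η, ∀ u ∈ Metric.ball (0 : ℝ) η,
      h.ip (G (s, u)) (fderiv ℝ G (s, u) (1, 0)) (V (s, u)) = h.norm (x s) (deriv x s) := by
    intro s hs u hu
    have hC1 : ∀ p ∈ Metric.ball ((0 : ℝ), (0 : ℝ)) η, ContDiffAt ℝ 1 G p ∧ ContDiffAt ℝ 1 V p :=
      fun p hp => ⟨(hB p hp).2.2.2.1.of_le (by norm_cast; omega),
        (hB p hp).2.2.2.2.of_le (by norm_cast; omega)⟩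
    have h1 : ∀ r ∈ Metric.ball (0 : ℝ) η,
        HasDerivAt (fun r => h.ip (G (s, r)) (fderiv ℝ G (s, r) (1, 0)) (V (s, r))) 0 r := by
      intro r hr
      have hm := hB' s hs r hr
      -- For `k = 2` the map `G` is only known to be `C^1`; the mixed derivative exists because `∂_u
      -- G = V` is `C^1` too.
      have hmix := hasDerivAt_fderiv_fst (hC1 _ hm).1 (hC1 _ hm).2
        (by filter_upwards [Metric.isOpen_ball.mem_nhds hm] with q hq using (hdG q hq).1)
      have h2 := (hB _ hm).2.1.hasDerivAt_ip (by omega) (hdG _ hm).1 hmix (hdG _ hm).2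
      have hGs : HasDerivAt (fun s => G (s, r)) (fderiv ℝ G (s, r) (1, 0)) s :=
        hasDerivAt_fst_slice (q := (s, r)) ((hC1 _ hm).1.differentiableAt (by simp))
      have hVs : HasDerivAt (fun s => V (s, r)) (fderiv ℝ V (s, r) (1, 0)) s :=
        hasDerivAt_fst_slice (q := (s, r)) ((hC1 _ hm).2.differentiableAt (by simp))
      have h3 := (hB _ hm).2.1.hasDerivAt_ip (c := fun s => G (s, r)) (by omega) hGs hVs hVs
      have h4 : HasDerivAt (fun s => h.ip (G (s, r)) (V (s, r)) (V (s, r))) 0 s := by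
        refine (hasDerivAt_const s (1 : ℝ)).congr_of_eventuallyEq ?_
        filter_upwards [Metric.isOpen_ball.mem_nhds hs] with s' hs' using hunit s' hs' r hr
      have h5 := h3.unique h4
      refine h2.congr_deriv ?_
      rw [(hB _ hm).2.1.ip_symm (V (s, r))] at h5
      rw [(hB _ hm).2.1.christoffelVec_symm (V (s, r)) (fderiv ℝ G (s, r) (1, 0))]
      have h6 : h.ip (G (s, r)) (fderiv ℝ G (s, r) (1, 0))
        (-h.christoffelVec (G (s, r)) (V (s, r)) (V (s, r)) +
          h.christoffelVec (G (s, r)) (V (s, r)) (V (s, r))) = 0 := by simp [LocalMetric.ip_eq]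
      rw [h6]
      linarith
    rw [eq_of_hasDerivAt_zero_ball h1 u hu 0 h0]
    have hGs : HasDerivAt (fun s => G (s, 0)) (fderiv ℝ G (s, 0) (1, 0)) s :=
      hasDerivAt_fst_slice (q := (s, 0)) ((hC1 _ (hB' s hs 0 h0)).1.differentiableAt (by simp))
    have hxs : HasDerivAt (fun s => G (s, 0)) (deriv x s) s := by
      have hd : DifferentiableAt ℝ x s := (hB _ (hB' s hs 0 h0)).2.2.1.2.differentiableAt (by
        have : k ≠ 0 := by omega
        exact_mod_cast this)
      refine hd.hasDerivAt.congr_of_eventuallyEq ?_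
      filter_upwards [Metric.isOpen_ball.mem_nhds hs] with s' hs' using (hbase s' hs').1
    rw [hGs.unique hxs, (hbase s hs).1, (hbase s hs).2]
    have hr : h.IsRegularAt k (x s) := by
      have := (hB _ (hB' s hs 0 h0)).2.1; rwa [(hbase s hs).1] at this
    have hne := (hB _ (hB' s hs 0 h0)).2.2.1.1
    have hn := hr.norm_pos hne
    rw [LocalMetric.unitTangent, LocalMetric.ip_smul_right, ← hr.norm_sq]
    field_simp
  refine ⟨G, V, Metric.eventually_nhds_iff_ball.2 ⟨η, hη, ?_⟩⟩
  rintro ⟨s, u⟩ hp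
  have hp' := hp
  rw [← ball_prod_same] at hp'
  obtain ⟨hs, hu⟩ := hp'
  exact ⟨(hB _ hp).2.1, (hbase s hs).1, (hbase s hs).2, (hB _ hp).2.2.1.1,
    (hB _ hp).2.2.2.1, (hB _ hp).2.2.2.2, (hdG _ hp).1, (hdG _ hp).2, hunit s hs u hu,
    hgauss s hs u hu⟩

/-- A short unit speed geodesic stays close to its starting point and keeps its speed. -/
theorem LocalMetric.IsGeodesicOn.mem_ball {c : ℝ → Plane} {ℓ ρ R : ℝ} {o : Plane} (hk : 1 ≤ k)
    (hR : 0 < R)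
    (hreg : ∀ u ∈ Metric.closedBall o ρ, h.IsRegularAt k u ∧ ∀ v, h.ip u v v = 1 → ‖v‖ ≤ R)
    (hc : h.IsGeodesicOn c (Icc 0 ℓ)) (h0 : c 0 ∈ Metric.ball o (ρ / 2))
    (h1 : h.norm (c 0) (deriv c 0) = 1) (hℓ : ℓ * R < ρ / 2) :
    ∀ t ∈ Icc 0 ℓ, c t ∈ Metric.ball o ρ ∧ h.ip (c t) (deriv c t) (deriv c t) = 1 := by
  have hρ : 0 < ρ := by have := Metric.pos_of_mem_ball h0; linarith
  have hcont : ContinuousOn c (Icc 0 ℓ) := fun t ht =>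
    (hc t ht).2.1.continuousAt.continuousWithinAt
  have h0' : c 0 ∈ Metric.closedBall o ρ :=
    Metric.ball_subset_closedBall (Metric.ball_subset_ball (by linarith) h0)
  -- Conservation of speed needs the regularity of the metric, hence confinement to the ball;
  -- confinement in turn needs a speed bound. The circle is broken at the first exit time.
  have hspeed : ∀ t ∈ Icc 0 ℓ, (∀ r ∈ Ico 0 t, c r ∈ Metric.ball o ρ) →
      c t ∈ Metric.closedBall o ρ →
      ∀ r ∈ Icc 0 t, h.ip (c r) (deriv c r) (deriv c r) = 1 := by
    intro t ht hr hct r hrt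
    have hin : ∀ r ∈ Icc 0 t, c r ∈ Metric.closedBall o ρ := by
      intro r hrt
      rcases hrt.2.eq_or_lt with rfl | hlt
      · exact hct
      · exact Metric.ball_subset_closedBall (hr r ⟨hrt.1, hlt⟩)
    have hder : ∀ r ∈ Icc 0 t,
        HasDerivAt (fun r => h.ip (c r) (deriv c r) (deriv c r)) 0 r := by
      intro r hrt
      obtain ⟨-, hd, hdd, hg⟩ := hc r ⟨hrt.1, hrt.2.trans ht.2⟩
      have := (hreg _ (hin r hrt)).1.hasDerivAt_ip hk hd.hasDerivAt hdd.hasDerivAt hdd.hasDerivAt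
      refine this.congr_deriv ?_
      rw [LocalMetric.covDeriv] at hg
      rw [hg]
      simp [LocalMetric.ip_eq]
    have h2 := constant_of_has_deriv_right_zero (f := fun r => h.ip (c r) (deriv c r) (deriv c r))
      (fun r hr => (hder r hr).continuousAt.continuousWithinAt)
      (fun r hr => (hder r (Ico_subset_Icc_self hr)).hasDerivWithinAt) r hrt
    rw [h2, ← (hreg _ h0').1.norm_eq_one_iff, h1]
  have hstay : ∀ t ∈ Icc 0 ℓ, c t ∈ Metric.ball o ρ := by
    by_contra! hcon
    obtain ⟨t₁, ht₁, hmem₁⟩ := hcon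
    -- Compactness gives a first exit time. Up to it the Euclidean speed is at most `R`, so the
    -- curve has moved by at most `ℓ R < ρ / 2` and cannot have left the ball.
    have hS : IsCompact {t ∈ Icc 0 ℓ | ρ ≤ dist (c t) o} := by
      have hcl : IsClosed (Icc 0 ℓ ∩ (fun t => dist (c t) o) ⁻¹' Ici ρ) :=
        (ContinuousOn.comp (g := fun u => dist u o) (t := univ) (by fun_prop) hcont (mapsTo_univ _ _)).preimage_isClosed_of_isClosed isClosed_Icc isClosed_Ici
      exact isCompact_Icc.of_isClosed_subset hcl inter_subset_left
    obtain ⟨t, ⟨ht, hρt⟩, hmin⟩ := hS.exists_isLeast ⟨t₁, ht₁, not_lt.1 hmem₁⟩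
    have hlt : ∀ r ∈ Ico 0 t, c r ∈ Metric.ball o ρ := by
      intro r hr
      by_contra hcr
      have := hmin ⟨⟨hr.1, (hr.2.trans_le ht.2).le⟩, not_lt.1 hcr⟩
      linarith [hr.2]
    have ht0 : 0 < t := by
      rcases ht.1.eq_or_lt with h0t | h0t
      · rw [← h0t] at hρt
        have : dist (c 0) o < ρ / 2 := h0
        linarith
      · exact h0t
    have hct : c t ∈ Metric.closedBall o ρ := by
      have h3 : ContinuousWithinAt c (Iio t) t := (hc t ht).2.1.continuousAt.continuousWithinAt
      have h4 : ∀ᶠ r in 𝓝[<] t, c r ∈ Metric.closedBall o ρ := by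
        filter_upwards [Ioo_mem_nhdsLT ht0] with r hr
        exact Metric.ball_subset_closedBall (hlt r ⟨hr.1.le, hr.2⟩)
      exact Metric.isClosed_closedBall.mem_of_tendsto h3 h4
    have hsp := hspeed t ht hlt hct
    have hbd := norm_image_sub_le_of_norm_deriv_le_segment' (f := c) (f' := deriv c) (a := 0)
      (b := t) (C := R)
      (fun r hr => (hc r ⟨hr.1, hr.2.trans ht.2⟩).2.1.hasDerivAt.hasDerivWithinAt)
      (fun r hr => (hreg _ (Metric.ball_subset_closedBall (hlt r hr))).2 _
        (hsp r (Ico_subset_Icc_self hr))) t ⟨ht0.le, le_rfl⟩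
    have h5 : dist (c t) o ≤ dist (c t) (c 0) + dist (c 0) o := dist_triangle _ _ _
    rw [dist_eq_norm (c t) (c 0)] at h5
    have h6 : dist (c 0) o < ρ / 2 := h0
    have h7 : R * (t - 0) ≤ ℓ * R := by nlinarith [ht.2]
    linarith
  intro t ht
  refine ⟨hstay t ht, hspeed t ht (fun r hr => hstay r ⟨hr.1, hr.2.le.trans ht.2⟩)
    (Metric.ball_subset_closedBall (hstay t ht)) t ⟨ht.1, le_rfl⟩⟩

theorem LocalMetric.IsRegularAt.eq_unitTangent_or {c : ℝ → Plane} {a : ℝ} {v : Plane}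
    (H : h.IsRegularAt k (c a)) (hne : deriv c a ≠ 0) (hv : h.ip (c a) v v = 1)
    (hmem : v ∈ Submodule.span ℝ {deriv c a}) :
    v = h.unitTangent c a ∨ v = -h.unitTangent c a := by
  obtain ⟨μ, rfl⟩ := Submodule.mem_span_singleton.1 hmem
  rw [← H.norm_eq_one_iff, LocalMetric.norm_smul] at hv
  have hn := H.norm_pos hne
  rw [LocalMetric.unitTangent]
  rcases abs_choice μ with hμ | hμ <;> rw [hμ] at hv
  · left; rw [eq_inv_of_mul_eq_one_left hv]
  · right
    have := eq_inv_of_mul_eq_one_left hv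
    rw [← this, neg_smul, neg_neg]

variable {G V : ℝ × ℝ → Plane}

/-- Description of the geodesic segments tangent to the curve by the tangent flow. -/
theorem IsCurvedAt.eventually_isTangentSegment_iff (H : IsCurvedAt h k x)
    (hGV : ∀ᶠ p in 𝓝 ((0 : ℝ), (0 : ℝ)), IsTangentFlowAt h k x G V p) :
    ∀ᶠ ε in 𝓝[>] (0 : ℝ), ∀ᶠ C in 𝓝 (x 0), ∀ a ℓ ζ, IsTangentSegment h x ε C a ℓ ζ ↔
      a ∈ Ioo (-ε) ε ∧ ℓ ∈ Ioo 0 ε ∧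
        ((G (a, ℓ) = C ∧ ζ = -V (a, ℓ)) ∨ (G (a, -ℓ) = C ∧ ζ = V (a, -ℓ))) := by
  have hk : 1 ≤ k := by have := H.two_le; omega
  obtain ⟨ρ, hρ, R, hR, hreg⟩ := H.metric.exists_ball
  have hG0 : G (0, 0) = x 0 := hGV.self_of_nhds.base
  have hGball : ∀ᶠ p in 𝓝 ((0 : ℝ), (0 : ℝ)), G p ∈ Metric.closedBall (x 0) ρ :=
    hGV.self_of_nhds.contDiffG.continuousAt.eventually
      (by rw [hG0]; exact Metric.closedBall_mem_nhds _ hρ)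
  obtain ⟨η, hη, hB⟩ := Metric.eventually_nhds_iff_ball.1 (hGV.and hGball)
  have hB' : ∀ s ∈ Metric.ball (0 : ℝ) η, ∀ u ∈ Metric.ball (0 : ℝ) η,
      (s, u) ∈ Metric.ball ((0 : ℝ), (0 : ℝ)) η := by
    intro s hs u hu
    rw [← ball_prod_same]; exact ⟨hs, hu⟩
  let D : Set (Plane × Plane) := Metric.closedBall (x 0) ρ ×ˢ Metric.closedBall 0 R
  -- A compact convex set in phase space that contains all the trajectories compared below; there
  -- the spray is Lipschitz and solutions are unique.
  obtain ⟨K, hK⟩ : ∃ K, LipschitzOnWith K h.spray D := by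
    refine ContDiffOn.exists_lipschitzOnWith (n := ((k - 1 : ℕ) : ℕ∞ω)) (fun p hp => ?_) ?_
      ((convex_closedBall _ _).prod (convex_closedBall _ _))
      ((isCompact_closedBall _ _).prod (isCompact_closedBall _ _))
    · exact (LocalMetric.IsRegularAt.contDiffAt_spray (by omega)
        (hreg _ hp.1).1).contDiffWithinAt
    · have : k - 1 ≠ 0 := by have := H.two_le; omega
      exact_mod_cast this
  have hsmall : ∀ᶠ ε in 𝓝[>] (0 : ℝ), ε < η ∧ ε * R < ρ / 2 := by
    refine mem_nhdsWithin_of_mem_nhds ?_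
    have h1 : ContinuousAt (fun ε : ℝ => ε * R) 0 := by fun_prop
    exact (eventually_lt_nhds hη).and (h1.eventually_lt_const (by simpa using hρ))
  filter_upwards [hsmall, self_mem_nhdsWithin] with ε ⟨hεη, hεR⟩ hε0
  filter_upwards [Metric.ball_mem_nhds (x 0) (half_pos hρ)] with C hC a ℓ ζ
  have habs : ∀ {r : ℝ}, |r| < ε → r ∈ Metric.ball (0 : ℝ) η := fun hr => by
    rw [mem_ball_zero_iff, Real.norm_eq_abs]; linarith
  constructor
  · rintro ⟨ha, hℓ, hζ, c, hc, hc0, hdc0, hcℓ, hspan⟩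
    refine ⟨ha, hℓ, ?_⟩
    have haB : a ∈ Metric.ball (0 : ℝ) η := habs (abs_lt.2 ha)
    have hcD := hc.mem_ball hk hR hreg (by rwa [hc0]) (by rw [hc0, hdc0]; exact hζ)
      (lt_of_le_of_lt (mul_le_mul_of_nonneg_right hℓ.2.le hR.le) hεR)
    have hend := hcD ℓ ⟨hℓ.1.le, le_rfl⟩
    have hF := fun u (hu : |u| < ε) => (hB _ (hB' a haB u (habs hu))).1
    have hFD : ∀ u, |u| < ε → (G (a, u), V (a, u)) ∈ D ∧ (G (a, u), -V (a, u)) ∈ D := by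
      intro u hu
      have h1 := (hB _ (hB' a haB u (habs hu))).2
      have h2 := (hreg _ h1).2 _ (hF u hu).unit
      exact ⟨⟨h1, by simpa using h2⟩, ⟨h1, by simpa using h2⟩⟩
    have hcD' : ∀ t ∈ Icc 0 ℓ, (c t, deriv c t) ∈ D ∧ (c t, -deriv c t) ∈ D := by
      intro t ht
      have h1 := Metric.ball_subset_closedBall (hcD t ht).1
      have h2 := (hreg _ h1).2 _ (hcD t ht).2
      exact ⟨⟨h1, by simpa using h2⟩, ⟨h1, by simpa using h2⟩⟩
    have hdc : ∀ t ∈ Icc 0 ℓ, HasDerivAt (fun t => (c t, deriv c t))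
        (h.spray (c t, deriv c t)) t := by
      intro t ht
      obtain ⟨-, h1, h2, h3⟩ := hc t ht
      have h4 : deriv (deriv c) t = -h.christoffelVec (c t) (deriv c t) (deriv c t) :=
        eq_neg_of_add_eq_zero_left h3
      have h5 := h2.hasDerivAt
      rw [h4] at h5
      exact h1.hasDerivAt.prodMk h5
    have h00 : |(0 : ℝ)| < ε := by simpa using hε0
    have hreg' : h.IsRegularAt k (x a) := by
      have := (hF 0 h00).regular; rwa [(hF 0 h00).base] at this
    rcases (show h.IsRegularAt k (x a) from hreg').eq_unitTangent_or (hF 0 h00).deriv_ne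
      (by rw [← hcℓ]; exact hend.2) hspan with hT | hT
    -- Arrival with velocity `+T`: by uniqueness backwards from the tangency point, the segment is
    -- the tangent geodesic run from time `-ℓ` to 0.
    · right
      have heq := ODE_solution_unique_of_mem_Icc_left (v := fun _ => h.spray) (s := fun _ => D)
        (K := K) (f := fun t => (c t, deriv c t)) (g := fun t => (G (a, t - ℓ), V (a, t - ℓ)))
        (a := 0) (b := ℓ) (fun _ _ => hK)
        (fun t ht => (hdc t ht).continuousAt.continuousWithinAt)
        (fun t ht => (hdc t (Ioc_subset_Icc_self ht)).hasDerivWithinAt)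
        (fun t ht => (hcD' t (Ioc_subset_Icc_self ht)).1) ?_ ?_ ?_ ?_
      · have := heq ⟨le_rfl, hℓ.1.le⟩
        simp only [zero_sub, Prod.mk.injEq] at this
        rw [← this.1, ← this.2, hc0, hdc0]
        exact ⟨rfl, rfl⟩
      all_goals
        have habs' : ∀ t ∈ Icc 0 ℓ, |t - ℓ| < ε := fun t ht => abs_lt.2
          ⟨by linarith [ht.1, hℓ.2], by linarith [ht.2, hℓ.1, hℓ.2]⟩
        have hder : ∀ t ∈ Icc 0 ℓ, HasDerivAt (fun t => (G (a, t - ℓ), V (a, t - ℓ)))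
            (h.spray (G (a, t - ℓ), V (a, t - ℓ))) t := fun t ht =>
          ((hF _ (habs' t ht)).derivG.comp_sub_const t ℓ).prodMk
            ((hF _ (habs' t ht)).derivV.comp_sub_const t ℓ)
      · exact fun t ht => (hder t ht).continuousAt.continuousWithinAt
      · exact fun t ht => (hder t (Ioc_subset_Icc_self ht)).hasDerivWithinAt
      · exact fun t ht => (hFD _ (habs' t (Ioc_subset_Icc_self ht))).1
      · simp only [sub_self]
        rw [(hF 0 h00).base, (hF 0 h00).vel, hcℓ, hT]
    -- Arrival with velocity `-T`: the segment is the tangent geodesic run backwards from time `ℓ`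
    -- to 0, which is again a solution since the spray is quadratic in the velocity.
    · left
      have heq := ODE_solution_unique_of_mem_Icc_left (v := fun _ => h.spray) (s := fun _ => D)
        (K := K) (f := fun t => (c t, deriv c t)) (g := fun t => (G (a, ℓ - t), -V (a, ℓ - t)))
        (a := 0) (b := ℓ) (fun _ _ => hK)
        (fun t ht => (hdc t ht).continuousAt.continuousWithinAt)
        (fun t ht => (hdc t (Ioc_subset_Icc_self ht)).hasDerivWithinAt)
        (fun t ht => (hcD' t (Ioc_subset_Icc_self ht)).1) ?_ ?_ ?_ ?_
      · have := heq ⟨le_rfl, hℓ.1.le⟩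
        simp only [sub_zero, Prod.mk.injEq] at this
        rw [← this.1, ← this.2, hc0, hdc0]
        exact ⟨rfl, rfl⟩
      all_goals
        have habs' : ∀ t ∈ Icc 0 ℓ, |ℓ - t| < ε := fun t ht => abs_lt.2
          ⟨by linarith [ht.2, hℓ.2, hℓ.1], by linarith [ht.1, hℓ.1, hℓ.2]⟩
        have hder : ∀ t ∈ Icc 0 ℓ, HasDerivAt (fun t => (G (a, ℓ - t), -V (a, ℓ - t)))
            (h.spray (G (a, ℓ - t), -V (a, ℓ - t))) t := by
          intro t ht
          have h1 := (hF _ (habs' t ht)).derivG.comp_const_sub ℓ t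
          have h2 := ((hF _ (habs' t ht)).derivV.comp_const_sub ℓ t).neg
          refine (h1.prodMk h2).congr_deriv ?_
          rw [LocalMetric.spray]
          simp only
          rw [← neg_one_smul ℝ (V _), LocalMetric.christoffelVec_smul_left,
            LocalMetric.christoffelVec_smul_right]
          simp
      · exact fun t ht => (hder t ht).continuousAt.continuousWithinAt
      · exact fun t ht => (hder t (Ioc_subset_Icc_self ht)).hasDerivWithinAt
      · exact fun t ht => (hFD _ (habs' t (Ioc_subset_Icc_self ht))).2
      · simp only [sub_self]
        rw [(hF 0 h00).base, (hF 0 h00).vel, hcℓ, hT]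
  · rintro ⟨ha, hℓ, hor⟩
    have haB : a ∈ Metric.ball (0 : ℝ) η := habs (abs_lt.2 ha)
    have hF := fun u (hu : |u| < ε) => (hB _ (hB' a haB u (habs hu))).1
    have h00 : |(0 : ℝ)| < ε := by simpa using hε0
    have hspan : h.unitTangent x a ∈ Submodule.span ℝ {deriv x a} :=
      Submodule.smul_mem _ _ (Submodule.mem_span_singleton_self _)
    rcases hor with ⟨rfl, rfl⟩ | ⟨rfl, rfl⟩
    · have habs' : ∀ t ∈ Icc 0 ℓ, |ℓ - t| < ε := fun t ht => abs_lt.2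
          ⟨by linarith [ht.2, hℓ.2, hℓ.1], by linarith [ht.1, hℓ.1, hℓ.2]⟩
      have hℓ0 := habs' 0 ⟨le_rfl, hℓ.1.le⟩
      rw [sub_zero] at hℓ0
      have hder : ∀ t, |ℓ - t| < ε → HasDerivAt (fun t => G (a, ℓ - t)) (-V (a, ℓ - t)) t :=
        fun t ht => (hF _ ht).derivG.comp_const_sub ℓ t
      have hdd : ∀ t, |ℓ - t| < ε → deriv (fun t => G (a, ℓ - t)) =ᶠ[𝓝 t]
          fun t => -V (a, ℓ - t) := by
        intro t ht
        have hcont : ContinuousAt (fun t => |ℓ - t|) t := by fun_prop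
        filter_upwards [hcont.eventually_lt_const ht] with r hr using (hder r hr).deriv
      refine ⟨ha, hℓ, ?_, fun t => G (a, ℓ - t), fun t ht => ?_, by simp, ?_, ?_, ?_⟩
      · rw [LocalMetric.norm_neg, (hF ℓ hℓ0).regular.norm_eq_one_iff]
        exact (hF ℓ hℓ0).unit
      · have ht' := habs' t ht
        have h2 := ((hF _ ht').derivV.comp_const_sub ℓ t).neg
        refine ⟨mem_of_mem_nhds (hF _ ht').regular.domain, (hder t ht').differentiableAt,
          (hdd t ht').differentiableAt_iff.2 h2.differentiableAt, ?_⟩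
        rw [LocalMetric.covDeriv, (hdd t ht').deriv_eq, (hder t ht').deriv]
        erw [h2.deriv]
        rw [← neg_one_smul ℝ (V _), LocalMetric.christoffelVec_smul_left,
            LocalMetric.christoffelVec_smul_right]
        simp
      · rw [(hder 0 (habs' 0 ⟨le_rfl, hℓ.1.le⟩)).deriv, sub_zero]
      · simp only [sub_self]; exact (hF 0 h00).base
      · rw [(hder ℓ (habs' ℓ ⟨hℓ.1.le, le_rfl⟩)).deriv, sub_self, (hF 0 h00).vel]
        exact Submodule.neg_mem _ hspan
    · have habs' : ∀ t ∈ Icc 0 ℓ, |t - ℓ| < ε := fun t ht => abs_lt.2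
          ⟨by linarith [ht.1, hℓ.2], by linarith [ht.2, hℓ.1, hℓ.2]⟩
      have hℓ0 := habs' 0 ⟨le_rfl, hℓ.1.le⟩
      rw [zero_sub] at hℓ0
      have hder : ∀ t, |t - ℓ| < ε → HasDerivAt (fun t => G (a, t - ℓ)) (V (a, t - ℓ)) t :=
        fun t ht => (hF _ ht).derivG.comp_sub_const t ℓ
      have hdd : ∀ t, |t - ℓ| < ε → deriv (fun t => G (a, t - ℓ)) =ᶠ[𝓝 t]
          fun t => V (a, t - ℓ) := by
        intro t ht
        have hcont : ContinuousAt (fun t => |t - ℓ|) t := by fun_prop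
        filter_upwards [hcont.eventually_lt_const ht] with r hr using (hder r hr).deriv
      refine ⟨ha, hℓ, ?_, fun t => G (a, t - ℓ), fun t ht => ?_, by simp, ?_, ?_, ?_⟩
      · rw [(hF _ hℓ0).regular.norm_eq_one_iff]
        exact (hF _ hℓ0).unit
      · have ht' := habs' t ht
        have h2 := (hF _ ht').derivV.comp_sub_const t ℓ
        refine ⟨mem_of_mem_nhds (hF _ ht').regular.domain, (hder t ht').differentiableAt,
          (hdd t ht').differentiableAt_iff.2 h2.differentiableAt, ?_⟩
        rw [LocalMetric.covDeriv, (hdd t ht').deriv_eq, (hder t ht').deriv]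
        erw [h2.deriv]
        simp
      · rw [(hder 0 (habs' 0 ⟨le_rfl, hℓ.1.le⟩)).deriv, zero_sub]
      · simp only [sub_self]; exact (hF 0 h00).base
      · rw [(hder ℓ (habs' ℓ ⟨hℓ.1.le, le_rfl⟩)).deriv, sub_self, (hF 0 h00).vel]
        exact hspan

/-! ### Inverse and implicit functions. -/

section LocalInverse

theorem exists_local_inverse {E F : Type} [NormedAddCommGroup E] [NormedSpace ℝ E]
    [FiniteDimensional ℝ E] [NormedAddCommGroup F] [NormedSpace ℝ F] [FiniteDimensional ℝ F]
    (hfin : Module.finrank ℝ E = Module.finrank ℝ F) {f : E → F} {a : E} {n : ℕ} (hn : 1 ≤ n)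
    (hf : ContDiffAt ℝ n f a) (hinj : ∀ v, fderiv ℝ f a v = 0 → v = 0) :
    ∃ g : F → E, ContDiffAt ℝ n g (f a) ∧ g (f a) = a ∧ (∀ᶠ x in 𝓝 a, g (f x) = x) ∧
      ∀ᶠ y in 𝓝 (f a), f (g y) = y := by
  have : CompleteSpace E := FiniteDimensional.complete ℝ E
  have hn0 : (n : ℕ∞ω) ≠ 0 := by
    have : n ≠ 0 := by omega
    exact_mod_cast this
  let e : E ≃L[ℝ] F := (LinearEquiv.ofInjectiveOfFinrankEq (fderiv ℝ f a : E →ₗ[ℝ] F)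
    ((injective_iff_map_eq_zero _).2 hinj) hfin).toContinuousLinearEquiv
  have he : HasFDerivAt f (e : E →L[ℝ] F) a := by
    have h1 := (hf.differentiableAt hn0).hasFDerivAt
    convert h1
    ext v
    rfl
  refine ⟨hf.localInverse he hn0, hf.to_localInverse he hn0, hf.localInverse_apply_image he hn0,
    ?_, ?_⟩
  · exact (hf.hasStrictFDerivAt' he hn0).eventually_left_inverse
  · exact (hf.hasStrictFDerivAt' he hn0).eventually_right_inverse

/-- Solving the equation `F (s, p) = y` for `s`. -/
theorem exists_solution {F : ℝ × ℝ → ℝ} {a : ℝ × ℝ} {n : ℕ} (hn : 1 ≤ n)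
    (hF : ContDiffAt ℝ n F a) (hne : fderiv ℝ F a (1, 0) ≠ 0) :
    ∃ β : ℝ × ℝ → ℝ, ContDiffAt ℝ n β (F a, a.2) ∧ β (F a, a.2) = a.1 ∧
      (∀ᶠ q in 𝓝 a, β (F q, q.2) = q.1) ∧ ∀ᶠ q in 𝓝 (F a, a.2), F (β q, q.2) = q.1 := by
  have hn0 : (n : ℕ∞ω) ≠ 0 := by
    have : n ≠ 0 := by omega
    exact_mod_cast this
  have hf : ContDiffAt ℝ n (fun q : ℝ × ℝ => (F q, q.2)) a := hF.prodMk contDiffAt_snd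
  have hd : fderiv ℝ (fun q : ℝ × ℝ => (F q, q.2)) a =
      (fderiv ℝ F a).prod (ContinuousLinearMap.snd ℝ ℝ ℝ) :=
    ((hF.differentiableAt hn0).hasFDerivAt.prodMk hasFDerivAt_snd).fderiv
  obtain ⟨g, hg, hga, h1, h2⟩ := exists_local_inverse rfl hn hf (by
    rintro ⟨v, v'⟩ hv
    rw [hd] at hv
    simp only [ContinuousLinearMap.prod_apply, ContinuousLinearMap.coe_snd',
      Prod.mk_eq_zero] at hv
    obtain ⟨hv1, rfl⟩ := hv
    have : ((v, 0) : ℝ × ℝ) = v • (1, 0) := by simp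
    rw [this, map_smul, smul_eq_mul] at hv1
    simpa using (mul_eq_zero.1 hv1).resolve_right hne)
  refine ⟨fun q => (g q).1, contDiffAt_fst.comp _ hg, by simp [hga], h1.mono fun q hq => congrArg Prod.fst hq,
    h2.mono fun q hq => ?_⟩
  have h3 := congrArg Prod.fst hq
  have h4 := congrArg Prod.snd hq
  simp only at h3 h4
  rw [← h4, Prod.mk.eta, h3]

end LocalInverse

/-! ### Coordinates adapted to the curve. -/

theorem IsCurvedAt.curvatureVec_ne (H : IsCurvedAt h k x) : h.curvatureVec x 0 ≠ 0 := by
  intro h0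
  have := H.curv
  rw [LocalMetric.geodesicCurvature, h0] at this
  simp [LocalMetric.norm, LocalMetric.ip_eq] at this

theorem IsCurvedAt.norm_deriv_pos (H : IsCurvedAt h k x) : 0 < h.norm (x 0) (deriv x 0) :=
  H.metric.norm_pos H.deriv_ne

theorem IsCurvedAt.covDeriv_unitTangent (H : IsCurvedAt h k x) :
    deriv (h.unitTangent x) 0 + h.christoffelVec (x 0) (deriv x 0) (h.unitTangent x 0) =
      h.norm (x 0) (deriv x 0) • h.curvatureVec x 0 := by
  rw [LocalMetric.curvatureVec, smul_smul, mul_inv_cancel₀ H.norm_deriv_pos.ne', one_smul]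
  rfl

theorem IsCurvedAt.ne_zero (H : IsCurvedAt h k x) : (k : ℕ∞ω) ≠ 0 := by
  have : k ≠ 0 := by have := H.two_le; omega
  exact_mod_cast this

theorem IsCurvedAt.pred_ne_zero (H : IsCurvedAt h k x) : ((k - 1 : ℕ) : ℕ∞ω) ≠ 0 := by
  have : k - 1 ≠ 0 := by have := H.two_le; omega
  exact_mod_cast this

/-- Differentiate `⟨T, T⟩ = 1` along the curve. Orthogonality makes `sideMap` a local diffeomorphism
and isolates the normal component of a velocity. -/
theorem IsCurvedAt.ip_curvatureVec (H : IsCurvedAt h k x) :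
    h.ip (x 0) (deriv x 0) (h.curvatureVec x 0) = 0 := by
  have hx := (H.smooth.differentiableAt H.ne_zero).hasDerivAt
  have hT := (H.contDiffAt_unitTangent.differentiableAt H.pred_ne_zero).hasDerivAt
  have h1 := H.metric.hasDerivAt_ip (by have := H.two_le; omega) hx hT hT
  have hev : ∀ᶠ s in 𝓝 (0 : ℝ), h.ip (x s) (h.unitTangent x s) (h.unitTangent x s) = 1 := by
    have hd : ContinuousAt (deriv x) 0 :=
      (contDiffAt_deriv H.smooth (by have := H.two_le; omega)).continuousAt
    filter_upwards [H.smooth.continuousAt.eventually H.metric.eventually,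
      hd.eventually_ne H.deriv_ne] with s hs hs'
    have hn := hs.norm_pos hs'
    rw [LocalMetric.unitTangent, LocalMetric.ip_smul_left, LocalMetric.ip_smul_right,
      ← hs.norm_sq]
    field_simp
  have h2 := h1.unique ((hasDerivAt_const (0 : ℝ) (1 : ℝ)).congr_of_eventuallyEq hev)
  rw [H.covDeriv_unitTangent, LocalMetric.ip_smul_left, LocalMetric.ip_smul_right,
    H.metric.ip_symm (h.unitTangent x 0), LocalMetric.unitTangent, LocalMetric.ip_smul_right] at h2
  have hn := H.norm_deriv_pos
  rw [H.metric.ip_symm]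
  have h3 : h.norm (x 0) (deriv x 0) * (h.norm (x 0) (deriv x 0))⁻¹ = 1 := mul_inv_cancel₀ hn.ne'
  linear_combination (1 / 2) * h2 - h.ip (x 0) (h.curvatureVec x 0) (deriv x 0) * h3

/-- The coordinates `(σ, t) ↦ x σ - t n` near the curve, where `n` is the curvature vector. -/
def sideMap (h : LocalMetric) (x : ℝ → Plane) (p : ℝ × ℝ) : Plane :=
  x p.1 - p.2 • h.curvatureVec x 0

theorem hasFDerivAt_sideMap {p : ℝ × ℝ} (hx : DifferentiableAt ℝ x p.1) :
    HasFDerivAt (sideMap h x) ((ContinuousLinearMap.fst ℝ ℝ ℝ).smulRight (deriv x p.1) -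
      (ContinuousLinearMap.snd ℝ ℝ ℝ).smulRight (h.curvatureVec x 0)) p := by
  have h1 : HasFDerivAt (fun p : ℝ × ℝ => x p.1)
      ((ContinuousLinearMap.fst ℝ ℝ ℝ).smulRight (deriv x p.1)) p := by
    have := hx.hasDerivAt.hasFDerivAt.comp p hasFDerivAt_fst
    refine this.congr_fderiv ?_
    ext <;> simp
  have h2 : HasFDerivAt (fun p : ℝ × ℝ => p.2 • h.curvatureVec x 0)
      ((ContinuousLinearMap.snd ℝ ℝ ℝ).smulRight (h.curvatureVec x 0)) p :=
    hasFDerivAt_snd.smul_const _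
  exact h1.sub h2

theorem contDiffAt_sideMap {n : ℕ} {p : ℝ × ℝ} (hx : ContDiffAt ℝ n x p.1) :
    ContDiffAt ℝ n (sideMap h x) p :=
  (hx.comp p contDiffAt_fst).sub (contDiffAt_snd.smul contDiffAt_const)

theorem IsCurvedAt.eventually_curve (H : IsCurvedAt h k x) :
    ∀ᶠ s in 𝓝 (0 : ℝ), ContDiffAt ℝ k x s ∧ deriv x s ≠ 0 ∧ h.IsRegularAt k (x s) := by
  have hd : ContinuousAt (deriv x) 0 :=
    (contDiffAt_deriv H.smooth (by have := H.two_le; omega)).continuousAt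
  exact (H.smooth.eventually (by simp)).and ((hd.eventually_ne H.deriv_ne).and
    (H.smooth.continuousAt.eventually H.metric.eventually))

/-- The inverse of the coordinates `sideMap`. -/
theorem IsCurvedAt.exists_sideChart (H : IsCurvedAt h k x) :
    ∃ Θ : Plane → ℝ × ℝ, ContDiffAt ℝ k Θ (x 0) ∧ Θ (x 0) = (0, 0) ∧
      (∀ᶠ p in 𝓝 ((0 : ℝ), (0 : ℝ)), Θ (sideMap h x p) = p) ∧
      ∀ᶠ C in 𝓝 (x 0), sideMap h x (Θ C) = C := by
  have h0 : sideMap h x (0, 0) = x 0 := by simp [sideMap]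
  have hd : DifferentiableAt ℝ x ((0 : ℝ), (0 : ℝ)).1 := H.smooth.differentiableAt H.ne_zero
  have := exists_local_inverse (f := sideMap h x) (a := (0, 0)) (n := k)
    (by simp) (by have := H.two_le; omega) (contDiffAt_sideMap H.smooth) (by
      rintro ⟨a, b⟩ hv
      rw [(hasFDerivAt_sideMap hd).fderiv] at hv
      simp only [sub_apply, ContinuousLinearMap.smulRight_apply,
        ContinuousLinearMap.coe_fst', ContinuousLinearMap.coe_snd'] at hv
      have h1 : h.ip (x 0) (a • deriv x 0 - b • h.curvatureVec x 0) (deriv x 0) = 0 := by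
        rw [hv]; simp [LocalMetric.ip_eq]
      have h2 : h.ip (x 0) (a • deriv x 0 - b • h.curvatureVec x 0) (h.curvatureVec x 0) = 0 := by
        rw [hv]; simp [LocalMetric.ip_eq]
      rw [LocalMetric.ip_sub_left, LocalMetric.ip_smul_left, LocalMetric.ip_smul_left] at h1 h2
      rw [H.metric.ip_symm (h.curvatureVec x 0) (deriv x 0), H.ip_curvatureVec, mul_zero,
        sub_zero] at h1
      rw [H.ip_curvatureVec, mul_zero, zero_sub, neg_eq_zero] at h2
      rw [(mul_eq_zero.1 h1).resolve_right (H.metric.ip_pos H.deriv_ne).ne',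
        (mul_eq_zero.1 h2).resolve_right (H.metric.ip_pos H.curvatureVec_ne).ne']
      rfl)
  rwa [h0] at this

/-! ### Division by the square of the distance to the diagonal. -/

/-- Hadamard's lemma in the second variable, by integration along the vertical segment from the
diagonal point `(p.1, p.1)` to `p`. -/
theorem eventually_eq_mul_integral {F M : ℝ × ℝ → ℝ} (hM : ContDiffAt ℝ 0 M (0, 0))
    (hd : ∀ᶠ p in 𝓝 ((0 : ℝ), (0 : ℝ)), HasDerivAt (fun σ => F (p.1, σ)) (M p) p.2)
    (h0 : ∀ᶠ p in 𝓝 ((0 : ℝ), (0 : ℝ)), F (p.1, p.1) = 0) :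
    ∀ᶠ p in 𝓝 ((0 : ℝ), (0 : ℝ)),
      F p = (p.2 - p.1) * ∫ θ in (0 : ℝ)..1, M (p.1, p.1 + θ * (p.2 - p.1)) := by
  have hMc : ∀ᶠ p in 𝓝 ((0 : ℝ), (0 : ℝ)), ContinuousAt M p :=
    (hM.eventually (by simp)).mono fun p hp => hp.continuousAt
  obtain ⟨η, hη, hB⟩ := Metric.eventually_nhds_iff_ball.1 (hd.and (h0.and hMc))
  filter_upwards [Metric.ball_mem_nhds _ hη] with p hp
  have hseg : ∀ θ ∈ Icc (0 : ℝ) 1,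
      (p.1, p.1 + θ * (p.2 - p.1)) ∈ Metric.ball ((0 : ℝ), (0 : ℝ)) η := by
    intro θ hθ
    rw [← ball_prod_same] at hp ⊢
    have hc := convex_ball (0 : ℝ) η hp.1 hp.2 (sub_nonneg.2 hθ.2) hθ.1 (by ring)
    refine ⟨hp.1, ?_⟩
    convert hc using 1
    simp only [smul_eq_mul]; ring
  have hder : ∀ θ ∈ uIcc (0 : ℝ) 1, HasDerivAt (fun θ => F (p.1, p.1 + θ * (p.2 - p.1)))
      ((p.2 - p.1) * M (p.1, p.1 + θ * (p.2 - p.1))) θ := by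
    intro θ hθ
    rw [uIcc_of_le zero_le_one] at hθ
    have h1 := (hB _ (hseg θ hθ)).1
    have h2 : HasDerivAt (fun θ : ℝ => p.1 + θ * (p.2 - p.1)) (p.2 - p.1) θ := by
      simpa using ((hasDerivAt_id θ).mul_const (p.2 - p.1)).const_add p.1
    exact (h1.comp θ h2).congr_deriv (mul_comm _ _)
  have hcont : ContinuousOn (fun θ => (p.2 - p.1) * M (p.1, p.1 + θ * (p.2 - p.1)))
      (uIcc (0 : ℝ) 1) := by
    intro θ hθ
    rw [uIcc_of_le zero_le_one] at hθ
    refine continuousWithinAt_const.mul ?_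
    exact ContinuousAt.comp_continuousWithinAt (g := M)
      (f := fun θ => (p.1, p.1 + θ * (p.2 - p.1))) (hB _ (hseg θ hθ)).2.2 (by fun_prop)
  have h1 := intervalIntegral.integral_eq_sub_of_hasDerivAt hder hcont.intervalIntegrable
  rw [intervalIntegral.integral_const_mul] at h1
  rw [h1]
  simp only [one_mul, zero_mul, add_zero, add_sub_cancel, Prod.mk.eta]
  rw [(hB p hp).2.1, sub_zero]

/-- A function which vanishes, together with its derivative in the second variable, on the
diagonal, is divisible by the square of the difference of the variables. -/
theorem exists_sq_mul {n : ℕ} {F M : ℝ × ℝ → ℝ} (hM : ContDiffAt ℝ (n + 1 : ℕ) M (0, 0))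
    (hd : ∀ᶠ p in 𝓝 ((0 : ℝ), (0 : ℝ)), HasDerivAt (fun σ => F (p.1, σ)) (M p) p.2)
    (h0 : ∀ᶠ p in 𝓝 ((0 : ℝ), (0 : ℝ)), F (p.1, p.1) = 0)
    (h0' : ∀ᶠ p in 𝓝 ((0 : ℝ), (0 : ℝ)), M (p.1, p.1) = 0) :
    ∃ R : ℝ × ℝ → ℝ, ContDiffAt ℝ n R (0, 0) ∧ R (0, 0) = fderiv ℝ M (0, 0) (0, 1) / 2 ∧
      ∀ᶠ p in 𝓝 ((0 : ℝ), (0 : ℝ)), F p = (p.1 - p.2) ^ 2 * R p := by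
  -- Hadamard's lemma is used twice: `M = (σ - s) N` with `N` an average of `D`, and then `F = (σ -
  -- s)² ∫ θ N`. Only `M` is differentiated, and only once, so a single order is lost. The factor
  -- `1/2` in `R (0, 0)` is `∫ θ dθ`.
  let D : ℝ × ℝ → ℝ := fun p => fderiv ℝ M p (0, 1)
  let N : ℝ × ℝ → ℝ := fun p => ∫ θ in (0 : ℝ)..1, D (p.1, p.1 + θ * (p.2 - p.1))
  let R : ℝ × ℝ → ℝ := fun p => ∫ θ in (0 : ℝ)..1, θ * N (p.1, p.1 + θ * (p.2 - p.1))
  have hD : ContDiffAt ℝ n D (0, 0) :=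
    (hM.fderiv_right (m := n) (by norm_cast)).clm_apply contDiffAt_const
  have hN : ContDiffAt ℝ n N (0, 0) := by
    refine contDiffAt_parametric_integral
      (H := fun v : ℝ × (ℝ × ℝ) => D (v.2.1, v.2.1 + v.1 * (v.2.2 - v.2.1))) fun θ hθ => ?_
    refine ContDiffAt.comp (g := D) (θ, ((0 : ℝ), (0 : ℝ)))
      (f := fun v : ℝ × (ℝ × ℝ) => (v.2.1, v.2.1 + v.1 * (v.2.2 - v.2.1))) ?_ (by fun_prop)
    simpa using hD
  have hR : ContDiffAt ℝ n R (0, 0) := by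
    refine contDiffAt_parametric_integral
      (H := fun v : ℝ × (ℝ × ℝ) => v.1 * N (v.2.1, v.2.1 + v.1 * (v.2.2 - v.2.1))) fun θ hθ => ?_
    refine contDiffAt_fst.mul ?_
    refine ContDiffAt.comp (g := N) (θ, ((0 : ℝ), (0 : ℝ)))
      (f := fun v : ℝ × (ℝ × ℝ) => (v.2.1, v.2.1 + v.1 * (v.2.2 - v.2.1))) ?_ (by fun_prop)
    simpa using hN
  have hMd : ∀ᶠ p in 𝓝 ((0 : ℝ), (0 : ℝ)), HasDerivAt (fun σ => M (p.1, σ)) (D p) p.2 :=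
    (hM.eventually (by simp)).mono fun p hp => hasDerivAt_snd_slice (hp.differentiableAt (by simp))
  have e1 := eventually_eq_mul_integral (hM.of_le (by simp)) hd h0
  have e2 := eventually_eq_mul_integral (hD.of_le (by simp)) hMd h0'
  refine ⟨R, hR, ?_, ?_⟩
  · simp only [R, N, sub_self, mul_zero, add_zero, intervalIntegral.integral_const, sub_zero,
      one_smul]
    rw [intervalIntegral.integral_mul_const, integral_id]
    simp only [D]
    ring
  · obtain ⟨η, hη, hB⟩ := Metric.eventually_nhds_iff_ball.1 e2
    filter_upwards [e1, Metric.ball_mem_nhds _ hη] with p hp1 hp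
    rw [hp1]
    have hcongr : ∫ θ in (0 : ℝ)..1, M (p.1, p.1 + θ * (p.2 - p.1)) =
        ∫ θ in (0 : ℝ)..1, (p.2 - p.1) * (θ * N (p.1, p.1 + θ * (p.2 - p.1))) := by
      refine intervalIntegral.integral_congr fun θ hθ => ?_
      rw [uIcc_of_le zero_le_one] at hθ
      have hmem : (p.1, p.1 + θ * (p.2 - p.1)) ∈ Metric.ball ((0 : ℝ), (0 : ℝ)) η := by
        rw [← ball_prod_same] at hp ⊢
        have hc := convex_ball (0 : ℝ) η hp.1 hp.2 (sub_nonneg.2 hθ.2) hθ.1 (by ring)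
        refine ⟨hp.1, ?_⟩
        convert hc using 1
        simp only [smul_eq_mul]; ring
      have := hB _ hmem
      simp only at this ⊢
      rw [this]
      simp only [N, D]
      ring
    rw [hcongr, intervalIntegral.integral_const_mul]
    simp only [R]
    ring

/-! ### The tangent geodesics cut by the coordinate lines. -/

/-- The family of geodesics tangent to the curve, in the coordinates `sideMap`: the geodesic
tangent at the parameter `p.1` meets the line `σ = p.2` at the height `t = f p` at the time `τ p`
with the velocity `w p`. -/
structure IsSlicedAt (h : LocalMetric) (k : ℕ) (x : ℝ → Plane) (τ f : ℝ × ℝ → ℝ)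
    (w : ℝ × ℝ → Plane) (p : ℝ × ℝ) : Prop where
  smooth : ContDiffAt ℝ k x p.1
  deriv_ne : deriv x p.1 ≠ 0
  contDiffτ : ContDiffAt ℝ (k - 1 : ℕ) τ p
  contDifff : ContDiffAt ℝ (k - 1 : ℕ) f p
  contDiffw : ContDiffAt ℝ (k - 1 : ℕ) w p
  diagτ : τ (p.1, p.1) = 0
  diagf : f (p.1, p.1) = 0
  diagw : w (p.1, p.1) = h.unitTangent x p.1
  dτ_pos : 0 < fderiv ℝ τ p (0, 1)
  df_pos : p.2 < p.1 → 0 < fderiv ℝ f p (1, 0)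
  df_neg : p.1 < p.2 → fderiv ℝ f p (1, 0) < 0
  regular : h.IsRegularAt k (sideMap h x (p.2, f p))
  unit : h.ip (sideMap h x (p.2, f p)) (w p) (w p) = 1
  eikonal : ∀ v : ℝ × ℝ, fderiv ℝ τ p v + h.norm (x p.1) (deriv x p.1) * v.1 =
    h.ip (sideMap h x (p.2, f p)) (w p)
      (v.2 • deriv x p.2 - (fderiv ℝ f p v) • h.curvatureVec x 0)

/-- The curvature enters through `R_pos` and `dw`: the tangent geodesics bend away from the curve to
second order, and their velocities turn towards the curvature vector as `s` grows. In `segment`, `ε`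
is fixed before the neighbourhood of `q`, so the point may be taken much closer to the curve than
the range allowed to tangency parameters and lengths. -/
structure IsSlicing (h : LocalMetric) (k : ℕ) (x : ℝ → Plane) (τ f R : ℝ × ℝ → ℝ)
    (w : ℝ × ℝ → Plane) : Prop where
  sliced : ∀ᶠ p in 𝓝 ((0 : ℝ), (0 : ℝ)), IsSlicedAt h k x τ f w p
  quad : ∀ᶠ p in 𝓝 ((0 : ℝ), (0 : ℝ)), f p = (p.1 - p.2) ^ 2 * R p
  contDiffR : ContDiffAt ℝ (k - 2 : ℕ) R (0, 0)
  R_pos : 0 < R (0, 0)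
  dw : fderiv ℝ w (0, 0) (1, 0) = h.norm (x 0) (deriv x 0) • h.curvatureVec x 0
  segment : ∀ᶠ ε in 𝓝[>] (0 : ℝ), ∀ᶠ q in 𝓝 ((0 : ℝ), (0 : ℝ)), ∀ a ℓ ζ,
    IsTangentSegment h x ε (sideMap h x q) a ℓ ζ ↔
      a ∈ Ioo (-ε) ε ∧ ℓ ∈ Ioo 0 ε ∧ f (a, q.1) = q.2 ∧
        ((τ (a, q.1) = ℓ ∧ ζ = -w (a, q.1)) ∨ (τ (a, q.1) = -ℓ ∧ ζ = w (a, q.1)))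

/-- Near the origin each tangent geodesic has positive velocity along `σ`, so `σ` can replace time
as its parameter. The slope `M = ∂_σ f` vanishes on the diagonal, and its derivatives at the origin
are `∓ν²` with `ν = |x'(0)|`. This yields `R(0, 0) = ν² / 2` and the sign of `∂_s f` on either side
of the diagonal. -/
theorem IsCurvedAt.exists_slicing (H : IsCurvedAt h k x) :
    ∃ (τ f R : ℝ × ℝ → ℝ) (w : ℝ × ℝ → Plane), IsSlicing h k x τ f R w := by
  have hk2 := H.two_le
  have hk0 := H.pred_ne_zero
  have hk1 : (1 : ℕ∞ω) ≤ ((k - 1 : ℕ) : ℕ∞ω) := by norm_cast; omega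
  obtain ⟨G, V, hGV⟩ := H.exists_tangentFlow
  obtain ⟨Θ, hΘ, hΘ0, hΘl, hΘr⟩ := H.exists_sideChart
  set n₀ := h.curvatureVec x 0 with hn₀
  set ν : ℝ → ℝ := fun s => h.norm (x s) (deriv x s) with hν
  have hν0 : 0 < ν 0 := H.norm_deriv_pos
  have hG00 : G (0, 0) = x 0 := hGV.self_of_nhds.base
  have hGc : ContDiffAt ℝ (k - 1 : ℕ) G (0, 0) := hGV.self_of_nhds.contDiffG
  have hVc : ContDiffAt ℝ (k - 1 : ℕ) V (0, 0) := hGV.self_of_nhds.contDiffV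
  have hfst : ContinuousAt (Prod.fst : ℝ × ℝ → ℝ) (0, 0) := continuousAt_fst
  have hdiag : ContinuousAt (fun p : ℝ × ℝ => (p.1, p.1)) (0, 0) := by fun_prop
  have hzero : ContinuousAt (fun p : ℝ × ℝ => (p.1, (0 : ℝ))) (0, 0) := by fun_prop
  have hline : ContinuousAt (fun s : ℝ => (s, (0 : ℝ))) 0 := by fun_prop
  -- the velocity of the flow in the coordinates
  let A : ℝ × ℝ → ℝ × ℝ := fun p => fderiv ℝ Θ (G p) (V p)
  have hΘ' : ContDiffAt ℝ (k - 1 : ℕ) (fderiv ℝ Θ) (G (0, 0)) := by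
    rw [hG00]; exact hΘ.fderiv_right (m := (k - 1 : ℕ)) (by norm_cast; omega)
  have hA : ContDiffAt ℝ (k - 1 : ℕ) A (0, 0) := (hΘ'.comp ((0 : ℝ), (0 : ℝ)) hGc).clm_apply hVc
  have hGx : Tendsto G (𝓝 (0, 0)) (𝓝 (x 0)) := by rw [← hG00]; exact hGc.continuousAt
  have hΘd : ∀ᶠ p in 𝓝 ((0 : ℝ), (0 : ℝ)), ContDiffAt ℝ k Θ (G p) :=
    hGx.eventually (hΘ.eventually (by simp))
  have hΘG : ∀ᶠ p in 𝓝 ((0 : ℝ), (0 : ℝ)),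
      HasDerivAt (fun u => Θ (G (p.1, u))) (A p) p.2 := by
    filter_upwards [hΘd, hGV] with p h1 h2
    exact (h1.differentiableAt H.ne_zero).hasFDerivAt.comp_hasDerivAt p.2 h2.derivG
  have hΘx : ∀ᶠ s in 𝓝 (0 : ℝ), Θ (x s) = (s, 0) := by
    filter_upwards [hline.eventually hΘl] with s hs
    simpa [sideMap] using hs
  have hΘx' : ∀ᶠ s in 𝓝 (0 : ℝ), ContDiffAt ℝ k Θ (x s) :=
    H.smooth.continuousAt.eventually (hΘ.eventually (by simp))
  have hAdiag : ∀ᶠ s in 𝓝 (0 : ℝ), A (s, 0) = (ν s)⁻¹ • (1, 0) := by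
    filter_upwards [hΘx.eventually_nhds, hΘx', H.eventually_curve, hline.eventually hGV]
      with s h1 h2 h3 h4
    have h5 : HasDerivAt (fun s => Θ (x s)) (fderiv ℝ Θ (x s) (deriv x s)) s :=
      (h2.differentiableAt H.ne_zero).hasFDerivAt.comp_hasDerivAt s
        (h3.1.differentiableAt H.ne_zero).hasDerivAt
    have h6 : HasDerivAt (fun s : ℝ => Θ (x s)) ((1 : ℝ), (0 : ℝ)) s :=
      ((hasDerivAt_id s).prodMk (hasDerivAt_const s (0 : ℝ))).congr_of_eventuallyEq h1
    simp only [A]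
    rw [h4.base, h4.vel, LocalMetric.unitTangent, map_smul, h5.unique h6]
  have hAV : ∀ᶠ p in 𝓝 ((0 : ℝ), (0 : ℝ)),
      (A p).1 • deriv x (Θ (G p)).1 - (A p).2 • n₀ = V p := by
    have hxΘ : ∀ᶠ C in 𝓝 (x 0), ContDiffAt ℝ k x (Θ C).1 := by
      have h1 : ContinuousAt (fun C => (Θ C).1) (x 0) := hΘ.continuousAt.fst
      exact h1.eventually (by simp only [hΘ0]; exact H.smooth.eventually (by simp))
    filter_upwards [hΘd, hGx.eventually hΘr.eventually_nhds, hGx.eventually hxΘ] with p h1 h2 h3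
    have h4 := (hasFDerivAt_sideMap (h := h) (p := Θ (G p))
      (h3.differentiableAt H.ne_zero)).comp (G p) (h1.differentiableAt H.ne_zero).hasFDerivAt
    have h5 := h4.unique ((hasFDerivAt_id (G p)).congr_of_eventuallyEq h2)
    have h6 := DFunLike.congr_fun h5 (V p)
    simpa [A] using h6
  -- the arrival time
  let F : ℝ × ℝ → ℝ := fun q => (Θ (G (q.2, q.1))).1
  have hswap : ContDiff ℝ (k - 1 : ℕ) (fun q : ℝ × ℝ => (q.2, q.1)) := by fun_prop
  have hF0 : F (0, 0) = 0 := by simp [F, hG00, hΘ0]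
  have hΘG' : ContDiffAt ℝ (k - 1 : ℕ) (fun p => Θ (G p)) (0, 0) := by
    refine ContDiffAt.comp (g := Θ) (0, 0) ?_ hGc
    rw [hG00]; exact hΘ.of_le (by norm_cast; omega)
  have hFc : ContDiffAt ℝ (k - 1 : ℕ) F (0, 0) :=
    contDiffAt_fst.comp _ (ContDiffAt.comp (g := fun p => Θ (G p)) ((0 : ℝ), (0 : ℝ)) hΘG'
      hswap.contDiffAt)
  have hF1 : fderiv ℝ F (0, 0) (1, 0) ≠ 0 := by
    have h1 : HasDerivAt (fun u => F (u, 0)) (fderiv ℝ F (0, 0) (1, 0)) 0 :=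
      hasDerivAt_fst_slice (q := (0, 0)) (hFc.differentiableAt hk0)
    have h2 : HasDerivAt (fun u => (Θ (G (0, u))).1) (A (0, 0)).1 0 := hΘG.self_of_nhds.fst
    rw [h1.unique h2, hAdiag.self_of_nhds]
    simp [hν0.ne']
  -- The arrival time: `F (u, s) = σ` is solved for `u`, which is possible because the geodesic
  -- crosses the line with `σ`-velocity `1/ν ≠ 0` at the origin.
  obtain ⟨β, hβc, hβ0, hβl, hβr⟩ := exists_solution (by omega) hFc hF1
  rw [hF0] at hβc hβ0 hβr
  simp only at hβc hβ0 hβr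
  let τ : ℝ × ℝ → ℝ := fun p => β (p.2, p.1)
  have hτc : ContDiffAt ℝ (k - 1 : ℕ) τ (0, 0) :=
    ContDiffAt.comp (g := β) ((0 : ℝ), (0 : ℝ)) hβc hswap.contDiffAt
  have hτ0 : τ (0, 0) = 0 := hβ0
  let q : ℝ × ℝ → ℝ × ℝ := fun p => (p.1, τ p)
  have hqc : ContDiffAt ℝ (k - 1 : ℕ) q (0, 0) := contDiffAt_fst.prodMk hτc
  have hq0 : q (0, 0) = (0, 0) := by simp [q, hτ0]
  have hqt : Tendsto q (𝓝 (0, 0)) (𝓝 (0, 0)) := by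
    have := hqc.continuousAt; rwa [ContinuousAt, hq0] at this
  let w : ℝ × ℝ → Plane := fun p => V (q p)
  let f : ℝ × ℝ → ℝ := fun p => (Θ (G (q p))).2
  have hwc : ContDiffAt ℝ (k - 1 : ℕ) w (0, 0) :=
    ContDiffAt.comp (g := V) ((0 : ℝ), (0 : ℝ)) (by rwa [hq0]) hqc
  have hfc : ContDiffAt ℝ (k - 1 : ℕ) f (0, 0) :=
    contDiffAt_snd.comp _ (ContDiffAt.comp (g := fun p => Θ (G p)) ((0 : ℝ), (0 : ℝ))
      (by rwa [hq0]) hqc)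
  have hAqc : ContDiffAt ℝ (k - 1 : ℕ) (fun p => A (q p)) (0, 0) :=
    ContDiffAt.comp (g := A) ((0 : ℝ), (0 : ℝ)) (by rwa [hq0]) hqc
  have hsw : Tendsto (fun p : ℝ × ℝ => (p.2, p.1)) (𝓝 (0, 0)) (𝓝 (0, 0)) :=
    (hswap.continuous.continuousAt (x := ((0 : ℝ), (0 : ℝ))))
  have hΘq : ∀ᶠ p in 𝓝 ((0 : ℝ), (0 : ℝ)), Θ (G (q p)) = (p.2, f p) := by
    filter_upwards [hsw.eventually hβr] with p hp
    exact Prod.ext hp rfl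
  have hτl : ∀ᶠ p in 𝓝 ((0 : ℝ), (0 : ℝ)), τ (p.1, (Θ (G p)).1) = p.2 := hsw.eventually hβl
  have hside : ∀ᶠ p in 𝓝 ((0 : ℝ), (0 : ℝ)), sideMap h x (p.2, f p) = G (q p) := by
    filter_upwards [hΘq, (hGx.comp hqt).eventually hΘr] with p h1 h2
    rw [← h1]; exact h2
  have hwA : ∀ᶠ p in 𝓝 ((0 : ℝ), (0 : ℝ)),
      w p = (A (q p)).1 • deriv x p.2 - (A (q p)).2 • n₀ := by
    filter_upwards [hΘq, hqt.eventually hAV] with p h1 h2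
    rw [h1] at h2; exact h2.symm
  have hΘx2 := hfst.eventually hΘx
  have hdτ : ∀ᶠ p in 𝓝 ((0 : ℝ), (0 : ℝ)), τ (p.1, p.1) = 0 := by
    filter_upwards [hzero.eventually hτl, hΘx2, hzero.eventually hGV] with p h1 h2 h3
    simpa [h3.base, h2] using h1
  have hdq : ∀ᶠ p in 𝓝 ((0 : ℝ), (0 : ℝ)), q (p.1, p.1) = (p.1, 0) :=
    hdτ.mono fun p hp => by simp [q, hp]
  have hdf : ∀ᶠ p in 𝓝 ((0 : ℝ), (0 : ℝ)), f (p.1, p.1) = 0 := by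
    filter_upwards [hdq, hΘx2, hzero.eventually hGV] with p h1 h2 h3
    simp only [f, h1]; rw [h3.base, h2]
  have hdw : ∀ᶠ p in 𝓝 ((0 : ℝ), (0 : ℝ)), w (p.1, p.1) = h.unitTangent x p.1 := by
    filter_upwards [hdq, hzero.eventually hGV] with p h1 h3
    simp only [w, h1]; rw [h3.vel]
  have hτd : ∀ᶠ p in 𝓝 ((0 : ℝ), (0 : ℝ)), ContDiffAt ℝ (k - 1 : ℕ) τ p :=
    hτc.eventually (by simp)
  have hfd : ∀ᶠ p in 𝓝 ((0 : ℝ), (0 : ℝ)), ContDiffAt ℝ (k - 1 : ℕ) f p :=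
    hfc.eventually (by simp)
  have hwd : ∀ᶠ p in 𝓝 ((0 : ℝ), (0 : ℝ)), ContDiffAt ℝ (k - 1 : ℕ) w p :=
    hwc.eventually (by simp)
  have hA00 : (A (0, 0)).1 = (ν 0)⁻¹ := by rw [hAdiag.self_of_nhds]; simp
  have hA1pos : ∀ᶠ p in 𝓝 ((0 : ℝ), (0 : ℝ)), 0 < (A (q p)).1 := by
    have h1 : ContinuousAt (fun p => (A (q p)).1) (0, 0) := hAqc.continuousAt.fst
    refine h1.eventually_const_lt ?_
    simp only [hq0, hA00]; positivity
  -- derivatives in the second variable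
  have hsnd : ∀ᶠ p in 𝓝 ((0 : ℝ), (0 : ℝ)), fderiv ℝ τ p (0, 1) = (A (q p)).1⁻¹ ∧
      fderiv ℝ f p (0, 1) = (A (q p)).2 / (A (q p)).1 := by
    filter_upwards [hτd, hfd, hqt.eventually hΘG, hΘq.eventually_nhds, hA1pos] with p h1 h2 h3 h4 h5
    have h6 : HasDerivAt (fun σ => τ (p.1, σ)) (fderiv ℝ τ p (0, 1)) p.2 :=
      hasDerivAt_snd_slice (h1.differentiableAt hk0)
    have h7 : HasDerivAt (fun σ => f (p.1, σ)) (fderiv ℝ f p (0, 1)) p.2 :=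
      hasDerivAt_snd_slice (h2.differentiableAt hk0)
    have h8 : HasDerivAt (fun σ => Θ (G (p.1, τ (p.1, σ)))) (fderiv ℝ τ p (0, 1) • A (q p)) p.2 :=
      HasDerivAt.scomp p.2 (h := fun σ => τ (p.1, σ)) (g₁ := fun u => Θ (G (p.1, u))) h3 h6
    have h9 : HasDerivAt (fun σ => Θ (G (p.1, τ (p.1, σ)))) (1, fderiv ℝ f p (0, 1)) p.2 := by
      refine ((hasDerivAt_id p.2).prodMk h7).congr_of_eventuallyEq ?_
      have hc : ContinuousAt (fun σ => (p.1, σ)) p.2 := by fun_prop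
      filter_upwards [hc.eventually h4] with σ hσ using hσ
    have h10 := h8.unique h9
    have e1 : fderiv ℝ τ p (0, 1) * (A (q p)).1 = 1 := congrArg Prod.fst h10
    have e2 : fderiv ℝ τ p (0, 1) * (A (q p)).2 = fderiv ℝ f p (0, 1) := congrArg Prod.snd h10
    have e3 := eq_inv_of_mul_eq_one_left e1
    refine ⟨e3, ?_⟩
    rw [← e2, e3]; field_simp
  -- As a quotient of velocity components, `∂_σ f` is as smooth as `f` itself; this saves one
  -- derivative in the factorization `f = (s - σ)² R`.
  let M : ℝ × ℝ → ℝ := fun p => (A (q p)).2 / (A (q p)).1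
  have hMc : ContDiffAt ℝ (k - 1 : ℕ) M (0, 0) := by
    refine (contDiffAt_snd.comp _ hAqc).div (contDiffAt_fst.comp _ hAqc) ?_
    show (A (q (0, 0))).1 ≠ 0
    rw [hq0, hA00]; positivity
  have hfM : ∀ᶠ p in 𝓝 ((0 : ℝ), (0 : ℝ)), HasDerivAt (fun σ => f (p.1, σ)) (M p) p.2 := by
    filter_upwards [hsnd, hfd] with p h1 h2
    have := hasDerivAt_snd_slice (q := p) (h2.differentiableAt hk0)
    rwa [h1.2] at this
  have hAdiag2 := hfst.eventually hAdiag
  have hdM : ∀ᶠ p in 𝓝 ((0 : ℝ), (0 : ℝ)), M (p.1, p.1) = 0 := by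
    filter_upwards [hdq, hAdiag2] with p h1 h2
    simp only [M, h1, h2]; simp
  -- the derivative of `w` at the origin
  have hdw0 : fderiv ℝ w (0, 0) (1, 0) = ν 0 • n₀ := by
    have e1 : HasDerivAt (fun s => w (s, s)) (fderiv ℝ w (0, 0) (1, 1)) 0 :=
      (hwc.differentiableAt hk0).hasFDerivAt.comp_hasDerivAt (f := fun s => (s, s)) (0 : ℝ)
        ((hasDerivAt_id (0 : ℝ)).prodMk (hasDerivAt_id (0 : ℝ)))
    have e2 : HasDerivAt (fun s => w (s, s)) (deriv (h.unitTangent x) 0) 0 := by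
      refine (H.contDiffAt_unitTangent.differentiableAt hk0).hasDerivAt.congr_of_eventuallyEq ?_
      filter_upwards [hline.eventually hdw] with s hs using hs
    have e3 : HasDerivAt (fun σ => w (0, σ)) (fderiv ℝ w (0, 0) (0, 1)) 0 :=
      hasDerivAt_snd_slice (q := (0, 0)) (hwc.differentiableAt hk0)
    have e4 : HasDerivAt (fun σ => w (0, σ)) (fderiv ℝ τ (0, 0) (0, 1) •
        (-h.christoffelVec (x 0) (h.unitTangent x 0) (h.unitTangent x 0))) 0 := by
      have h1 := hGV.self_of_nhds.derivV
      rw [hGV.self_of_nhds.base, hGV.self_of_nhds.vel] at h1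
      have h2 : HasDerivAt (fun σ => τ (0, σ)) (fderiv ℝ τ (0, 0) (0, 1)) 0 :=
        hasDerivAt_snd_slice (q := (0, 0)) (hτc.differentiableAt hk0)
      exact HasDerivAt.scomp (0 : ℝ) (h := fun σ => τ (0, σ)) (g₁ := fun u => V (0, u))
        (by rw [hτ0]; exact h1) h2
    have e5 : fderiv ℝ w (0, 0) (1, 0) = fderiv ℝ w (0, 0) (1, 1) - fderiv ℝ w (0, 0) (0, 1) := by
      rw [← map_sub]; simp
    have e6 : fderiv ℝ τ (0, 0) (0, 1) = ν 0 := by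
      rw [hsnd.self_of_nhds.1, hq0, hA00, inv_inv]
    have e7 := H.covDeriv_unitTangent
    have e8 : deriv x 0 = ν 0 • h.unitTangent x 0 := by
      rw [LocalMetric.unitTangent, smul_smul, mul_inv_cancel₀ hν0.ne', one_smul]
    rw [e8, LocalMetric.christoffelVec_smul_left, ← e8] at e7
    rw [e5, e1.unique e2, e3.unique e4, e6, smul_neg, sub_neg_eq_add]
    exact e7
  -- On the line `σ = 0` the component of `w` along `n₀` is `-A₂`, because `x'(0)` is orthogonal to
  -- `n₀`; its rate of change is known from `hdw0`.
  have hM1 : fderiv ℝ M (0, 0) (1, 0) = -ν 0 ^ 2 := by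
    have hn := H.metric.ip_pos H.curvatureVec_ne
    have e1 : HasDerivAt (fun s => M (s, 0)) (fderiv ℝ M (0, 0) (1, 0)) 0 :=
      hasDerivAt_fst_slice (q := (0, 0)) (hMc.differentiableAt hk0)
    have e2 : HasDerivAt (fun s => h.ip (x 0) (w (s, 0)) n₀)
        (h.ip (x 0) (ν 0 • n₀) n₀) 0 := by
      have h1 : HasDerivAt (fun s => w (s, 0)) (fderiv ℝ w (0, 0) (1, 0)) 0 :=
        hasDerivAt_fst_slice (q := (0, 0)) (hwc.differentiableAt hk0)
      rw [hdw0] at h1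
      have h2 := H.metric.hasDerivAt_ip (c := fun _ => x 0) (by omega)
        (hasDerivAt_const (0 : ℝ) (x 0)) h1 (hasDerivAt_const (0 : ℝ) n₀)
      refine h2.congr_deriv ?_
      have h3 : ∀ v, h.christoffelVec (x 0) 0 v = 0 := fun v => by
        have := h.christoffelVec_smul_left (x 0) 0 0 v
        simpa using this
      simp only [h3, add_zero]
      simp [LocalMetric.ip_eq]
    have e3 : HasDerivAt (fun s => (A (q (s, 0))).1) (fderiv ℝ (fun p => (A (q p)).1) (0, 0) (1, 0))
        0 :=
      hasDerivAt_fst_slice (q := (0, 0)) ((contDiffAt_fst.comp _ hAqc).differentiableAt hk0)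
    have hne : h.ip (x 0) n₀ n₀ ≠ 0 := hn.ne'
    have e4 : ∀ᶠ s in 𝓝 (0 : ℝ),
        M (s, 0) = -(h.ip (x 0) (w (s, 0)) n₀) / h.ip (x 0) n₀ n₀ / (A (q (s, 0))).1 := by
      filter_upwards [hline.eventually hwA] with s hs
      rw [hs]
      rw [LocalMetric.ip_sub_left, LocalMetric.ip_smul_left, LocalMetric.ip_smul_left,
        H.ip_curvatureVec]
      simp only [M]
      field_simp
      ring
    have hA1 : (A (q (0, 0))).1 ≠ 0 := hA1pos.self_of_nhds.ne'
    have e5 := ((e2.neg.div_const (h.ip (x 0) n₀ n₀)).div e3 hA1).congr_of_eventuallyEq e4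
    rw [e1.unique e5]
    have hw0 : h.ip (x 0) (w (0, 0)) n₀ = 0 := by
      rw [hdw.self_of_nhds, LocalMetric.unitTangent, LocalMetric.ip_smul_left, H.ip_curvatureVec,
        mul_zero]
    simp only [Pi.neg_apply, hw0, hq0, hA00, LocalMetric.ip_smul_left]
    field_simp
    ring
  -- `M` vanishes on the diagonal, so its two partial derivatives there are opposite.
  have hM2 : fderiv ℝ M (0, 0) (0, 1) = ν 0 ^ 2 := by
    have e1 : HasDerivAt (fun s => M (s, s)) (fderiv ℝ M (0, 0) (1, 1)) 0 :=
      (hMc.differentiableAt hk0).hasFDerivAt.comp_hasDerivAt (f := fun s => (s, s)) (0 : ℝ)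
        ((hasDerivAt_id (0 : ℝ)).prodMk (hasDerivAt_id (0 : ℝ)))
    have e2 : HasDerivAt (fun s => M (s, s)) 0 0 := by
      refine (hasDerivAt_const (0 : ℝ) (0 : ℝ)).congr_of_eventuallyEq ?_
      filter_upwards [hline.eventually hdM] with s hs using hs
    have e3 : fderiv ℝ M (0, 0) (1, 1) = fderiv ℝ M (0, 0) (1, 0) + fderiv ℝ M (0, 0) (0, 1) := by
      rw [← map_add]; simp
    rw [e1.unique e2, hM1] at e3
    linarith
  obtain ⟨R, hRc, hR0, hquad⟩ := exists_sq_mul (n := k - 2)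
    (by rwa [show k - 2 + 1 = k - 1 by omega]) hfM hdf hdM
  -- the sign of the derivative of `f` in the first variable
  have hMneg : ∀ᶠ p in 𝓝 ((0 : ℝ), (0 : ℝ)), fderiv ℝ M p (1, 0) < 0 := by
    have h1 : ContinuousAt (fun p => fderiv ℝ M p (1, 0)) (0, 0) :=
      ((hMc.fderiv_right (m := (0 : ℕ)) (by norm_cast; omega)).continuousAt).clm_apply
        continuousAt_const
    refine h1.eventually_lt_const ?_
    simp only [hM1]; have := pow_pos hν0 2; linarith
  have hmixed : ∀ᶠ p in 𝓝 ((0 : ℝ), (0 : ℝ)),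
      HasDerivAt (fun σ => fderiv ℝ f (p.1, σ) (1, 0)) (fderiv ℝ M p (1, 0)) p.2 := by
    filter_upwards [hfd, hMc.eventually (by simp), hfM.eventually_nhds] with p h1 h2 h3
    exact hasDerivAt_fderiv_fst (h1.of_le hk1) (h2.of_le hk1) h3
  have hfs0 : ∀ᶠ p in 𝓝 ((0 : ℝ), (0 : ℝ)), fderiv ℝ f (p.1, p.1) (1, 0) = 0 := by
    filter_upwards [hdiag.eventually hfd, hdf.eventually_nhds, hdiag.eventually hfM,
      hdM] with p h1 h2 h3 h4
    have e1 : HasDerivAt (fun s => f (s, s)) (fderiv ℝ f (p.1, p.1) (1, 1)) p.1 :=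
      (h1.differentiableAt hk0).hasFDerivAt.comp_hasDerivAt (f := fun s => (s, s)) p.1
        ((hasDerivAt_id p.1).prodMk (hasDerivAt_id p.1))
    have e2 : HasDerivAt (fun s => f (s, s)) 0 p.1 := by
      refine (hasDerivAt_const p.1 (0 : ℝ)).congr_of_eventuallyEq ?_
      have hc : ContinuousAt (fun s : ℝ => (s, p.2)) p.1 := by fun_prop
      filter_upwards [hc.eventually h2] with s hs using hs
    have e3 : fderiv ℝ f (p.1, p.1) (1, 1) =
        fderiv ℝ f (p.1, p.1) (1, 0) + fderiv ℝ f (p.1, p.1) (0, 1) := by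
      rw [← map_add]; simp
    have e4 := (hasDerivAt_snd_slice (q := (p.1, p.1)) (h1.differentiableAt hk0)).unique h3
    rw [e1.unique e2, e4, h4, add_zero] at e3
    exact e3.symm
  have hsign : ∀ᶠ p in 𝓝 ((0 : ℝ), (0 : ℝ)), (p.2 < p.1 → 0 < fderiv ℝ f p (1, 0)) ∧
      (p.1 < p.2 → fderiv ℝ f p (1, 0) < 0) := by
    obtain ⟨η, hη, hB⟩ := Metric.eventually_nhds_iff_ball.1 (hmixed.and (hMneg.and hfs0))
    filter_upwards [Metric.ball_mem_nhds _ hη] with p hp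
    rw [← ball_prod_same] at hp
    have hB' : ∀ σ ∈ Metric.ball (0 : ℝ) η, (p.1, σ) ∈ Metric.ball ((0 : ℝ), (0 : ℝ)) η := by
      intro σ hσ
      rw [← ball_prod_same]; exact ⟨hp.1, hσ⟩
    -- `∂_s f` vanishes on the diagonal and its `σ`-derivative is `∂_s M < 0`, which decides its
    -- sign on both sides.
    have hanti : StrictAntiOn (fun σ => fderiv ℝ f (p.1, σ) (1, 0)) (Metric.ball (0 : ℝ) η) := by
      refine strictAntiOn_of_deriv_neg (convex_ball _ _)
        (fun σ hσ => (hB _ (hB' σ hσ)).1.continuousAt.continuousWithinAt) fun σ hσ => ?_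
      rw [Metric.isOpen_ball.interior_eq] at hσ
      rw [(hB _ (hB' σ hσ)).1.deriv]
      exact (hB _ (hB' σ hσ)).2.1
    have hz : fderiv ℝ f (p.1, p.1) (1, 0) = 0 := (hB _ (hB' p.1 hp.1)).2.2
    constructor
    · intro hlt
      have := hanti hp.2 hp.1 hlt
      simpa [hz] using this
    · intro hlt
      have := hanti hp.1 hp.2 hlt
      simpa [hz] using this
  -- Differentiate `sideMap (σ, f) = G (s, τ)` and pair with the unit vector `V`; the Gauss lemma
  -- replaces `⟨∂_s G, V⟩` by `|x'(s)|`.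
  have heik : ∀ᶠ p in 𝓝 ((0 : ℝ), (0 : ℝ)), ∀ v : ℝ × ℝ,
      fderiv ℝ τ p v + h.norm (x p.1) (deriv x p.1) * v.1 =
      h.ip (sideMap h x (p.2, f p)) (w p) (v.2 • deriv x p.2 - (fderiv ℝ f p v) • n₀) := by
    have hcurve2 := (continuousAt_snd (p := ((0 : ℝ), (0 : ℝ)))).eventually H.eventually_curve
    filter_upwards [hside.eventually_nhds, hτd, hfd, hqt.eventually hGV, hcurve2]
      with p h1 h2 h3 h4 h5 v
    have e1 : HasFDerivAt q ((ContinuousLinearMap.fst ℝ ℝ ℝ).prod (fderiv ℝ τ p)) p :=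
      hasFDerivAt_fst.prodMk (h2.differentiableAt hk0).hasFDerivAt
    have e2 := (h4.contDiffG.differentiableAt hk0).hasFDerivAt.comp p e1
    have e3 : HasFDerivAt (fun p : ℝ × ℝ => (p.2, f p))
        ((ContinuousLinearMap.snd ℝ ℝ ℝ).prod (fderiv ℝ f p)) p :=
      hasFDerivAt_snd.prodMk (h3.differentiableAt hk0).hasFDerivAt
    have e4 := (hasFDerivAt_sideMap (h := h) (p := (p.2, f p))
      (h5.1.differentiableAt H.ne_zero)).comp p e3
    have e5 := (e4.congr_of_eventuallyEq (h1.mono fun _ hp => hp.symm)).unique e2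
    have e6 := DFunLike.congr_fun e5 v
    simp only [ContinuousLinearMap.comp_apply, ContinuousLinearMap.prod_apply,
      ContinuousLinearMap.coe_fst', ContinuousLinearMap.coe_snd',
      sub_apply, ContinuousLinearMap.smulRight_apply] at e6
    have e7 : (v.1, fderiv ℝ τ p v) = v.1 • ((1 : ℝ), (0 : ℝ)) +
      fderiv ℝ τ p v • ((0 : ℝ), (1 : ℝ)) := by simp
    have e8 : fderiv ℝ G (q p) (0, 1) = V (q p) :=
      (hasDerivAt_snd_slice (h4.contDiffG.differentiableAt hk0)).unique h4.derivG
    rw [e7, map_add, map_smul, map_smul, e8] at e6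
    have e9 : h.IsRegularAt k (sideMap h x (p.2, f p)) := by
      rw [h1.self_of_nhds]; exact h4.regular
    rw [hn₀, e6, e9.ip_symm, h1.self_of_nhds, LocalMetric.ip_add_left, LocalMetric.ip_smul_left,
      LocalMetric.ip_smul_left]
    have e10 := h4.gauss
    have e11 := h4.unit
    simp only [w]
    rw [e10, e11]
    simp only [q]
    ring
  refine ⟨τ, f, R, w, ?_, hquad, hRc, ?_, hdw0, ?_⟩
  · have hc1 := hfst.eventually H.eventually_curve
    filter_upwards [hc1, hτd, hfd, hwd, hdτ, hdf, hdw, hsnd, hA1pos, hsign,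
      hqt.eventually hGV, hside, heik] with p a1 a2 a3 a4 a5 a6 a7 a8 a9 a10 a11 a12 a13
    refine ⟨a1.1, a1.2.1, a2, a3, a4, a5, a6, a7, ?_, a10.1, a10.2, ?_, ?_, a13⟩
    · rw [a8.1]; exact inv_pos.2 a9
    · rw [a12]; exact a11.regular
    · rw [a12]; exact a11.unit
  · rw [hR0, hM2]; positivity
  · obtain ⟨η, hη, hB⟩ := Metric.eventually_nhds_iff_ball.1
      (hΘl.and (hτl.and (hside.and (hGx.eventually hΘr))))
    have hsmall : ∀ᶠ ε in 𝓝[>] (0 : ℝ), ε < η := mem_nhdsWithin_of_mem_nhds (eventually_lt_nhds hη)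
    filter_upwards [H.eventually_isTangentSegment_iff hGV, hsmall, self_mem_nhdsWithin]
      with ε h1 hεη hε0
    have hcs : Tendsto (sideMap h x) (𝓝 (0, 0)) (𝓝 (x 0)) := by
      have h2 := (contDiffAt_sideMap (h := h) (p := (0, 0)) H.smooth).continuousAt
      have h3 : sideMap h x (0, 0) = x 0 := by simp [sideMap]
      rwa [ContinuousAt, h3] at h2
    filter_upwards [hcs.eventually h1, Metric.ball_mem_nhds _ hη] with p hp hpη a ℓ ζ
    rw [hp]
    refine and_congr_right fun ha => and_congr_right fun hℓ => ?_
    have hB' : ∀ s u : ℝ, |s| < η → |u| < η → (s, u) ∈ Metric.ball ((0 : ℝ), (0 : ℝ)) η := by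
      intro s u hs hu
      rw [← ball_prod_same]
      exact ⟨by simpa using hs, by simpa using hu⟩
    have ha' : |a| < η := (abs_lt.2 ha).trans hεη
    have hp1 : |p.1| < η := by
      rw [← ball_prod_same] at hpη; simpa using hpη.1
    -- Passing through the point at time `u` means being on its line at its height; by the
    -- uniqueness of the arrival time, `u` is then `τ`.
    have key : ∀ u, |u| < ε → (G (a, u) = sideMap h x p ↔ f (a, p.1) = p.2 ∧ τ (a, p.1) = u) := by
      intro u hu
      have b1 := (hB p hpη).1
      have b2 := hB _ (hB' a u ha' (hu.trans hεη))
      have b3 := (hB _ (hB' a p.1 ha' hp1)).2.2.1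
      constructor
      · intro he
        have c1 : Θ (G (a, u)) = p := by rw [he, b1]
        have c2 := b2.2.1
        rw [c1] at c2
        refine ⟨?_, c2⟩
        simp only [f, q]
        rw [c2, c1]
      · rintro ⟨c1, c2⟩
        have c3 : q (a, p.1) = (a, u) := by simp only [q, c2]
        rw [← c3, ← b3, c1]
    have hℓa : |ℓ| < ε := abs_lt.2 ⟨by linarith [hℓ.1, hℓ.2], hℓ.2⟩
    have hℓa' : |-ℓ| < ε := by rwa [abs_neg]
    rw [key ℓ hℓa, key (-ℓ) hℓa']
    constructor
    · rintro (⟨⟨c1, c2⟩, c3⟩ | ⟨⟨c1, c2⟩, c3⟩)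
      · refine ⟨c1, Or.inl ⟨c2, ?_⟩⟩
        simp only [w, q, c2, c3]
      · refine ⟨c1, Or.inr ⟨c2, ?_⟩⟩
        simp only [w, q, c2, c3]
    · rintro ⟨c1, (⟨c2, c3⟩ | ⟨c2, c3⟩)⟩
      · refine Or.inl ⟨⟨c1, c2⟩, ?_⟩
        simp only [c3, w, q, c2]
      · refine Or.inr ⟨⟨c1, c2⟩, ?_⟩
        simp only [c3, w, q, c2]

/-! ### The two tangency parameters. -/

/-- The coordinate domain of the concave side, including the curve. -/
def sideBox (δ : ℝ) : Set (ℝ × ℝ) := Ioo (-δ) δ ×ˢ Ico 0 δ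

theorem sideBox_mono {δ δ' : ℝ} (hδ : δ ≤ δ') : sideBox δ ⊆ sideBox δ' :=
  prod_mono (Ioo_subset_Ioo (neg_le_neg hδ) hδ) (Ico_subset_Ico_right hδ)

theorem sideBox_mem_nhds {δ : ℝ} {q : ℝ × ℝ} (hq : q ∈ sideBox δ) (ht : 0 < q.2) :
    sideBox δ ∈ 𝓝 q :=
  prod_mem_nhds (Ioo_mem_nhds hq.1.1 hq.1.2) (Ico_mem_nhds ht hq.2.2)

theorem eventually_sideBox {p : ℝ × ℝ → Prop} (hp : ∀ᶠ q in 𝓝 ((0 : ℝ), (0 : ℝ)), p q) :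
    ∃ δ > 0, ∀ q ∈ sideBox δ, p q := by
  obtain ⟨δ, hδ, hB⟩ := Metric.eventually_nhds_iff_ball.1 hp
  refine ⟨δ, hδ, fun q hq => hB q ?_⟩
  rw [← ball_prod_same, Real.ball_eq_Ioo]
  simp only [zero_sub, zero_add]
  exact ⟨hq.1, by linarith [hq.2.1], hq.2.2⟩

theorem exists_unique_root {g : ℝ → ℝ} {σ η ρ t : ℝ} (hρ : 0 < ρ) (hη : σ + ρ < η)
    (hc : ContinuousOn g (Ico σ η)) (hg : StrictMonoOn g (Ico σ η)) (h0 : g σ ≤ t)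
    (h1 : t < g (σ + ρ)) : ∃ b ∈ Ico σ η, ∀ s ∈ Ico σ η, g s = t ↔ s = b := by
  have hs : Icc σ (σ + ρ) ⊆ Ico σ η := fun s hs => ⟨hs.1, hs.2.trans_lt hη⟩
  obtain ⟨b, hb, hgb⟩ := intermediate_value_Icc (by linarith) (hc.mono hs) ⟨h0, h1.le⟩
  refine ⟨b, hs hb, fun s hs' => ⟨fun he => hg.injOn hs' (hs hb) (he.trans hgb.symm), ?_⟩⟩
  rintro rfl
  exact hgb

/-- `a q ≤ q.1 ≤ b q` are the parameters of the geodesics tangent to the curve that pass through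
the point with the coordinates `q`. -/
structure IsRootPair (h : LocalMetric) (k : ℕ) (x : ℝ → Plane) (τ f : ℝ × ℝ → ℝ)
    (w : ℝ × ℝ → Plane) (a b : ℝ × ℝ → ℝ) (η δ : ℝ) : Prop where
  δ_pos : 0 < δ
  δ_le : δ ≤ η
  sliced : ∀ s ∈ Ioo (-η) η, ∀ σ ∈ Ioo (-η) η, IsSlicedAt h k x τ f w (s, σ)
  mem_a : ∀ q ∈ sideBox δ, a q ∈ Ioo (-η) η
  mem_b : ∀ q ∈ sideBox δ, b q ∈ Ioo (-η) η
  root : ∀ q ∈ sideBox δ, ∀ s ∈ Ioo (-η) η, f (s, q.1) = q.2 ↔ s = a q ∨ s = b q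
  a_le : ∀ q ∈ sideBox δ, a q ≤ q.1
  le_b : ∀ q ∈ sideBox δ, q.1 ≤ b q
  bound : ∃ K, ∀ q ∈ sideBox δ, (a q - q.1) ^ 2 ≤ K * q.2 ∧ (b q - q.1) ^ 2 ≤ K * q.2

namespace IsSlicing

variable {τ f R : ℝ × ℝ → ℝ} {w : ℝ × ℝ → Plane}

/-- For fixed `σ`, the function `f(·, σ)` decreases strictly to 0 at `s = σ` and then increases
strictly, so it takes each small positive value once on each side. The lower bound `f ≥ c (s - σ)²`
keeps the roots within a multiple of `√t` of `σ`. -/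
theorem exists_rootPair (S : IsSlicing h k x τ f R w) (hk : 2 ≤ k) :
    ∃ (a b : ℝ × ℝ → ℝ) (η δ : ℝ), IsRootPair h k x τ f w a b η δ ∧
      ∀ s ∈ Ioo (-η) η, ∀ σ ∈ Ioo (-η) η, f (s, σ) = (s - σ) ^ 2 * R (s, σ) := by
  have hk1 : ((k - 1 : ℕ) : ℕ∞ω) ≠ 0 := by
    have : k - 1 ≠ 0 := by omega
    exact_mod_cast this
  set c := R (0, 0) / 2 with hc
  have hc0 : 0 < c := half_pos S.R_pos
  have hR : ∀ᶠ p in 𝓝 ((0 : ℝ), (0 : ℝ)), c < R p :=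
    S.contDiffR.continuousAt.eventually_const_lt (half_lt_self S.R_pos)
  obtain ⟨η, hη, hB⟩ := Metric.eventually_nhds_iff_ball.1 (S.sliced.and (S.quad.and hR))
  have hB' : ∀ s ∈ Ioo (-η) η, ∀ σ ∈ Ioo (-η) η, IsSlicedAt h k x τ f w (s, σ) ∧
      f (s, σ) = (s - σ) ^ 2 * R (s, σ) ∧ c < R (s, σ) := by
    intro s hs σ hσ
    refine hB (s, σ) ?_
    rw [← ball_prod_same, Real.ball_eq_Ioo]
    simpa using ⟨hs, hσ⟩
  have hder : ∀ s ∈ Ioo (-η) η, ∀ σ ∈ Ioo (-η) η,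
      HasDerivAt (fun s => f (s, σ)) (fderiv ℝ f (s, σ) (1, 0)) s := fun s hs σ hσ =>
    hasDerivAt_fst_slice (q := (s, σ)) ((hB' s hs σ hσ).1.contDifff.differentiableAt hk1)
  -- The first bound keeps `σ ± η/2` inside `(-η, η)`; the second makes `t` smaller than `f(σ ± η/2,
  -- σ)`.
  set δ := min (η / 2) (c * (η / 2) ^ 2) with hδ
  have hδ0 : 0 < δ := by positivity
  have hδη : δ ≤ η / 2 := min_le_left _ _
  have hmem : ∀ q ∈ sideBox δ, q.1 ∈ Ioo (-(η / 2)) (η / 2) := fun q hq =>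
    ⟨by linarith [hq.1.1], by linarith [hq.1.2]⟩
  have hlow : ∀ q ∈ sideBox δ, ∀ ρ, ρ ^ 2 = (η / 2) ^ 2 → q.1 + ρ ∈ Ioo (-η) η →
      q.2 < f (q.1 + ρ, q.1) := by
    intro q hq ρ hρ hm
    obtain ⟨-, h1, h2⟩ := hB' (q.1 + ρ) hm q.1
      ⟨by linarith [(hmem q hq).1], by linarith [(hmem q hq).2]⟩
    rw [h1, add_sub_cancel_left, hρ]
    have h3 := hq.2.2.trans_le (min_le_right _ _)
    nlinarith [sq_nonneg (η / 2)]
  have hexb : ∀ q ∈ sideBox δ, ∃ b ∈ Ico q.1 η, ∀ s ∈ Ico q.1 η, f (s, q.1) = q.2 ↔ s = b := by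
    intro q hq
    have hσ := hmem q hq
    have hσ' : q.1 ∈ Ioo (-η) η := ⟨by linarith [hσ.1], by linarith [hσ.2]⟩
    have hsub : Ico q.1 η ⊆ Ioo (-η) η := fun s hs => ⟨hσ'.1.trans_le hs.1, hs.2⟩
    have hcont : ContinuousOn (fun s => f (s, q.1)) (Ico q.1 η) := fun s hs =>
      (hder s (hsub hs) q.1 hσ').continuousAt.continuousWithinAt
    refine exists_unique_root (ρ := η / 2) (by linarith) (by linarith [hσ.2]) hcont ?_ ?_ ?_
    · refine strictMonoOn_of_deriv_pos (convex_Ico _ _) hcont fun s hs => ?_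
      rw [interior_Ico] at hs
      rw [(hder s (hsub ⟨hs.1.le, hs.2⟩) q.1 hσ').deriv]
      exact (hB' s (hsub ⟨hs.1.le, hs.2⟩) q.1 hσ').1.df_pos hs.1
    · rw [(hB' q.1 hσ' q.1 hσ').1.diagf]; exact hq.2.1
    · exact hlow q hq _ rfl ⟨by linarith [hσ.1], by linarith [hσ.2]⟩
  have hexa : ∀ q ∈ sideBox δ, ∃ a ∈ Ioc (-η) q.1, ∀ s ∈ Ioc (-η) q.1, f (s, q.1) = q.2 ↔ s = a := by
    intro q hq
    have hσ := hmem q hq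
    have hσ' : q.1 ∈ Ioo (-η) η := ⟨by linarith [hσ.1], by linarith [hσ.2]⟩
    -- The left root is obtained from the increasing case by the reflection `s ↦ -s`.
    have hsub : ∀ s ∈ Ico (-q.1) η, -s ∈ Ioo (-η) η := fun s hs =>
      ⟨by linarith [hs.2], by linarith [hs.1, hσ'.2]⟩
    have hder' : ∀ s ∈ Ico (-q.1) η, HasDerivAt (fun s => f (-s, q.1))
        (-fderiv ℝ f (-s, q.1) (1, 0)) s := fun s hs =>
      ((hder (-s) (hsub s hs) q.1 hσ').scomp s (hasDerivAt_neg s)).congr_deriv (by simp)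
    have hcont : ContinuousOn (fun s => f (-s, q.1)) (Ico (-q.1) η) := fun s hs =>
      (hder' s hs).continuousAt.continuousWithinAt
    have hmono : StrictMonoOn (fun s => f (-s, q.1)) (Ico (-q.1) η) := by
      refine strictMonoOn_of_deriv_pos (convex_Ico _ _) hcont fun s hs => ?_
      rw [interior_Ico] at hs
      rw [(hder' s ⟨hs.1.le, hs.2⟩).deriv]
      have := (hB' (-s) (hsub s ⟨hs.1.le, hs.2⟩) q.1 hσ').1.df_neg (neg_lt.1 hs.1)
      linarith
    have hz : f (- -q.1, q.1) ≤ q.2 := by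
      rw [neg_neg, (hB' q.1 hσ' q.1 hσ').1.diagf]; exact hq.2.1
    have hlt : q.2 < f (-(-q.1 + η / 2), q.1) := by
      have := hlow q hq (-(η / 2)) (by ring) ⟨by linarith [hσ.1], by linarith [hσ.2]⟩
      rwa [show q.1 + -(η / 2) = -(-q.1 + η / 2) by ring] at this
    obtain ⟨b, hb, hb'⟩ := exists_unique_root (half_pos hη) (by linarith [hσ.1]) hcont hmono hz hlt
    refine ⟨-b, ⟨by linarith [hb.2], by linarith [hb.1]⟩, fun s hs => ?_⟩
    have := hb' (-s) ⟨by linarith [hs.2], by linarith [hs.1]⟩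
    rw [neg_neg] at this
    rw [this]
    exact neg_eq_iff_eq_neg
  choose! b hb1 hb2 using hexb
  choose! a ha1 ha2 using hexa
  have hσ' : ∀ q ∈ sideBox δ, q.1 ∈ Ioo (-η) η := fun q hq =>
    ⟨by linarith [(hmem q hq).1], by linarith [(hmem q hq).2]⟩
  have hroot : ∀ q ∈ sideBox δ, ∀ s ∈ Ioo (-η) η, f (s, q.1) = q.2 → (s - q.1) ^ 2 ≤ c⁻¹ * q.2 := by
    intro q hq s hs he
    obtain ⟨-, h1, h2⟩ := hB' s hs q.1 (hσ' q hq)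
    rw [inv_mul_eq_div, le_div_iff₀ hc0]
    rw [h1] at he
    nlinarith [sq_nonneg (s - q.1)]
  have hma : ∀ q ∈ sideBox δ, a q ∈ Ioo (-η) η := fun q hq =>
    ⟨(ha1 q hq).1, (ha1 q hq).2.trans_lt (hσ' q hq).2⟩
  have hmb : ∀ q ∈ sideBox δ, b q ∈ Ioo (-η) η := fun q hq =>
    ⟨(hσ' q hq).1.trans_le (hb1 q hq).1, (hb1 q hq).2⟩
  refine ⟨a, b, η, δ, ⟨hδ0, by linarith, fun s hs σ hσ => (hB' s hs σ hσ).1, hma, hmb, ?_,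
    fun q hq => (ha1 q hq).2, fun q hq => (hb1 q hq).1, c⁻¹, fun q hq =>
    ⟨hroot q hq _ (hma q hq) ((ha2 q hq _ (ha1 q hq)).2 rfl),
      hroot q hq _ (hmb q hq) ((hb2 q hq _ (hb1 q hq)).2 rfl)⟩⟩,
    fun s hs σ hσ => (hB' s hs σ hσ).2.1⟩
  intro q hq s hs
  constructor
  · intro he
    rcases le_total s q.1 with hle | hle
    · exact Or.inl ((ha2 q hq s ⟨hs.1, hle⟩).1 he)
    · exact Or.inr ((hb2 q hq s ⟨hle, hs.2⟩).1 he)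
  · rintro (rfl | rfl)
    · exact (ha2 q hq _ (ha1 q hq)).2 rfl
    · exact (hb2 q hq _ (hb1 q hq)).2 rfl

end IsSlicing

namespace IsRootPair

variable {τ f R : ℝ × ℝ → ℝ} {w : ℝ × ℝ → Plane} {a b : ℝ × ℝ → ℝ} {η δ : ℝ}
  {q : ℝ × ℝ}

theorem mono (A : IsRootPair h k x τ f w a b η δ) {δ' : ℝ} (h0 : 0 < δ') (hδ : δ' ≤ δ) :
    IsRootPair h k x τ f w a b η δ' := by
  have hs := sideBox_mono hδ
  obtain ⟨K, hK⟩ := A.bound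
  exact ⟨h0, hδ.trans A.δ_le, A.sliced, fun q hq => A.mem_a q (hs hq), fun q hq => A.mem_b q (hs hq),
    fun q hq => A.root q (hs hq), fun q hq => A.a_le q (hs hq), fun q hq => A.le_b q (hs hq),
    K, fun q hq => hK q (hs hq)⟩

theorem mem_fst (A : IsRootPair h k x τ f w a b η δ) (hq : q ∈ sideBox δ) : q.1 ∈ Ioo (-η) η :=
  ⟨by linarith [hq.1.1, A.δ_le], by linarith [hq.1.2, A.δ_le]⟩

theorem root_a (A : IsRootPair h k x τ f w a b η δ) (hq : q ∈ sideBox δ) : f (a q, q.1) = q.2 :=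
  (A.root q hq _ (A.mem_a q hq)).2 (Or.inl rfl)

theorem root_b (A : IsRootPair h k x τ f w a b η δ) (hq : q ∈ sideBox δ) : f (b q, q.1) = q.2 :=
  (A.root q hq _ (A.mem_b q hq)).2 (Or.inr rfl)

theorem sliced_a (A : IsRootPair h k x τ f w a b η δ) (hq : q ∈ sideBox δ) :
    IsSlicedAt h k x τ f w (a q, q.1) := A.sliced _ (A.mem_a q hq) _ (A.mem_fst hq)

theorem sliced_b (A : IsRootPair h k x τ f w a b η δ) (hq : q ∈ sideBox δ) :
    IsSlicedAt h k x τ f w (b q, q.1) := A.sliced _ (A.mem_b q hq) _ (A.mem_fst hq)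

theorem sliced_diag (A : IsRootPair h k x τ f w a b η δ) (hq : q ∈ sideBox δ) :
    IsSlicedAt h k x τ f w (q.1, q.1) := A.sliced _ (A.mem_fst hq) _ (A.mem_fst hq)

theorem eq_of_zero (A : IsRootPair h k x τ f w a b η δ) (hq : q ∈ sideBox δ) (h0 : q.2 = 0) :
    a q = q.1 ∧ b q = q.1 := by
  obtain ⟨K, hK⟩ := A.bound
  have := hK q hq
  rw [h0, mul_zero] at this
  exact ⟨sub_eq_zero.1 (pow_eq_zero_iff two_ne_zero |>.1 (this.1.antisymm (sq_nonneg _))),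
    sub_eq_zero.1 (pow_eq_zero_iff two_ne_zero |>.1 (this.2.antisymm (sq_nonneg _)))⟩

theorem a_lt (A : IsRootPair h k x τ f w a b η δ) (hq : q ∈ sideBox δ) (h0 : 0 < q.2) :
    a q < q.1 := by
  refine (A.a_le q hq).lt_of_ne fun he => h0.ne' ?_
  rw [← A.root_a hq, he, (A.sliced_diag hq).diagf]

theorem lt_b (A : IsRootPair h k x τ f w a b η δ) (hq : q ∈ sideBox δ) (h0 : 0 < q.2) :
    q.1 < b q := by
  refine (A.le_b q hq).lt_of_ne' fun he => h0.ne' ?_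
  rw [← A.root_b hq, he, (A.sliced_diag hq).diagf]

/-- Off the curve `∂_s f ≠ 0` at either root, so the implicit function theorem gives a smooth branch
of roots. The strict position of the branch relative to `σ` persists nearby and tells which of `a`,
`b` it is. -/
theorem contDiffAt_roots (A : IsRootPair h k x τ f w a b η δ) (hk : 2 ≤ k) (hq : q ∈ sideBox δ)
    (h0 : 0 < q.2) : ContDiffAt ℝ (k - 1 : ℕ) a q ∧ ContDiffAt ℝ (k - 1 : ℕ) b q := by
  have key : ∀ s ∈ Ioo (-η) η, f (s, q.1) = q.2 → s ≠ q.1 → ∃ β : ℝ × ℝ → ℝ,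
      ContDiffAt ℝ (k - 1 : ℕ) β q ∧ β q = s ∧ ∀ᶠ p in 𝓝 q, p ∈ sideBox δ ∧
        (β p = a p ∨ β p = b p) := by
    intro s hs he hne
    have hS := A.sliced s hs _ (A.mem_fst hq)
    have hne' : fderiv ℝ f (s, q.1) (1, 0) ≠ 0 := by
      rcases lt_or_gt_of_ne hne with hlt | hlt
      · exact (hS.df_neg hlt).ne
      · exact (hS.df_pos hlt).ne'
    obtain ⟨β, h1, h2, -, h4⟩ := exists_solution (n := k - 1) (by omega) hS.contDifff hne'
    simp only [he] at h1 h2 h4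
    have hsw : ContDiff ℝ (k - 1 : ℕ) (fun p : ℝ × ℝ => (p.2, p.1)) := by fun_prop
    have hβ : ContDiffAt ℝ (k - 1 : ℕ) (fun p : ℝ × ℝ => β (p.2, p.1)) q :=
      ContDiffAt.comp q (f := fun p : ℝ × ℝ => (p.2, p.1)) h1 hsw.contDiffAt
    refine ⟨fun p => β (p.2, p.1), hβ, h2, ?_⟩
    have h5 : ∀ᶠ p in 𝓝 q, f (β (p.2, p.1), p.1) = p.2 :=
      (hsw.continuous.continuousAt (x := q)).eventually h4
    have h6 : ∀ᶠ p in 𝓝 q, β (p.2, p.1) ∈ Ioo (-η) η :=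
      hβ.continuousAt.eventually (by simp only [h2]; exact Ioo_mem_nhds hs.1 hs.2)
    filter_upwards [h5, h6, sideBox_mem_nhds hq h0] with p p1 p2 p3
    exact ⟨p3, (A.root p p3 _ p2).1 p1⟩
  constructor
  · obtain ⟨β, h1, h2, h3⟩ := key (a q) (A.mem_a q hq) (A.root_a hq) (A.a_lt hq h0).ne
    refine h1.congr_of_eventuallyEq ?_
    have h4 : ∀ᶠ p in 𝓝 q, β p < p.1 :=
      h1.continuousAt.eventually_lt continuousAt_fst (by rw [h2]; exact A.a_lt hq h0)
    filter_upwards [h3, h4] with p p1 p2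
    rcases p1.2 with p3 | p3
    · exact p3.symm
    · linarith [A.le_b p p1.1]
  · obtain ⟨β, h1, h2, h3⟩ := key (b q) (A.mem_b q hq) (A.root_b hq) (A.lt_b hq h0).ne'
    refine h1.congr_of_eventuallyEq ?_
    have h4 : ∀ᶠ p in 𝓝 q, p.1 < β p :=
      continuousAt_fst.eventually_lt h1.continuousAt (by rw [h2]; exact A.lt_b hq h0)
    filter_upwards [h3, h4] with p p1 p2
    rcases p1.2 with p3 | p3
    · linarith [A.a_le p p1.1]
    · exact p3.symm

theorem tendsto_of_bound {K : ℝ} {r : ℝ × ℝ → ℝ}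
    (hr : ∀ q ∈ sideBox δ, (r q - q.1) ^ 2 ≤ K * q.2) (h0 : q.2 = 0) :
    Tendsto r (𝓝[sideBox δ] q) (𝓝 q.1) := by
  have h1 : Tendsto (fun p : ℝ × ℝ => √(K * p.2)) (𝓝[sideBox δ] q) (𝓝 0) := by
    have : Continuous fun p : ℝ × ℝ => √(K * p.2) := by fun_prop
    have h2 := this.tendsto q
    simp only [h0, mul_zero, Real.sqrt_zero] at h2
    exact h2.mono_left nhdsWithin_le_nhds
  have h2 : Tendsto (fun p => r p - p.1) (𝓝[sideBox δ] q) (𝓝 0) := by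
    refine squeeze_zero_norm' ?_ h1
    filter_upwards [self_mem_nhdsWithin] with p hp
    exact Real.abs_le_sqrt (hr p hp)
  have h3 : Tendsto (fun p : ℝ × ℝ => p.1) (𝓝[sideBox δ] q) (𝓝 q.1) :=
    (continuous_fst.tendsto q).mono_left nhdsWithin_le_nhds
  simpa using h2.add h3

theorem continuousOn_roots (A : IsRootPair h k x τ f w a b η δ) (hk : 2 ≤ k) :
    ContinuousOn a (sideBox δ) ∧ ContinuousOn b (sideBox δ) := by
  obtain ⟨K, hK⟩ := A.bound
  constructor
  · intro q hq
    rcases hq.2.1.eq_or_lt with h0 | h0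
    · rw [ContinuousWithinAt, (A.eq_of_zero hq h0.symm).1]
      exact tendsto_of_bound (fun p hp => (hK p hp).1) h0.symm
    · exact (A.contDiffAt_roots hk hq h0).1.continuousAt.continuousWithinAt
  · intro q hq
    rcases hq.2.1.eq_or_lt with h0 | h0
    · rw [ContinuousWithinAt, (A.eq_of_zero hq h0.symm).2]
      exact tendsto_of_bound (fun p hp => (hK p hp).2) h0.symm
    · exact (A.contDiffAt_roots hk hq h0).2.continuousAt.continuousWithinAt

theorem zero_mem (A : IsRootPair h k x τ f w a b η δ) : ((0 : ℝ), (0 : ℝ)) ∈ sideBox δ :=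
  ⟨⟨neg_lt_zero.2 A.δ_pos, A.δ_pos⟩, le_rfl, A.δ_pos⟩

/-- The roots are close to the origin near the origin. -/
theorem exists_forall_near (A : IsRootPair h k x τ f w a b η δ) (hk : 2 ≤ k)
    {p : ℝ × ℝ → Prop} (hp : ∀ᶠ v in 𝓝 ((0 : ℝ), (0 : ℝ)), p v) :
    ∃ δ' > 0, δ' ≤ δ ∧ ∀ q ∈ sideBox δ', p (a q, q.1) ∧ p (b q, q.1) := by
  obtain ⟨ca, cb⟩ := A.continuousOn_roots hk
  have hz := A.eq_of_zero A.zero_mem rfl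
  have h1 : Tendsto (fun q => (a q, q.1)) (𝓝[sideBox δ] (0, 0)) (𝓝 (0, 0)) := by
    have := (ca _ A.zero_mem).prodMk
      (continuousWithinAt_fst (s := sideBox δ) (p := ((0 : ℝ), (0 : ℝ))))
    rwa [ContinuousWithinAt, hz.1] at this
  have h2 : Tendsto (fun q => (b q, q.1)) (𝓝[sideBox δ] (0, 0)) (𝓝 (0, 0)) := by
    have := (cb _ A.zero_mem).prodMk
      (continuousWithinAt_fst (s := sideBox δ) (p := ((0 : ℝ), (0 : ℝ))))
    rwa [ContinuousWithinAt, hz.2] at this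
  have h3 := eventually_nhdsWithin_iff.1 ((h1.eventually hp).and (h2.eventually hp))
  obtain ⟨δ', hδ', hB⟩ := eventually_sideBox h3
  refine ⟨min δ' δ, lt_min hδ' A.δ_pos, min_le_right _ _, fun q hq => ?_⟩
  exact hB q (sideBox_mono (min_le_left _ _) hq) (sideBox_mono (min_le_right _ _) hq)

/-! ### The bisector field up to the curve. -/

/-- The sum of the velocities of the two tangent geodesics at their intersection point. -/
theorem contDiffAt_velocity_sum (A : IsRootPair h k x τ f w a b η δ) (hk : 2 ≤ k)
    (hq : q ∈ sideBox δ) (h0 : 0 < q.2) :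
    ContDiffAt ℝ (k - 1 : ℕ) (fun q => w (a q, q.1) + w (b q, q.1)) q := by
  obtain ⟨ha, hb⟩ := A.contDiffAt_roots hk hq h0
  exact (ContDiffAt.comp (g := w) q (A.sliced_a hq).contDiffw (ha.prodMk contDiffAt_fst)).add
    (ContDiffAt.comp (g := w) q (A.sliced_b hq).contDiffw (hb.prodMk contDiffAt_fst))

theorem continuousOn_velocity (A : IsRootPair h k x τ f w a b η δ) (hk : 2 ≤ k) :
    ContinuousOn (fun q => w (a q, q.1)) (sideBox δ) ∧
      ContinuousOn (fun q => w (b q, q.1)) (sideBox δ) := by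
  obtain ⟨ca, cb⟩ := A.continuousOn_roots hk
  refine ⟨fun q hq => ?_, fun q hq => ?_⟩
  · exact ContinuousAt.comp_continuousWithinAt (g := w) (f := fun q => (a q, q.1))
      (A.sliced_a hq).contDiffw.continuousAt ((ca q hq).prodMk continuousWithinAt_fst)
  · exact ContinuousAt.comp_continuousWithinAt (g := w) (f := fun q => (b q, q.1))
      (A.sliced_b hq).contDiffw.continuousAt ((cb q hq).prodMk continuousWithinAt_fst)

/-- In the variable `z = (s - σ)√R` the equation `f = t` reads `z² = t`, and the two roots are
exchanged by `z ↦ -z`. The sum of velocities is symmetric under this exchange, hence an even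
function evaluated at `√t`. -/
theorem exists_contDiffOn_velocity_sum (A : IsRootPair h k x τ f w a b η δ) (hk : 2 ≤ k)
    (S : IsSlicing h k x τ f R w)
    (hR : ∀ s ∈ Ioo (-η) η, ∀ σ ∈ Ioo (-η) η, f (s, σ) = (s - σ) ^ 2 * R (s, σ)) :
    ∃ δ' > 0, δ' ≤ δ ∧
      ContDiffOn ℝ (k / 2 - 1 : ℕ) (fun q => w (a q, q.1) + w (b q, q.1)) (sideBox δ') := by
  -- For `k < 4` the required order is 0 and the continuity of the roots suffices. From `k = 4` on,
  -- `Z` has enough derivatives for the implicit function theorem.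
  rcases lt_or_ge k 4 with hk4 | hk4
  · refine ⟨δ, A.δ_pos, le_rfl, ?_⟩
    rw [show k / 2 - 1 = 0 by omega]
    exact contDiffOn_zero.2 ((A.continuousOn_velocity hk).1.add (A.continuousOn_velocity hk).2)
  have hw0 := S.sliced.self_of_nhds.contDiffw
  let Z : ℝ × ℝ → ℝ := fun p => (p.1 - p.2) * √(R p)
  have hRs : ContDiffAt ℝ (k - 2 : ℕ) (fun p => √(R p)) (0, 0) := S.contDiffR.sqrt S.R_pos.ne'
  have hZ : ContDiffAt ℝ (k - 2 : ℕ) Z (0, 0) :=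
    (contDiffAt_fst.sub contDiffAt_snd).mul hRs
  have hn0 : ((k - 2 : ℕ) : ℕ∞ω) ≠ 0 := by
    have : k - 2 ≠ 0 := by omega
    exact_mod_cast this
  have hZ1 : fderiv ℝ Z (0, 0) (1, 0) ≠ 0 := by
    have h1 : HasDerivAt (fun s => Z (s, 0)) (fderiv ℝ Z (0, 0) (1, 0)) 0 :=
      hasDerivAt_fst_slice (q := (0, 0)) (hZ.differentiableAt hn0)
    have h2 : HasDerivAt (fun s => √(R (s, 0))) _ 0 :=
      hasDerivAt_fst_slice (F := fun p => √(R p)) (q := (0, 0)) (hRs.differentiableAt hn0)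
    have h3 : HasDerivAt (fun s : ℝ => s - 0) 1 0 := (hasDerivAt_id (0 : ℝ)).sub_const 0
    have h4 := h1.unique (h3.mul h2)
    rw [h4]
    simpa using (Real.sqrt_pos.2 S.R_pos).ne'
  obtain ⟨β, hβ, hβ0, hβl, -⟩ := exists_solution (by omega) hZ hZ1
  have hZ0 : Z (0, 0) = 0 := by simp [Z]
  simp only [hZ0] at hβ hβ0
  let W₁ : ℝ × ℝ → Plane := fun p => w (β (p.2, p.1), p.1)
  let W : ℝ × ℝ → Plane := fun p => W₁ p + W₁ (p.1, -p.2)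
  have hsw : ContDiff ℝ (k - 2 : ℕ) (fun p : ℝ × ℝ => (p.2, p.1)) := by fun_prop
  have hW₁ : ContDiffAt ℝ (k - 2 : ℕ) W₁ (0, 0) := by
    have h1 : ContDiffAt ℝ (k - 2 : ℕ) (fun p : ℝ × ℝ => (β (p.2, p.1), p.1)) (0, 0) :=
      (ContDiffAt.comp ((0 : ℝ), (0 : ℝ)) (f := fun p : ℝ × ℝ => (p.2, p.1)) hβ
        hsw.contDiffAt).prodMk contDiffAt_fst
    refine ContDiffAt.comp (g := w) ((0 : ℝ), (0 : ℝ)) ?_ h1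
    simp only [hβ0]
    exact hw0.of_le (by norm_cast; omega)
  have hW : ContDiffAt ℝ (k - 2 : ℕ) W (0, 0) := by
    refine hW₁.add ?_
    refine ContDiffAt.comp (g := W₁) (f := fun p : ℝ × ℝ => (p.1, -p.2)) ((0 : ℝ), (0 : ℝ)) ?_
      (by fun_prop)
    simpa using hW₁
  obtain ⟨ρ, hρ, hB⟩ := Metric.eventually_nhds_iff_ball.1 (hW.eventually (by simp))
  -- The order is `2 ([k/2] - 1) ≤ k - 2`: each derivative in `t` uses up two derivatives in `z`.
  have hWon : ContDiffOn ℝ (2 * (k / 2 - 1) : ℕ) W (Ioo (-ρ) ρ ×ˢ Ioo (-ρ) ρ) := by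
    intro p hp
    refine ((hB p ?_).of_le (by norm_cast; omega)).contDiffWithinAt
    rw [← ball_prod_same, Real.ball_eq_Ioo]
    simpa using hp
  have hsq := contDiffOn_comp_sqrt (k / 2 - 1) hWon (fun σ _ z _ => by simp [W, add_comm])
  obtain ⟨δ₁, hδ₁, hδ₁δ, hnear⟩ := A.exists_forall_near hk hβl
  refine ⟨min δ₁ (min ρ (ρ ^ 2)), by positivity, (min_le_left _ _).trans hδ₁δ, ?_⟩
  refine (hsq.mono ?_).congr ?_
  · refine prod_mono (Ioo_subset_Ioo (neg_le_neg ?_) ?_) (Ico_subset_Ico_right ?_)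
    · exact (min_le_right _ _).trans (min_le_left _ _)
    · exact (min_le_right _ _).trans (min_le_left _ _)
    · exact (min_le_right _ _).trans (min_le_right _ _)
  · intro q hq
    have hq1 := sideBox_mono (min_le_left _ _) hq
    have hqδ := sideBox_mono hδ₁δ hq1
    obtain ⟨n1, n2⟩ := hnear q hq1
    have hkey : ∀ s ∈ Ioo (-η) η, f (s, q.1) = q.2 → √q.2 = |s - q.1| * √(R (s, q.1)) := by
      intro s hs he
      rw [← he, hR s hs _ (A.mem_fst hqδ), Real.sqrt_mul (sq_nonneg _), Real.sqrt_sq_eq_abs]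
    have hb : Z (b q, q.1) = √q.2 := by
      rw [hkey _ (A.mem_b q hqδ) (A.root_b hqδ), abs_of_nonneg (sub_nonneg.2 (A.le_b q hqδ))]
    have ha : Z (a q, q.1) = -√q.2 := by
      rw [hkey _ (A.mem_a q hqδ) (A.root_a hqδ), abs_of_nonpos (sub_nonpos.2 (A.a_le q hqδ))]
      simp only [Z]; ring
    rw [hb] at n2
    rw [ha] at n1
    simp only at n1 n2
    simp only [W, W₁, n1, n2]
    exact add_comm _ _

end IsRootPair

/-! ### The string length and its differential. -/

/-- The excess `|AC| + |BC| - λ(A, B)` as a function of the coordinates of `C`. -/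
def stringLength (h : LocalMetric) (x : ℝ → Plane) (τ : ℝ × ℝ → ℝ) (a b : ℝ × ℝ → ℝ)
    (q : ℝ × ℝ) : ℝ :=
  -- The point is reached after the tangency at `a` and before the one at `b`: the second time is
  -- negative, and both `τ (a q, q.1)` and `-τ (b q, q.1)` are lengths.
  τ (a q, q.1) - τ (b q, q.1) - h.arcLength x (a q) (b q)

theorem sideMap_zero (s : ℝ) : sideMap h x (s, 0) = x s := by simp [sideMap]

theorem hasDerivAt_ip_const {V : ℝ → Plane} {V' : Plane} {t : ℝ} (u n : Plane)
    (hV : HasDerivAt V V' t) : HasDerivAt (fun s => h.ip u (V s) n) (h.ip u V' n) t := by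
  let L : Plane →ₗ[ℝ] ℝ :=
    { toFun := fun v => h.ip u v n
      map_add' := fun v v' => h.ip_add_left u v v' n
      map_smul' := fun c v => h.ip_smul_left u c v n }
  exact (LinearMap.toContinuousLinearMap L).hasFDerivAt.comp_hasDerivAt t hV

namespace IsRootPair

variable {τ f R : ℝ × ℝ → ℝ} {w : ℝ × ℝ → Plane} {a b : ℝ × ℝ → ℝ} {η δ : ℝ}
  {q : ℝ × ℝ}

theorem regular_curve (A : IsRootPair h k x τ f w a b η δ) {s : ℝ} (hs : s ∈ Ioo (-η) η) :
    h.IsRegularAt k (x s) := by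
  have h1 := (A.sliced s hs s hs).regular
  have h2 : f (s, s) = 0 := (A.sliced s hs s hs).diagf
  simpa [h2, sideMap_zero] using h1

theorem regular (A : IsRootPair h k x τ f w a b η δ) (hq : q ∈ sideBox δ) :
    h.IsRegularAt k (sideMap h x q) := by
  have := (A.sliced_a hq).regular
  rwa [A.root_a hq] at this

theorem sub_one_ne_zero (hk : 2 ≤ k) : ((k - 1 : ℕ) : ℕ∞ω) ≠ 0 := by
  have : k - 1 ≠ 0 := by omega
  exact_mod_cast this

theorem hasDerivAt_arcLength (A : IsRootPair h k x τ f w a b η δ) (hk : 2 ≤ k) {s s₀ : ℝ}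
    (hs : s ∈ Ioo (-η) η) (hs₀ : s₀ ∈ Ioo (-η) η) :
    HasDerivAt (fun s => h.arcLength x s₀ s) (h.norm (x s) (deriv x s)) s ∧
      IntervalIntegrable (fun t => h.norm (x t) (deriv x t)) MeasureTheory.volume s₀ s := by
  have hc : ContinuousOn (fun t => h.norm (x t) (deriv x t)) (Ioo (-η) η) := by
    intro t ht
    have h1 := (A.sliced t ht t ht).smooth
    have h2 : ContDiffAt ℝ (0 : ℕ) (deriv x) t := contDiffAt_deriv (h1.of_le (by norm_cast; omega))
      (by omega : 0 + 1 ≤ 1)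
    exact (LocalMetric.contDiffAt_norm (n := 0) (by omega) (A.regular_curve ht)
      (h1.of_le (by norm_cast; omega)) h2
      (A.sliced t ht t ht).deriv_ne).continuousAt.continuousWithinAt
  have hsub : uIcc s₀ s ⊆ Ioo (-η) η := ordConnected_Ioo.uIcc_subset hs₀ hs
  have hint : IntervalIntegrable (fun t => h.norm (x t) (deriv x t)) MeasureTheory.volume s₀ s :=
    (hc.mono hsub).intervalIntegrable
  refine ⟨intervalIntegral.integral_hasDerivAt_right hint ?_ ?_, hint⟩
  · exact hc.stronglyMeasurableAtFilter isOpen_Ioo _ hs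
  · exact hc.continuousAt (Ioo_mem_nhds hs.1 hs.2)

theorem arcLength_sub (A : IsRootPair h k x τ f w a b η δ) (hk : 2 ≤ k) {s s' : ℝ}
    (hs : s ∈ Ioo (-η) η) (hs' : s' ∈ Ioo (-η) η) :
    h.arcLength x s s' = h.arcLength x 0 s' - h.arcLength x 0 s := by
  have h0 : (0 : ℝ) ∈ Ioo (-η) η := A.mem_fst A.zero_mem
  exact (intervalIntegral.integral_interval_sub_left (A.hasDerivAt_arcLength hk hs' h0).2
    (A.hasDerivAt_arcLength hk hs h0).2).symm

/-- The eikonal identity along a root: moving the tangency point changes the time and the arc length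
by opposite amounts, so only the displacement of the end point remains. -/
theorem hasFDerivAt_partial (A : IsRootPair h k x τ f w a b η δ) (hk : 2 ≤ k)
    (hq : q ∈ sideBox δ) {r : ℝ × ℝ → ℝ} (hr : DifferentiableAt ℝ r q)
    (hm : r q ∈ Ioo (-η) η) (hroot : ∀ᶠ p in 𝓝 q, f (r p, p.1) = p.2) :
    ∃ L : ℝ × ℝ →L[ℝ] ℝ,
      HasFDerivAt (fun p => τ (r p, p.1) + h.arcLength x 0 (r p)) L q ∧
      ∀ v, L v = h.ip (sideMap h x q) (w (r q, q.1))
        (v.1 • deriv x q.1 - v.2 • h.curvatureVec x 0) := by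
  have hk0 := sub_one_ne_zero hk
  have hS := A.sliced _ hm _ (A.mem_fst hq)
  have h1 : HasFDerivAt (fun p : ℝ × ℝ => (r p, p.1))
      ((fderiv ℝ r q).prod (ContinuousLinearMap.fst ℝ ℝ ℝ)) q :=
    hr.hasFDerivAt.prodMk hasFDerivAt_fst
  have h2 := HasFDerivAt.comp q (g := τ) (f := fun p : ℝ × ℝ => (r p, p.1))
    (hS.contDiffτ.differentiableAt hk0).hasFDerivAt h1
  have h3 := HasFDerivAt.comp q (g := f) (f := fun p : ℝ × ℝ => (r p, p.1))
    (hS.contDifff.differentiableAt hk0).hasFDerivAt h1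
  have h4 := h3.unique ((hasFDerivAt_snd (𝕜 := ℝ) (p := q)).congr_of_eventuallyEq hroot)
  have h5 := (A.hasDerivAt_arcLength hk hm (A.mem_fst A.zero_mem)).1.hasFDerivAt.comp q
    hr.hasFDerivAt
  refine ⟨_, h2.add h5, fun v => ?_⟩
  have h6 := hS.eikonal (fderiv ℝ r q v, v.1)
  have h7 : fderiv ℝ f (r q, q.1) (fderiv ℝ r q v, v.1) = v.2 := DFunLike.congr_fun h4 v
  rw [h7, hroot.self_of_nhds] at h6
  simp only at h6
  rw [← h6]
  simp
  ring

/-- Writing the arc from `a` to `b` as a difference of arcs from 0 splits the excess into one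
contribution of each root. -/
theorem hasFDerivAt_stringLength (A : IsRootPair h k x τ f w a b η δ) (hk : 2 ≤ k)
    (hq : q ∈ sideBox δ) (h0 : 0 < q.2) :
    ∃ L : ℝ × ℝ →L[ℝ] ℝ, HasFDerivAt (stringLength h x τ a b) L q ∧
      ∀ v, L v = h.ip (sideMap h x q) (w (a q, q.1) - w (b q, q.1))
        (v.1 • deriv x q.1 - v.2 • h.curvatureVec x 0) := by
  have hk0 := sub_one_ne_zero hk
  obtain ⟨ha, hb⟩ := A.contDiffAt_roots hk hq h0
  have hnear := sideBox_mem_nhds hq h0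
  obtain ⟨L, hL, hL'⟩ := A.hasFDerivAt_partial hk hq (ha.differentiableAt hk0) (A.mem_a q hq)
    (mem_of_superset hnear fun p hp => A.root_a hp)
  obtain ⟨N, hN, hN'⟩ := A.hasFDerivAt_partial hk hq (hb.differentiableAt hk0) (A.mem_b q hq)
    (mem_of_superset hnear fun p hp => A.root_b hp)
  refine ⟨L - N, (hL.sub hN).congr_of_eventuallyEq ?_, fun v => ?_⟩
  · filter_upwards [hnear] with p hp
    simp only [stringLength, Pi.sub_apply]
    rw [A.arcLength_sub hk (A.mem_a p hp) (A.mem_b p hp)]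
    ring
  · rw [sub_apply, hL', hN', LocalMetric.ip_sub_left]

theorem continuousOn_stringLength (A : IsRootPair h k x τ f w a b η δ) (hk : 2 ≤ k) :
    ContinuousOn (stringLength h x τ a b) (sideBox δ) := by
  obtain ⟨ca, cb⟩ := A.continuousOn_roots hk
  have h0 : (0 : ℝ) ∈ Ioo (-η) η := A.mem_fst A.zero_mem
  have : ContinuousOn (fun q => τ (a q, q.1) - τ (b q, q.1) -
      (h.arcLength x 0 (b q) - h.arcLength x 0 (a q))) (sideBox δ) := by
    intro q hq
    refine ((ContinuousAt.comp_continuousWithinAt (g := τ) (f := fun q => (a q, q.1))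
      (A.sliced_a hq).contDiffτ.continuousAt ((ca q hq).prodMk continuousWithinAt_fst)).sub
      (ContinuousAt.comp_continuousWithinAt (g := τ) (f := fun q => (b q, q.1))
      (A.sliced_b hq).contDiffτ.continuousAt ((cb q hq).prodMk continuousWithinAt_fst))).sub ?_
    refine (ContinuousAt.comp_continuousWithinAt (g := fun s => h.arcLength x 0 s) (f := b)
      ?_ (cb q hq)).sub (ContinuousAt.comp_continuousWithinAt (g := fun s => h.arcLength x 0 s)
      (f := a) ?_ (ca q hq))
    · exact (A.hasDerivAt_arcLength hk (A.mem_b q hq) h0).1.continuousAt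
    · exact (A.hasDerivAt_arcLength hk (A.mem_a q hq) h0).1.continuousAt
  refine this.congr fun q hq => ?_
  rw [stringLength, A.arcLength_sub hk (A.mem_a q hq) (A.mem_b q hq)]

theorem stringLength_of_zero (A : IsRootPair h k x τ f w a b η δ) (hq : q ∈ sideBox δ)
    (h0 : q.2 = 0) : stringLength h x τ a b q = 0 := by
  obtain ⟨ha, hb⟩ := A.eq_of_zero hq h0
  simp [stringLength, ha, hb, LocalMetric.arcLength]

/-- The vectors `w(s, σ)` for `s` between the roots sit at different points of the line. They are
compared as coordinate vectors, with the metric frozen at the given point; near the origin the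
`s`-derivative of their product with the curvature vector is close to that vector's positive squared
norm times `|x'(0)|`. -/
theorem exists_ip_sub_pos (A : IsRootPair h k x τ f w a b η δ) (S : IsSlicing h k x τ f R w)
    (H : IsCurvedAt h k x) : ∃ δ' > 0, δ' ≤ δ ∧ ∀ q ∈ sideBox δ', 0 < q.2 →
      0 < h.ip (sideMap h x q) (w (b q, q.1) - w (a q, q.1)) (h.curvatureVec x 0) := by
  have hk := H.two_le
  have hk0 := sub_one_ne_zero hk
  set n₀ := h.curvatureVec x 0
  have hx0 : sideMap h x (0, 0) = x 0 := sideMap_zero 0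
  have hw := S.sliced.self_of_nhds.contDiffw
  have hc : ContinuousAt (fun v : Plane × (ℝ × ℝ) => h.ip v.1 (fderiv ℝ w v.2 (1, 0)) n₀)
      (x 0, (0, 0)) := by
    have hfd : ContDiffAt ℝ (0 : ℕ) (fun v : Plane × (ℝ × ℝ) => fderiv ℝ w v.2 (1, 0))
        (x 0, ((0 : ℝ), (0 : ℝ))) := by
      refine ContDiffAt.clm_apply ?_ contDiffAt_const
      exact ContDiffAt.comp (g := fderiv ℝ w) (x 0, ((0 : ℝ), (0 : ℝ)))
        (hw.fderiv_right (m := (0 : ℕ)) (by norm_cast; omega)) contDiffAt_snd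
    exact (LocalMetric.contDiffAt_ip (n := 0) (k := k) (c := Prod.fst) (by omega) H.metric
      contDiffAt_fst hfd contDiffAt_const).continuousAt
  have hpos : 0 < h.ip (x 0) (fderiv ℝ w (0, 0) (1, 0)) n₀ := by
    rw [S.dw, LocalMetric.ip_smul_left]
    exact mul_pos H.norm_deriv_pos (H.metric.ip_pos H.curvatureVec_ne)
  have hev := hc.eventually_const_lt hpos
  rw [nhds_prod_eq] at hev
  obtain ⟨pa, hpa, pb, hpb, hab⟩ := eventually_prod_iff.1 hev
  obtain ⟨ρ, hρ, hB⟩ := Metric.eventually_nhds_iff_ball.1 hpb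
  have hside : ∀ᶠ q in 𝓝 ((0 : ℝ), (0 : ℝ)), pa (sideMap h x q) := by
    have h1 := (contDiffAt_sideMap (h := h) (p := (0, 0)) H.smooth).continuousAt
    exact h1.eventually (by rw [hx0]; exact hpa)
  obtain ⟨δ₁, hδ₁, hδ₁'⟩ := eventually_sideBox hside
  obtain ⟨δ₂, hδ₂, hδ₂δ, hδ₂'⟩ := A.exists_forall_near hk
    (Metric.ball_mem_nhds ((0 : ℝ), (0 : ℝ)) hρ)
  refine ⟨min δ₁ δ₂, lt_min hδ₁ hδ₂, (min_le_right _ _).trans hδ₂δ, fun q hq h0 => ?_⟩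
  have hq1 := sideBox_mono (min_le_left _ _) hq
  have hq2 := sideBox_mono (min_le_right _ _) hq
  have hqδ := sideBox_mono hδ₂δ hq2
  obtain ⟨ma, mb⟩ := hδ₂' q hq2
  have hlt : a q < b q := (A.a_lt hqδ h0).trans (A.lt_b hqδ h0)
  have hder : ∀ s ∈ Icc (a q) (b q), HasDerivAt (fun s => h.ip (sideMap h x q) (w (s, q.1)) n₀)
      (h.ip (sideMap h x q) (fderiv ℝ w (s, q.1) (1, 0)) n₀) s := by
    intro s hs
    have hsη : s ∈ Ioo (-η) η :=
      ⟨(A.mem_a q hqδ).1.trans_le hs.1, hs.2.trans_lt (A.mem_b q hqδ).2⟩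
    exact hasDerivAt_ip_const _ _ (hasDerivAt_fst_slice (q := (s, q.1))
      ((A.sliced s hsη _ (A.mem_fst hqδ)).contDiffw.differentiableAt hk0))
  have hmono : StrictMonoOn (fun s => h.ip (sideMap h x q) (w (s, q.1)) n₀)
      (Icc (a q) (b q)) := by
    refine strictMonoOn_of_deriv_pos (convex_Icc _ _)
      (fun s hs => (hder s hs).continuousAt.continuousWithinAt) fun s hs => ?_
    rw [interior_Icc] at hs
    have hs' := Ioo_subset_Icc_self hs
    rw [(hder s hs').deriv]
    refine hab (hδ₁' q hq1) (hB (s, q.1) ?_)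
    rw [← Metric.mem_ball, ← ball_prod_same] at ma mb
    rw [← ball_prod_same]
    have hball : OrdConnected (Metric.ball (0 : ℝ) ρ) := by
      rw [Real.ball_eq_Ioo]; exact ordConnected_Ioo
    exact ⟨hball.out ma.1 mb.1 hs', ma.2⟩
  have := hmono (left_mem_Icc.2 hlt.le) (right_mem_Icc.2 hlt.le) hlt
  rw [LocalMetric.ip_sub_left]
  exact sub_pos.2 this

/-- The `t`-derivative of the excess is `⟨w_b - w_a, n⟩`, since increasing `t` moves the point along
`-n`. -/
theorem strictMonoOn_stringLength (A : IsRootPair h k x τ f w a b η δ) (hk : 2 ≤ k)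
    (hpos : ∀ q ∈ sideBox δ, 0 < q.2 →
      0 < h.ip (sideMap h x q) (w (b q, q.1) - w (a q, q.1)) (h.curvatureVec x 0))
    {σ : ℝ} (hσ : σ ∈ Ioo (-δ) δ) :
    StrictMonoOn (fun t => stringLength h x τ a b (σ, t)) (Ico 0 δ) := by
  refine strictMonoOn_of_deriv_pos (convex_Ico _ _) ?_ fun t ht => ?_
  · exact (A.continuousOn_stringLength hk).comp (by fun_prop) fun t ht => ⟨hσ, ht⟩
  · rw [interior_Ico] at ht
    have hq : (σ, t) ∈ sideBox δ := ⟨hσ, ht.1.le, ht.2⟩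
    obtain ⟨L, hL, hL'⟩ := A.hasFDerivAt_stringLength hk hq ht.1
    have h1 : HasDerivAt (fun t => stringLength h x τ a b (σ, t)) (L (0, 1)) t :=
      hL.comp_hasDerivAt t ((hasDerivAt_const t σ).prodMk (hasDerivAt_id t))
    rw [h1.deriv, hL']
    have := hpos _ hq ht.1
    simp only [zero_smul, one_smul, zero_sub]
    rw [LocalMetric.ip_neg_right, ← LocalMetric.ip_neg_left, neg_sub]
    exact this

theorem stringLength_pos (A : IsRootPair h k x τ f w a b η δ) (hk : 2 ≤ k)
    (hpos : ∀ q ∈ sideBox δ, 0 < q.2 →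
      0 < h.ip (sideMap h x q) (w (b q, q.1) - w (a q, q.1)) (h.curvatureVec x 0))
    (hq : q ∈ sideBox δ) (h0 : 0 < q.2) : 0 < stringLength h x τ a b q := by
  have := A.strictMonoOn_stringLength hk hpos hq.1 ⟨le_rfl, A.δ_pos⟩ hq.2 h0
  have h1 : stringLength h x τ a b (q.1, 0) = 0 :=
    A.stringLength_of_zero (q := (q.1, 0)) ⟨hq.1, le_rfl, A.δ_pos⟩ rfl
  simpa [h1] using this

theorem strictMonoOn_time (A : IsRootPair h k x τ f w a b η δ) (hk : 2 ≤ k) {s : ℝ}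
    (hs : s ∈ Ioo (-η) η) : StrictMonoOn (fun σ => τ (s, σ)) (Ioo (-η) η) := by
  have hder : ∀ σ ∈ Ioo (-η) η, HasDerivAt (fun σ => τ (s, σ)) (fderiv ℝ τ (s, σ) (0, 1)) σ :=
    fun σ hσ => hasDerivAt_snd_slice (q := (s, σ))
      ((A.sliced s hs σ hσ).contDiffτ.differentiableAt (sub_one_ne_zero hk))
  refine strictMonoOn_of_deriv_pos (convex_Ioo _ _)
    (fun σ hσ => (hder σ hσ).continuousAt.continuousWithinAt) fun σ hσ => ?_
  rw [interior_Ioo] at hσ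
  rw [(hder σ hσ).deriv]
  exact (A.sliced s hs σ hσ).dτ_pos

theorem time_a_pos (A : IsRootPair h k x τ f w a b η δ) (hk : 2 ≤ k) (hq : q ∈ sideBox δ)
    (h0 : 0 < q.2) : 0 < τ (a q, q.1) := by
  have := A.strictMonoOn_time hk (A.mem_a q hq) (A.mem_a q hq) (A.mem_fst hq) (A.a_lt hq h0)
  have h1 : τ (a q, a q) = 0 := (A.sliced_a hq).diagτ
  simpa [h1] using this

theorem time_b_neg (A : IsRootPair h k x τ f w a b η δ) (hk : 2 ≤ k) (hq : q ∈ sideBox δ)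
    (h0 : 0 < q.2) : τ (b q, q.1) < 0 := by
  have := A.strictMonoOn_time hk (A.mem_b q hq) (A.mem_fst hq) (A.mem_b q hq) (A.lt_b hq h0)
  have h1 : τ (b q, b q) = 0 := (A.sliced_b hq).diagτ
  simpa [h1] using this

/-- The tangent segments through a point of the concave side. -/
theorem eventually_segment_iff (A : IsRootPair h k x τ f w a b η δ)
    (S : IsSlicing h k x τ f R w) (hk : 2 ≤ k) : ∀ᶠ ε in 𝓝[>] (0 : ℝ), ∃ δ' > 0, δ' ≤ δ ∧
      ∀ q ∈ sideBox δ', ∀ s ℓ ζ, IsTangentSegment h x ε (sideMap h x q) s ℓ ζ ↔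
        0 < q.2 ∧ ((s = a q ∧ ℓ = τ (a q, q.1) ∧ ζ = -w (a q, q.1)) ∨
          (s = b q ∧ ℓ = -τ (b q, q.1) ∧ ζ = w (b q, q.1))) := by
  have hη : 0 < η := A.δ_pos.trans_le A.δ_le
  have hsmall : ∀ᶠ ε in 𝓝[>] (0 : ℝ), ε < η := mem_nhdsWithin_of_mem_nhds (eventually_lt_nhds hη)
  filter_upwards [S.segment, hsmall, self_mem_nhdsWithin] with ε h1 hεη hε
  have hε : 0 < ε := hε
  obtain ⟨δ₁, hδ₁, hδ₁'⟩ := eventually_sideBox h1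
  have hnear : ∀ᶠ v in 𝓝 ((0 : ℝ), (0 : ℝ)), v.1 ∈ Ioo (-ε) ε ∧ τ v ∈ Ioo (-ε) ε := by
    refine (continuousAt_fst.eventually (Ioo_mem_nhds (neg_lt_zero.2 hε) hε)).and ?_
    have hτ := S.sliced.self_of_nhds
    refine hτ.contDiffτ.continuousAt.eventually ?_
    have : τ (0, 0) = 0 := hτ.diagτ
    rw [this]
    exact Ioo_mem_nhds (neg_lt_zero.2 hε) hε
  obtain ⟨δ₂, hδ₂, hδ₂δ, hδ₂'⟩ := A.exists_forall_near hk hnear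
  refine ⟨min δ₁ δ₂, lt_min hδ₁ hδ₂, (min_le_right _ _).trans hδ₂δ, fun q hq s ℓ ζ => ?_⟩
  have hq2 := sideBox_mono (min_le_right _ _) hq
  have hqδ := sideBox_mono hδ₂δ hq2
  obtain ⟨na, nb⟩ := hδ₂' q hq2
  rw [hδ₁' q (sideBox_mono (min_le_left _ _) hq)]
  constructor
  · rintro ⟨hs, hℓ, he, hor⟩
    have hsη : s ∈ Ioo (-η) η := ⟨by linarith [hs.1], by linarith [hs.2]⟩
    have hroot := (A.root q hqδ s hsη).1 he
    -- On the curve both roots equal `σ` and the time vanishes there, so no segment of positive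
    -- length exists.
    have h0 : 0 < q.2 := by
      refine hqδ.2.1.lt_of_ne fun h0 => ?_
      obtain ⟨ea, eb⟩ := A.eq_of_zero hqδ h0.symm
      rw [ea, eb, or_self] at hroot
      have hz : τ (q.1, q.1) = 0 := (A.sliced_diag hqδ).diagτ
      rw [hroot, hz] at hor
      rcases hor with h3 | h3
      · linarith [h3.1, hℓ.1]
      · linarith [h3.1, hℓ.1]
    refine ⟨h0, ?_⟩
    rcases hroot with rfl | rfl
    · have h2 := A.time_a_pos hk hqδ h0
      rcases hor with h3 | h3
      · exact Or.inl ⟨rfl, h3.1.symm, h3.2⟩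
      · linarith [h3.1, hℓ.1]
    · have h2 := A.time_b_neg hk hqδ h0
      rcases hor with h3 | h3
      · linarith [h3.1, hℓ.1]
      · exact Or.inr ⟨rfl, by linarith [h3.1], h3.2⟩
  · rintro ⟨h0, (⟨rfl, rfl, rfl⟩ | ⟨rfl, rfl, rfl⟩)⟩
    · exact ⟨na.1, ⟨A.time_a_pos hk hqδ h0, na.2.2⟩, A.root_a hqδ, Or.inl ⟨rfl, rfl⟩⟩
    · exact ⟨nb.1, ⟨by linarith [A.time_b_neg hk hqδ h0], by linarith [nb.2.1]⟩, A.root_b hqδ,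
        Or.inr ⟨by ring, rfl⟩⟩

end IsRootPair

/-! ### Bisectors and string curves in coordinates. -/

theorem closedConcaveSide_eq (δ : ℝ) : closedConcaveSide h x δ = sideMap h x '' sideBox δ := by
  ext C
  constructor
  · rintro ⟨s, hs, t, ht, rfl⟩
    exact ⟨(s, t), ⟨hs, ht⟩, rfl⟩
  · rintro ⟨q, hq, rfl⟩
    exact ⟨q.1, hq.1, q.2, hq.2, rfl⟩

theorem mem_concaveSide_iff (δ : ℝ) (C : Plane) :
    C ∈ concaveSide h x δ ↔ ∃ q ∈ sideBox δ, 0 < q.2 ∧ sideMap h x q = C := by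
  constructor
  · rintro ⟨s, hs, t, ht, rfl⟩
    exact ⟨(s, t), ⟨hs, ht.1.le, ht.2⟩, ht.1, rfl⟩
  · rintro ⟨q, hq, h0, rfl⟩
    exact ⟨q.1, hq.1, q.2, ⟨h0, hq.2.2⟩, rfl⟩

/-- The objects of the string construction in the coordinates `sideMap`, with inverse `Θ`: the
field `X` spanning the exterior bisectors and the function `P` whose level sets are the string
curves. -/
structure IsStringSystem (h : LocalMetric) (k : ℕ) (x : ℝ → Plane) (Θ : Plane → ℝ × ℝ)
    (X : ℝ × ℝ → Plane) (P : ℝ × ℝ → ℝ) (ε δ : ℝ) : Prop where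
  two_le : 2 ≤ k
  δ_pos : 0 < δ
  left_inv : ∀ q ∈ sideBox δ, ∀ᶠ p in 𝓝 q, Θ (sideMap h x p) = p
  right_inv : ∀ q ∈ sideBox δ, ∀ᶠ C in 𝓝 (sideMap h x q), sideMap h x (Θ C) = C
  curve_inv : ∀ s ∈ Ioo (-ε) ε, Θ (x s) = (s, 0)
  contDiffΘ : ∀ q ∈ sideBox δ, ContDiffAt ℝ k Θ (sideMap h x q)
  regular : ∀ q ∈ sideBox δ, h.IsRegularAt k (sideMap h x q)
  smooth : ∀ q ∈ sideBox δ, ContDiffAt ℝ k x q.1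
  deriv_ne : ∀ q ∈ sideBox δ, deriv x q.1 ≠ 0
  contDiffX : ∀ q ∈ sideBox δ, 0 < q.2 → ContDiffAt ℝ (k - 1 : ℕ) X q
  contDiffOnX : ContDiffOn ℝ (k / 2 - 1 : ℕ) X (sideBox δ)
  curveX : ∀ q ∈ sideBox δ, q.2 = 0 → X q = (2 : ℝ) • h.unitTangent x q.1
  fstX : ∀ q ∈ sideBox δ, 0 < (fderiv ℝ Θ (sideMap h x q) (X q)).1
  P_zero : ∀ q ∈ sideBox δ, q.2 = 0 → P q = 0
  P_pos : ∀ q ∈ sideBox δ, 0 < q.2 → 0 < P q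
  P_mono : ∀ σ ∈ Ioo (-δ) δ, StrictMonoOn (fun t => P (σ, t)) (Ico 0 δ)
  P_deriv : ∀ q ∈ sideBox δ, 0 < q.2 → ∃ L : ℝ × ℝ →L[ℝ] ℝ, HasFDerivAt P L q ∧
    L (fderiv ℝ Θ (sideMap h x q) (X q)) = 0
  ncard : ∀ q ∈ sideBox δ, 0 < q.2 → (tangencySet h x ε (sideMap h x q)).ncard = 2
  bisector : ∀ q ∈ sideBox δ, bisectorField h x ε (sideMap h x q) = Submodule.span ℝ {X q}
  string : ∀ q ∈ sideBox δ, ∀ p, sideMap h x q ∈ stringCurve h x ε p ↔ p = P q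

theorem fderiv_sideChart {Θ : Plane → ℝ × ℝ} {q : ℝ × ℝ} (hΘ : DifferentiableAt ℝ Θ (sideMap h x q))
    (hx : DifferentiableAt ℝ x q.1) (hl : ∀ᶠ p in 𝓝 q, Θ (sideMap h x p) = p) (v : ℝ × ℝ) :
    fderiv ℝ Θ (sideMap h x q) (v.1 • deriv x q.1 - v.2 • h.curvatureVec x 0) = v := by
  have h1 := hΘ.hasFDerivAt.comp q (hasFDerivAt_sideMap (h := h) hx)
  have h2 := h1.unique ((hasFDerivAt_id q).congr_of_eventuallyEq hl)
  simpa using DFunLike.congr_fun h2 v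

theorem sideMap_fderiv_sideChart {Θ : Plane → ℝ × ℝ} {q : ℝ × ℝ}
    (hΘ : DifferentiableAt ℝ Θ (sideMap h x q)) (hx : DifferentiableAt ℝ x q.1)
    (hl : Θ (sideMap h x q) = q) (hr : ∀ᶠ C in 𝓝 (sideMap h x q), sideMap h x (Θ C) = C)
    (v : Plane) : (fderiv ℝ Θ (sideMap h x q) v).1 • deriv x q.1 -
      (fderiv ℝ Θ (sideMap h x q) v).2 • h.curvatureVec x 0 = v := by
  have h0 := hasFDerivAt_sideMap (h := h) (x := x) (p := Θ (sideMap h x q)) (by rwa [hl])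
  have h1 := h0.comp (sideMap h x q) hΘ.hasFDerivAt
  have h2 := h1.unique ((hasFDerivAt_id _).congr_of_eventuallyEq hr)
  simpa [hl] using DFunLike.congr_fun h2 v

/-- The tangent segments through a point are exactly the two given by `a` and `b`, with directions
`-w_a` and `w_b`. This turns the geometric definitions of `bisectorField` and `stringCurve` into
`span {w_a + w_b}` and the level sets of `stringLength`. -/
theorem IsCurvedAt.exists_stringSystem (H : IsCurvedAt h k x) :
    ∃ (Θ : Plane → ℝ × ℝ) (X : ℝ × ℝ → Plane) (P : ℝ × ℝ → ℝ),
      ∀ᶠ ε in 𝓝[>] (0 : ℝ), ∃ δ, IsStringSystem h k x Θ X P ε δ := by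
  have hk := H.two_le
  have hkne := H.ne_zero
  obtain ⟨τ, f, R, w, S⟩ := H.exists_slicing
  obtain ⟨a, b, η, δ₀, A₀, hR⟩ := S.exists_rootPair hk
  obtain ⟨Θ, hΘ, hΘ0, hΘl, hΘr⟩ := H.exists_sideChart
  let X : ℝ × ℝ → Plane := fun q => w (a q, q.1) + w (b q, q.1)
  let P := stringLength h x τ a b
  refine ⟨Θ, X, P, ?_⟩
  have hx0 : sideMap h x (0, 0) = x 0 := sideMap_zero 0
  have hcs : Tendsto (sideMap h x) (𝓝 (0, 0)) (𝓝 (x 0)) := by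
    have h2 := (contDiffAt_sideMap (h := h) (p := (0, 0)) H.smooth).continuousAt
    rwa [ContinuousAt, hx0] at h2
  -- neighbourhoods independent of `ε`
  have hΘc : ∀ᶠ q in 𝓝 ((0 : ℝ), (0 : ℝ)), ContDiffAt ℝ k Θ (sideMap h x q) :=
    hcs.eventually (hΘ.eventually (by simp))
  have hcurve := (continuousAt_fst (p := ((0 : ℝ), (0 : ℝ)))).eventually H.eventually_curve
  obtain ⟨δ₁, hδ₁, hB₁⟩ := eventually_sideBox
    (hΘl.eventually_nhds.and ((hcs.eventually hΘr.eventually_nhds).and (hΘc.and hcurve)))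
  obtain ⟨δ₂, hδ₂, hδ₂δ, hX₂⟩ := A₀.exists_contDiffOn_velocity_sum hk S hR
  obtain ⟨δ₃, hδ₃, hδ₃δ, hpos₃⟩ := A₀.exists_ip_sub_pos S H
  have hfst : ∀ᶠ v in 𝓝 ((0 : ℝ), (0 : ℝ)),
      0 < (fderiv ℝ Θ (sideMap h x (v.2, f v)) (w v)).1 := by
    have hS := S.sliced.self_of_nhds
    have hf0 : f (0, 0) = 0 := hS.diagf
    have hw0 : w (0, 0) = h.unitTangent x 0 := hS.diagw
    have h1 : ContDiffAt ℝ (0 : ℕ) (fun v : ℝ × ℝ => (v.2, f v)) (0, 0) :=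
      contDiffAt_snd.prodMk (hS.contDifff.of_le (by norm_cast; omega))
    have h2 : ContDiffAt ℝ (0 : ℕ) (fun v => sideMap h x (v.2, f v)) (0, 0) := by
      refine ContDiffAt.comp (g := sideMap h x) ((0 : ℝ), (0 : ℝ)) ?_ h1
      exact contDiffAt_sideMap (H.smooth.of_le (by norm_cast; omega))
    have h3 : ContDiffAt ℝ (0 : ℕ) (fun v => fderiv ℝ Θ (sideMap h x (v.2, f v)) (w v)) (0, 0) := by
      refine ContDiffAt.clm_apply ?_ (hS.contDiffw.of_le (by norm_cast; omega))
      refine ContDiffAt.comp (g := fderiv ℝ Θ) ((0 : ℝ), (0 : ℝ)) ?_ h2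
      simp only [hf0, hx0]
      exact hΘ.fderiv_right (m := (0 : ℕ)) (by norm_cast; omega)
    refine h3.continuousAt.fst.eventually_const_lt ?_
    have h4 := fderiv_sideChart (Θ := Θ) (q := (0, 0)) (h := h) (x := x)
      (by rw [hx0]; exact hΘ.differentiableAt hkne) (H.smooth.differentiableAt hkne) hΘl (1, 0)
    simp only [one_smul, zero_smul, sub_zero] at h4
    simp only [hf0, hw0, LocalMetric.unitTangent, map_smul, h4]
    simpa using H.norm_deriv_pos
  obtain ⟨δ₄, hδ₄, hδ₄δ, hfst₄⟩ := A₀.exists_forall_near hk hfst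
  -- the curve
  have hline : ContinuousAt (fun s : ℝ => (s, (0 : ℝ))) 0 := by fun_prop
  have hcv : ∀ᶠ s in 𝓝 (0 : ℝ), Θ (x s) = (s, 0) := by
    filter_upwards [hline.eventually hΘl] with s hs
    simpa [sideMap] using hs
  obtain ⟨ρ, hρ, hBρ⟩ := Metric.eventually_nhds_iff_ball.1 hcv
  have hερ : ∀ᶠ ε in 𝓝[>] (0 : ℝ), ε < ρ := mem_nhdsWithin_of_mem_nhds (eventually_lt_nhds hρ)
  filter_upwards [A₀.eventually_segment_iff S hk, hερ, self_mem_nhdsWithin]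
    with ε ⟨δ₅, hδ₅, hδ₅δ, hseg⟩ hερ hε
  have hε : 0 < ε := hε
  set δ := min ε (min δ₁ (min δ₂ (min δ₃ (min δ₄ δ₅)))) with hδ
  have hδ0 : 0 < δ := by positivity
  have l0 : δ ≤ ε := min_le_left _ _
  have l1' : δ ≤ min δ₁ (min δ₂ (min δ₃ (min δ₄ δ₅))) := min_le_right _ _
  have l1 : δ ≤ δ₁ := l1'.trans (min_le_left _ _)
  have l2' : δ ≤ min δ₂ (min δ₃ (min δ₄ δ₅)) := l1'.trans (min_le_right _ _)
  have l2 : δ ≤ δ₂ := l2'.trans (min_le_left _ _)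
  have l3' : δ ≤ min δ₃ (min δ₄ δ₅) := l2'.trans (min_le_right _ _)
  have l3 : δ ≤ δ₃ := l3'.trans (min_le_left _ _)
  have l4' : δ ≤ min δ₄ δ₅ := l3'.trans (min_le_right _ _)
  have l4 : δ ≤ δ₄ := l4'.trans (min_le_left _ _)
  have l5 : δ ≤ δ₅ := l4'.trans (min_le_right _ _)
  have A := A₀.mono hδ0 (l2.trans hδ₂δ)
  have hpos : ∀ q ∈ sideBox δ, 0 < q.2 →
      0 < h.ip (sideMap h x q) (w (b q, q.1) - w (a q, q.1)) (h.curvatureVec x 0) :=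
    fun q hq h0 => hpos₃ q (sideBox_mono l3 hq) h0
  have hsegδ := fun q (hq : q ∈ sideBox δ) => hseg q (sideBox_mono l5 hq)
  have hBδ := fun q (hq : q ∈ sideBox δ) => hB₁ q (sideBox_mono l1 hq)
  have hcinv : ∀ s ∈ Ioo (-ε) ε, Θ (x s) = (s, 0) := by
    intro s hs
    refine hBρ s ?_
    rw [Real.ball_eq_Ioo]
    exact ⟨by linarith [hs.1], by linarith [hs.2]⟩
  have hcmem : ∀ q ∈ sideBox δ, q.1 ∈ Ioo (-ε) ε := fun q hq =>
    ⟨by linarith [hq.1.1], by linarith [hq.1.2]⟩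
  have hxq : ∀ q ∈ sideBox δ, ∀ s ∈ Ioo (-ε) ε, x s = sideMap h x q ↔ q = (s, 0) := by
    intro q hq s hs
    constructor
    · intro he
      rw [← (hBδ q hq).1.self_of_nhds, ← he, hcinv s hs]
    · rintro rfl
      exact (sideMap_zero s).symm
  have himg : ∀ q ∈ sideBox δ, sideMap h x q ∈ x '' Ioo (-ε) ε ↔ q.2 = 0 := by
    intro q hq
    constructor
    · rintro ⟨s, hs, he⟩
      rw [(hxq q hq s hs).1 he]
    · intro h0
      exact ⟨q.1, hcmem q hq, (hxq q hq _ (hcmem q hq)).2 (Prod.ext rfl h0)⟩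
  have hXc : ∀ q ∈ sideBox δ, q.2 = 0 → X q = (2 : ℝ) • h.unitTangent x q.1 := by
    intro q hq h0
    obtain ⟨ea, eb⟩ := A.eq_of_zero hq h0
    have : w (q.1, q.1) = h.unitTangent x q.1 := (A.sliced_diag hq).diagw
    simp only [X, ea, eb, this, two_smul]
  have hfstX : ∀ q ∈ sideBox δ, 0 < (fderiv ℝ Θ (sideMap h x q) (X q)).1 := by
    intro q hq
    obtain ⟨n1, n2⟩ := hfst₄ q (sideBox_mono l4 hq)
    simp only [A.root_a hq, A.root_b hq] at n1 n2
    simp only [X, map_add]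
    exact add_pos n1 n2
  refine ⟨δ, hk, hδ0, fun q hq => (hBδ q hq).1, fun q hq => (hBδ q hq).2.1, hcinv,
    fun q hq => (hBδ q hq).2.2.1, fun q hq => A.regular hq, fun q hq => (hBδ q hq).2.2.2.1,
    fun q hq => (hBδ q hq).2.2.2.2.1, fun q hq h0 => A.contDiffAt_velocity_sum hk hq h0,
    hX₂.mono (sideBox_mono l2), hXc, hfstX, fun q hq h0 => A.stringLength_of_zero hq h0,
    fun q hq h0 => A.stringLength_pos hk hpos hq h0,
    fun σ hσ => A.strictMonoOn_stringLength hk hpos hσ, ?_, ?_, ?_, ?_⟩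
  · intro q hq h0
    obtain ⟨L, hL, hL'⟩ := A.hasFDerivAt_stringLength hk hq h0
    refine ⟨L, hL, ?_⟩
    -- What remains is `⟨w_a - w_b, w_a + w_b⟩ = |w_a|² - |w_b|² = 0`.
    rw [hL', sideMap_fderiv_sideChart ((hBδ q hq).2.2.1.differentiableAt hkne)
      ((hBδ q hq).2.2.2.1.differentiableAt hkne) (hBδ q hq).1.self_of_nhds (hBδ q hq).2.1]
    have ua := (A.sliced_a hq).unit
    have ub := (A.sliced_b hq).unit
    simp only [A.root_a hq, A.root_b hq] at ua ub
    simp only [X]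
    rw [LocalMetric.ip_sub_left, LocalMetric.ip_add_right, LocalMetric.ip_add_right, ua, ub,
      (A.regular hq).ip_symm (w (b q, q.1))]
    ring
  · intro q hq h0
    have : tangencySet h x ε (sideMap h x q) = {a q, b q} := by
      ext s
      simp only [tangencySet, mem_ofPred_eq, mem_insert_iff, mem_singleton_iff]
      constructor
      · rintro ⟨ℓ, ζ, hs⟩
        rcases ((hsegδ q hq s ℓ ζ).1 hs).2 with h1 | h1
        · exact Or.inl h1.1
        · exact Or.inr h1.1
      · rintro (rfl | rfl)
        · exact ⟨_, _, (hsegδ q hq _ _ _).2 ⟨h0, Or.inl ⟨rfl, rfl, rfl⟩⟩⟩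
        · exact ⟨_, _, (hsegδ q hq _ _ _).2 ⟨h0, Or.inr ⟨rfl, rfl, rfl⟩⟩⟩
    rw [this]
    exact Set.ncard_pair ((A.a_lt hq h0).trans (A.lt_b hq h0)).ne
  · intro q hq
    unfold bisectorField
    split_ifs with hc
    · have h0 := (himg q hq).1 hc
      have hset : {v | ∃ s ∈ Ioo (-ε) ε, x s = sideMap h x q ∧ v = deriv x s} =
          {deriv x q.1} := by
        ext v
        simp only [mem_ofPred_eq, mem_singleton_iff]
        constructor
        · rintro ⟨s, hs, he, rfl⟩
          rw [(hxq q hq s hs).1 he]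
        · rintro rfl
          exact ⟨q.1, hcmem q hq, (hxq q hq _ (hcmem q hq)).2 (Prod.ext rfl h0), rfl⟩
      have hn : h.norm (x q.1) (deriv x q.1) ≠ 0 :=
        ((hBδ q hq).2.2.2.2.2.norm_pos (hBδ q hq).2.2.2.2.1).ne'
      rw [hset, hXc q hq h0, LocalMetric.unitTangent, smul_smul]
      exact (Submodule.span_singleton_smul_eq (isUnit_iff_ne_zero.2 (by simpa using hn)) _).symm
    · have h0 : 0 < q.2 := hq.2.1.lt_of_ne fun he => hc ((himg q hq).2 he.symm)
      refine le_antisymm (Submodule.span_le.2 ?_) (Submodule.span_le.2 ?_)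
      · rintro v ⟨s, s', ℓ, ℓ', ζ, ζ', hne, h1, h2, rfl⟩
        obtain ⟨-, h1⟩ := (hsegδ q hq s ℓ ζ).1 h1
        obtain ⟨-, h2⟩ := (hsegδ q hq s' ℓ' ζ').1 h2
        rcases h1 with ⟨rfl, -, rfl⟩ | ⟨rfl, -, rfl⟩ <;>
          rcases h2 with ⟨rfl, -, rfl⟩ | ⟨rfl, -, rfl⟩
        · exact absurd rfl hne
        · have : -w (a q, q.1) - w (b q, q.1) = -X q := by simp only [X]; abel
          rw [this]
          exact (Submodule.span ℝ {X q}).neg_mem (Submodule.mem_span_singleton_self _)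
        · have : w (b q, q.1) - -w (a q, q.1) = X q := by simp only [X]; abel
          rw [this]
          exact Submodule.mem_span_singleton_self _
        · exact absurd rfl hne
      · rintro v rfl
        refine Submodule.subset_span ⟨b q, a q, _, _, _, _,
          ((A.a_lt hq h0).trans (A.lt_b hq h0)).ne',
          (hsegδ q hq _ _ _).2 ⟨h0, Or.inr ⟨rfl, rfl, rfl⟩⟩,
          (hsegδ q hq _ _ _).2 ⟨h0, Or.inl ⟨rfl, rfl, rfl⟩⟩, ?_⟩
        simp only [X]; abel
  · intro q hq p
    unfold stringCurve
    split_ifs with hp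
    · rw [himg q hq, hp]
      constructor
      · intro h0
        exact (A.stringLength_of_zero hq h0).symm
      · intro h1
        by_contra h0
        exact (A.stringLength_pos hk hpos hq (hq.2.1.lt_of_ne' h0)).ne h1
    · simp only [mem_ofPred_eq]
      constructor
      · rintro ⟨s, s', ℓ, ℓ', ζ, ζ', hlt, h1, h2, rfl⟩
        obtain ⟨h0, h1⟩ := (hsegδ q hq s ℓ ζ).1 h1
        obtain ⟨-, h2⟩ := (hsegδ q hq s' ℓ' ζ').1 h2
        have hab := (A.a_lt hq h0).trans (A.lt_b hq h0)
        rcases h1 with ⟨rfl, rfl, -⟩ | ⟨rfl, rfl, -⟩ <;>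
          rcases h2 with ⟨rfl, rfl, -⟩ | ⟨rfl, rfl, -⟩
        · exact absurd hlt (lt_irrefl _)
        · simp only [P, stringLength]; ring
        · exact absurd hlt hab.not_gt
        · exact absurd hlt (lt_irrefl _)
      · intro he
        have h0 : 0 < q.2 := hq.2.1.lt_of_ne fun h0 => hp (by
          rw [he]; exact A.stringLength_of_zero hq h0.symm)
        refine ⟨a q, b q, _, _, _, _, (A.a_lt hq h0).trans (A.lt_b hq h0),
          (hsegδ q hq _ _ _).2 ⟨h0, Or.inl ⟨rfl, rfl, rfl⟩⟩,
          (hsegδ q hq _ _ _).2 ⟨h0, Or.inr ⟨rfl, rfl, rfl⟩⟩, ?_⟩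
        rw [he]
        simp only [P, stringLength]; ring

/-! ### Derivatives along integral curves. -/

theorem uniqueDiffOn_sideBox (δ : ℝ) : UniqueDiffOn ℝ (sideBox δ) :=
  isOpen_Ioo.uniqueDiffOn.prod (uniqueDiffOn_Ico 0 δ)

/-- A curve which is an integral curve of a `C^m` field is `C^(m + 1)`. -/
theorem contDiffAt_of_integralCurve {E : Type*} [NormedAddCommGroup E] [NormedSpace ℝ E] {m : ℕ}
    {Y : E → E} {s : Set E} (hY : ContDiffOn ℝ m Y s) {r : ℝ → E} {t₀ : ℝ}
    (hr : ∀ᶠ t in 𝓝 t₀, r t ∈ s ∧ HasDerivAt r (Y (r t)) t) :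
    ContDiffAt ℝ (m + 1 : ℕ) r t₀ := by
  obtain ⟨ρ, hρ, hB⟩ := Metric.eventually_nhds_iff_ball.1 hr
  -- Bootstrap: if `r` is `C^n` and `n ≤ m`, then `r' = Y ∘ r` is `C^n` too.
  have key : ∀ n ≤ m + 1, ContDiffOn ℝ n r (Metric.ball t₀ ρ) := by
    intro n hn
    induction n with
    | zero =>
      exact contDiffOn_zero.2 fun t ht => (hB t ht).2.continuousAt.continuousWithinAt
    | succ n ih =>
      rw [Nat.cast_succ, contDiffOn_succ_iff_deriv_of_isOpen Metric.isOpen_ball]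
      refine ⟨fun t ht => (hB t ht).2.differentiableAt.differentiableWithinAt, by simp, ?_⟩
      refine ((hY.of_le (by norm_cast; omega)).comp (ih (by omega)) fun t ht => (hB t ht).1).congr ?_
      exact fun t ht => (hB t ht).2.deriv
  exact (key _ le_rfl).contDiffAt (Metric.ball_mem_nhds _ hρ)

/-- The iterated derivatives of `F` along the field `Y`. -/
def lieIterate {E F : Type*} [NormedAddCommGroup E] [NormedSpace ℝ E] [NormedAddCommGroup F]
    [NormedSpace ℝ F] (s : Set E) (Y : E → E) (G : E → F) : ℕ → E → F
  | 0 => G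
  | j + 1 => fun q => fderivWithin ℝ (lieIterate s Y G j) s q (Y q)

section

variable {E F : Type*} [NormedAddCommGroup E] [NormedSpace ℝ E] [NormedAddCommGroup F]
  [NormedSpace ℝ F] {s : Set E} {Y : E → E} {G : E → F} {m : ℕ}

theorem contDiffOn_lieIterate (hs : UniqueDiffOn ℝ s) (hY : ContDiffOn ℝ m Y s)
    (hG : ContDiffOn ℝ (m + 1 : ℕ) G s) (j : ℕ) (hj : j ≤ m + 1) :
    ContDiffOn ℝ (m + 1 - j : ℕ) (lieIterate s Y G j) s := by
  induction j with
  | zero => exact hG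
  | succ j ih =>
    refine ContDiffOn.clm_apply ((ih (by omega)).fderivWithin hs ?_) (hY.of_le ?_)
    · norm_cast; omega
    · norm_cast; omega

/-- The chain rule, one derivative at a time. The answer depends only on the current point and not
on the choice of integral curve; this is how jets will be shown continuous without a continuous flow
up to the boundary. -/
theorem iteratedDeriv_integralCurve (hs : UniqueDiffOn ℝ s) (hY : ContDiffOn ℝ m Y s)
    (hG : ContDiffOn ℝ (m + 1 : ℕ) G s) {r : ℝ → E} {t₀ : ℝ}
    (hr : ∀ᶠ t in 𝓝 t₀, r t ∈ s ∧ HasDerivAt r (Y (r t)) t) (j : ℕ) (hj : j ≤ m + 1) :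
    ∀ᶠ t in 𝓝 t₀, iteratedDeriv j (fun t => G (r t)) t = lieIterate s Y G j (r t) := by
  induction j with
  | zero => exact Eventually.of_forall fun t => by simp [lieIterate]
  | succ j ih =>
    filter_upwards [(ih (by omega)).eventually_nhds, hr.eventually_nhds] with t h1 h2
    rw [iteratedDeriv_succ, EventuallyEq.deriv_eq h1]
    have hd : DifferentiableOn ℝ (lieIterate s Y G j) s := by
      refine (contDiffOn_lieIterate hs hY hG j (by omega)).differentiableOn ?_
      have : m + 1 - j ≠ 0 := by omega
      exact_mod_cast this
    exact ((hd _ h2.self_of_nhds.1).hasFDerivWithinAt.comp_hasDerivAt t h2.self_of_nhds.2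
      (h2.mono fun _ h => h.1)).deriv

end

/-! ### String curves as integral curves of the bisector field. -/

/-- The unit field spanning the exterior bisectors in the coordinates `sideMap`. -/
def unitField (h : LocalMetric) (x : ℝ → Plane) (Θ : Plane → ℝ × ℝ) (X : ℝ × ℝ → Plane)
    (q : ℝ × ℝ) : ℝ × ℝ :=
  fderiv ℝ Θ (sideMap h x q) ((h.norm (sideMap h x q) (X q))⁻¹ • X q)

namespace IsStringSystem

variable {Θ : Plane → ℝ × ℝ} {X : ℝ × ℝ → Plane} {P : ℝ × ℝ → ℝ} {ε δ : ℝ} {q : ℝ × ℝ}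

theorem k_ne_zero (S : IsStringSystem h k x Θ X P ε δ) : (k : ℕ∞ω) ≠ 0 := by
  have : k ≠ 0 := by have := S.two_le; omega
  exact_mod_cast this

theorem X_ne (S : IsStringSystem h k x Θ X P ε δ) (hq : q ∈ sideBox δ) : X q ≠ 0 := by
  intro h0
  have := S.fstX q hq
  simp [h0] at this

theorem norm_pos (S : IsStringSystem h k x Θ X P ε δ) (hq : q ∈ sideBox δ) :
    0 < h.norm (sideMap h x q) (X q) := (S.regular q hq).norm_pos (S.X_ne hq)

theorem contDiffWithinAt_unitField (S : IsStringSystem h k x Θ X P ε δ) {n : ℕ}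
    (hn : n + 1 ≤ k) {s : Set (ℝ × ℝ)} (hq : q ∈ sideBox δ) (hX : ContDiffWithinAt ℝ n X s q) :
    ContDiffWithinAt ℝ n (unitField h x Θ X) s q := by
  let Ψ : Plane × Plane → ℝ × ℝ := fun v => fderiv ℝ Θ v.1 ((h.norm v.1 v.2)⁻¹ • v.2)
  have hN : ContDiffAt ℝ n (fun v : Plane × Plane => h.norm v.1 v.2) (sideMap h x q, X q) :=
    LocalMetric.contDiffAt_norm (k := k) (c := Prod.fst) (V := Prod.snd) (by omega)
      (S.regular q hq) contDiffAt_fst contDiffAt_snd (S.X_ne hq)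
  have hΨ : ContDiffAt ℝ n Ψ (sideMap h x q, X q) := by
    refine ContDiffAt.clm_apply ?_ ((hN.inv (S.norm_pos hq).ne').smul contDiffAt_snd)
    exact ContDiffAt.comp (g := fderiv ℝ Θ) (sideMap h x q, X q)
      ((S.contDiffΘ q hq).fderiv_right (m := n) (by norm_cast)) contDiffAt_fst
  have hm : ContDiffWithinAt ℝ n (sideMap h x) s q :=
    ((contDiffAt_sideMap (S.smooth q hq)).of_le (by norm_cast; omega)).contDiffWithinAt
  exact ContDiffAt.comp_contDiffWithinAt (g := Ψ) (f := fun q => (sideMap h x q, X q)) q hΨ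
    (hm.prodMk hX)

theorem contDiffOn_unitField (S : IsStringSystem h k x Θ X P ε δ) :
    ContDiffOn ℝ (k / 2 - 1 : ℕ) (unitField h x Θ X) (sideBox δ) := fun q hq =>
  S.contDiffWithinAt_unitField (by have := S.two_le; omega) hq (S.contDiffOnX q hq)

theorem unitField_fst_pos (S : IsStringSystem h k x Θ X P ε δ) (hq : q ∈ sideBox δ) :
    0 < (unitField h x Θ X q).1 := by
  rw [unitField, map_smul]
  exact mul_pos (inv_pos.2 (S.norm_pos hq)) (S.fstX q hq)

theorem unitField_of_zero (S : IsStringSystem h k x Θ X P ε δ) (hq : q ∈ sideBox δ)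
    (h0 : q.2 = 0) : unitField h x Θ X q = ((h.norm (x q.1) (deriv x q.1))⁻¹, 0) := by
  have hC : sideMap h x q = x q.1 := by simp [sideMap, h0]
  have hreg := S.regular q hq
  rw [hC] at hreg
  have hn := hreg.norm_pos (S.deriv_ne q hq)
  have h1 := fderiv_sideChart ((S.contDiffΘ q hq).differentiableAt S.k_ne_zero)
    ((S.smooth q hq).differentiableAt S.k_ne_zero) (S.left_inv q hq) (1, 0)
  simp only [one_smul, zero_smul, sub_zero] at h1
  rw [unitField, S.curveX q hq h0, LocalMetric.unitTangent, smul_smul, smul_smul, map_smul, h1,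
    hC, LocalMetric.norm_smul, LocalMetric.norm_smul, abs_of_pos two_pos,
    abs_of_pos (inv_pos.2 hn)]
  ext
  · simp; field_simp
  · simp

/-- At an interior point the field is `C^1` and Picard–Lindelöf applies; the excess is constant
along the solution because its differential kills the field. On the boundary the field may be merely
continuous, but it is tangent to the curve, and the problem reduces to the scalar equation `α' = 1 /
|x'(α)|` with a `C^1` right-hand side. -/
theorem exists_integralCurve (S : IsStringSystem h k x Θ X P ε δ) (hq : q ∈ sideBox δ) :
    ∃ r : ℝ → ℝ × ℝ, r 0 = q ∧ ∀ᶠ t in 𝓝 (0 : ℝ),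
      (r t ∈ sideBox δ ∧ HasDerivAt r (unitField h x Θ X (r t)) t) ∧ P (r t) = P q := by
  have hk := S.two_le
  rcases hq.2.1.eq_or_lt with h0 | h0
  · have h0 : q.2 = 0 := h0.symm
    have hC : sideMap h x q = x q.1 := by simp [sideMap, h0]
    have hreg := S.regular q hq
    rw [hC] at hreg
    have hN : ContDiffAt ℝ (1 : ℕ) (fun s => (h.norm (x s) (deriv x s))⁻¹) q.1 := by
      refine ContDiffAt.inv ?_ (hreg.norm_pos (S.deriv_ne q hq)).ne'
      refine LocalMetric.contDiffAt_norm (by omega) hreg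
        ((S.smooth q hq).of_le (by norm_cast; omega)) ?_ (S.deriv_ne q hq)
      exact (contDiffAt_deriv (S.smooth q hq) (by omega)).of_le (by norm_cast; omega)
    obtain ⟨α, hα0, ρ, hρ, hα⟩ :=
      ContDiffAt.exists_forall_mem_closedBall_exists_eq_forall_mem_Ioo_hasDerivAt₀ hN 0
    have hev : ∀ᶠ t in 𝓝 (0 : ℝ), t ∈ Ioo (0 - ρ) (0 + ρ) :=
      Ioo_mem_nhds (by linarith) (by linarith)
    have hc : ContinuousAt α 0 := (hα 0 ⟨by linarith, by linarith⟩).continuousAt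
    have hm : ∀ᶠ t in 𝓝 (0 : ℝ), α t ∈ Ioo (-δ) δ :=
      hc.eventually (by rw [hα0]; exact Ioo_mem_nhds hq.1.1 hq.1.2)
    refine ⟨fun t => (α t, 0), by simp only [hα0]; exact Prod.ext rfl h0.symm, ?_⟩
    filter_upwards [hev, hm] with t h1 h2
    have h3 : (α t, (0 : ℝ)) ∈ sideBox δ := ⟨h2, le_rfl, S.δ_pos⟩
    refine ⟨⟨h3, ?_⟩, ?_⟩
    · rw [S.unitField_of_zero h3 rfl]
      exact (hα t h1).prodMk (hasDerivAt_const t 0)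
    · rw [S.P_zero _ h3 rfl, S.P_zero q hq h0]
  · have hY : ContDiffAt ℝ (1 : ℕ) (unitField h x Θ X) q :=
      S.contDiffWithinAt_unitField (s := univ) (by omega) hq
        ((S.contDiffX q hq h0).of_le (by norm_cast; omega)).contDiffWithinAt
    obtain ⟨r, hr0, ρ, hρ, hr⟩ :=
      ContDiffAt.exists_forall_mem_closedBall_exists_eq_forall_mem_Ioo_hasDerivAt₀ hY 0
    have hev : ∀ᶠ t in 𝓝 (0 : ℝ), t ∈ Ioo (0 - ρ) (0 + ρ) :=
      Ioo_mem_nhds (by linarith) (by linarith)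
    have hc : ContinuousAt r 0 := (hr 0 ⟨by linarith, by linarith⟩).continuousAt
    have hm : ∀ᶠ t in 𝓝 (0 : ℝ), r t ∈ sideBox δ ∧ 0 < (r t).2 := by
      refine hc.eventually (p := fun p => p ∈ sideBox δ ∧ 0 < p.2) ?_
      rw [hr0]
      exact Filter.Eventually.and (sideBox_mem_nhds hq h0)
        (continuousAt_snd.eventually_const_lt h0)
    have hP : ∀ᶠ t in 𝓝 (0 : ℝ), HasDerivAt (fun t => P (r t)) 0 t := by
      filter_upwards [hev, hm] with t h1 h2
      obtain ⟨L, hL, hL0⟩ := S.P_deriv _ h2.1 h2.2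
      refine (hL.comp_hasDerivAt t (hr t h1)).congr_deriv ?_
      rw [unitField, map_smul, map_smul, hL0, smul_zero]
    obtain ⟨ρ', hρ', hB⟩ := Metric.eventually_nhds_iff_ball.1 hP
    refine ⟨r, hr0, ?_⟩
    filter_upwards [hev, hm, Metric.ball_mem_nhds _ hρ'] with t h1 h2 h3
    refine ⟨⟨h2.1, hr t h1⟩, ?_⟩
    have := eq_of_hasDerivAt_zero_ball hB t h3 0 (Metric.mem_ball_self hρ')
    simpa [hr0] using this

theorem injOn_P (S : IsStringSystem h k x Θ X P ε δ) {p p' : ℝ × ℝ} (hp : p ∈ sideBox δ)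
    (hp' : p' ∈ sideBox δ) (h1 : p.1 = p'.1) (h2 : P p = P p') : p = p' := by
  refine Prod.ext h1 ((S.P_mono p.1 hp.1).injOn hp.2 hp'.2 ?_)
  have : (p.1, p'.2) = p' := Prod.ext h1 rfl
  simpa [this] using h2

/-- The box is a neighbourhood of its interior points. At a boundary point it is only one-sided, but
there the string curve is the arc of `γ` itself, which the chart sends to the line `t = 0`. -/
theorem eventually_mem_string (S : IsStringSystem h k x Θ X P ε δ) (hq : q ∈ sideBox δ) :
    ∀ᶠ C in 𝓝[stringCurve h x ε (P q)] (sideMap h x q),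
      Θ C ∈ sideBox δ ∧ sideMap h x (Θ C) = C ∧ P (Θ C) = P q := by
  have hΘq := (S.left_inv q hq).self_of_nhds
  have hc := (S.contDiffΘ q hq).continuousAt
  have hm : ∀ᶠ C in 𝓝[stringCurve h x ε (P q)] (sideMap h x q), Θ C ∈ sideBox δ := by
    rcases hq.2.1.eq_or_lt with h0 | h0
    · rw [S.P_zero q hq h0.symm, stringCurve, if_pos rfl]
      have h1 : ∀ᶠ C in 𝓝 (sideMap h x q), (Θ C).1 ∈ Ioo (-δ) δ :=
        hc.fst.eventually (by simp only [hΘq]; exact Ioo_mem_nhds hq.1.1 hq.1.2)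
      filter_upwards [self_mem_nhdsWithin, nhdsWithin_le_nhds h1] with C hC hC'
      obtain ⟨s, hs, rfl⟩ := hC
      rw [S.curve_inv s hs] at hC' ⊢
      exact ⟨hC', le_rfl, S.δ_pos⟩
    · refine nhdsWithin_le_nhds (hc.eventually ?_)
      rw [hΘq]
      exact sideBox_mem_nhds hq h0
  filter_upwards [hm, nhdsWithin_le_nhds (S.right_inv q hq), self_mem_nhdsWithin] with C h1 h2 h3
  refine ⟨h1, h2, ?_⟩
  rw [← h2] at h3
  exact ((S.string _ h1 _).1 h3).symm

/-- The integral curve stays in its level set. Conversely it sweeps out all nearby values of `σ`,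
while a level set has at most one point over each `σ`; so the two coincide near the point. -/
theorem isArcTangentTo (S : IsStringSystem h k x Θ X P ε δ) (hq : q ∈ sideBox δ)
    {r : ℝ → ℝ × ℝ} (hr0 : r 0 = q)
    (hr : ∀ᶠ t in 𝓝 (0 : ℝ), (r t ∈ sideBox δ ∧ HasDerivAt r (unitField h x Θ X (r t)) t) ∧
      P (r t) = P q) :
    IsArcTangentTo h (k / 2) (bisectorField h x ε) (stringCurve h x ε (P q)) (sideMap h x q)
      (fun t => sideMap h x (r t)) := by
  have hk := S.two_le
  have hrc : ContDiffAt ℝ (k / 2 : ℕ) r 0 := by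
    have := contDiffAt_of_integralCurve S.contDiffOn_unitField (hr.mono fun t ht => ht.1)
    rwa [show k / 2 - 1 + 1 = k / 2 by omega] at this
  have hcc : ContDiffAt ℝ (k / 2 : ℕ) (fun t => sideMap h x (r t)) 0 := by
    refine ContDiffAt.comp (g := sideMap h x) (0 : ℝ) ?_ hrc
    rw [hr0]
    exact (contDiffAt_sideMap (S.smooth q hq)).of_le (by norm_cast; omega)
  refine ⟨by simp only [hr0], le_antisymm ?_ ?_, hcc, ?_⟩
  · refine tendsto_nhdsWithin_iff.2 ⟨?_, ?_⟩
    · have := hcc.continuousAt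
      rwa [ContinuousAt, hr0] at this
    · filter_upwards [hr] with t ht
      exact (S.string _ ht.1.1 _).2 ht.2.symm
  · intro s hs
    have hn : ((k / 2 : ℕ) : ℕ∞ω) ≠ 0 := by
      have : k / 2 ≠ 0 := by omega
      exact_mod_cast this
    -- The velocity along `σ` is nonzero, so `t ↦ (r t).1` maps neighbourhoods of 0 onto
    -- neighbourhoods of `q.1`. A point of the level set near the base point then has the same `σ`
    -- and the same `P` as some `r t`, hence equals it.
    have h1 : HasStrictDerivAt (fun t => (r t).1) (unitField h x Θ X q).1 0 := by
      have h2 := hr.self_of_nhds.1.2.fst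
      rw [hr0] at h2
      exact (contDiffAt_fst.comp (0 : ℝ) hrc).hasStrictDerivAt' h2 hn
    have h2 := h1.map_nhds_eq (S.unitField_fst_pos hq).ne'
    simp only [hr0] at h2
    have h3 := image_mem_map (m := fun t => (r t).1) (hr.and (mem_map.1 hs))
    rw [h2] at h3
    have hc := (S.contDiffΘ q hq).continuousAt.fst
    have h4 : ∀ᶠ C in 𝓝 (sideMap h x q), (Θ C).1 ∈ (fun t => (r t).1) ''
        {t | ((r t ∈ sideBox δ ∧ HasDerivAt r (unitField h x Θ X (r t)) t) ∧ P (r t) = P q) ∧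
          sideMap h x (r t) ∈ s} := by
      refine hc.eventually ?_
      simp only [(S.left_inv q hq).self_of_nhds]
      exact h3
    filter_upwards [S.eventually_mem_string hq, nhdsWithin_le_nhds h4] with C ⟨c1, c2, c3⟩
      ⟨t, ⟨⟨⟨t1, _⟩, t2⟩, t3⟩, t4⟩
    rw [S.injOn_P t1 c1 t4 (t2.trans c3.symm), c2] at t3
    exact t3
  · filter_upwards [hr] with t ht
    have h1 := (hasFDerivAt_sideMap (h := h) ((S.smooth _ ht.1.1).differentiableAt
      S.k_ne_zero)).comp_hasDerivAt t ht.1.2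
    have h2 : deriv (fun t => sideMap h x (r t)) t =
        (h.norm (sideMap h x (r t)) (X (r t)))⁻¹ • X (r t) := by
      refine h1.deriv.trans ?_
      have h3 := sideMap_fderiv_sideChart
        ((S.contDiffΘ _ ht.1.1).differentiableAt S.k_ne_zero)
        ((S.smooth _ ht.1.1).differentiableAt S.k_ne_zero) (S.left_inv _ ht.1.1).self_of_nhds
        (S.right_inv _ ht.1.1) ((h.norm (sideMap h x (r t)) (X (r t)))⁻¹ • X (r t))
      exact h3
    have hn := S.norm_pos ht.1.1
    rw [h2, S.bisector _ ht.1.1]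
    refine ⟨?_, Submodule.smul_mem _ _ (Submodule.mem_span_singleton_self _)⟩
    rw [LocalMetric.norm_smul, abs_of_pos (inv_pos.2 hn), inv_mul_cancel₀ hn.ne']

theorem isLineFieldOn (S : IsStringSystem h k x Θ X P ε δ) {n : ℕ} {s : Set (ℝ × ℝ)}
    (hs : s ⊆ sideBox δ) (hn : n ≤ k) (hX : ContDiffOn ℝ n X s) :
    IsLineFieldOn n (bisectorField h x ε) (sideMap h x '' s) := by
  rintro _ ⟨q, hq, rfl⟩
  have hΘq := (S.left_inv q (hs hq)).self_of_nhds
  have hmap : MapsTo Θ (sideMap h x '' s) s := by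
    rintro _ ⟨p, hp, rfl⟩
    rwa [(S.left_inv p (hs hp)).self_of_nhds]
  refine ⟨fun C => X (Θ C), ?_, ?_⟩
  · refine ContDiffWithinAt.comp (g := X) (t := s) (sideMap h x q) (by rw [hΘq]; exact hX q hq)
      ((S.contDiffΘ q (hs hq)).of_le (by norm_cast)).contDiffWithinAt hmap
  · filter_upwards [self_mem_nhdsWithin] with C hC
    obtain ⟨p, hp, rfl⟩ := hC
    rw [(S.left_inv p (hs hp)).self_of_nhds]
    exact ⟨S.X_ne (hs hp), S.bisector p (hs hp)⟩

theorem continuousOn_sideChart (S : IsStringSystem h k x Θ X P ε δ) :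
    ContinuousOn Θ (closedConcaveSide h x δ) := by
  rw [closedConcaveSide_eq]
  rintro _ ⟨q, hq, rfl⟩
  exact (S.contDiffΘ q hq).continuousAt.continuousWithinAt

theorem mapsTo_sideChart (S : IsStringSystem h k x Θ X P ε δ) :
    MapsTo Θ (closedConcaveSide h x δ) (sideBox δ) := by
  rw [closedConcaveSide_eq]
  rintro _ ⟨q, hq, rfl⟩
  rwa [(S.left_inv q hq).self_of_nhds]

/-- The integral curves are chosen independently for each point. Continuity of the jets comes from
the formula for their derivatives: iterated derivatives of `sideMap` along the unit field, composed
with the chart. -/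
theorem exists_curves (S : IsStringSystem h k x Θ X P ε δ) :
    ∃ c : Plane → ℝ → Plane,
      (∀ C ∈ closedConcaveSide h x δ, ∃ p ≥ 0, (∀ q, C ∈ stringCurve h x ε q ↔ q = p) ∧
        IsArcTangentTo h (k / 2) (bisectorField h x ε) (stringCurve h x ε p) C (c C)) ∧
      ∀ j ≤ k / 2, ContinuousOn (fun C => iteratedDeriv j (c C) 0)
        (closedConcaveSide h x δ) := by
  have hk := S.two_le
  choose! r hr0 hr using fun q (hq : q ∈ sideBox δ) => S.exists_integralCurve hq
  refine ⟨fun C t => sideMap h x (r (Θ C) t), ?_, fun j hj => ?_⟩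
  · rw [closedConcaveSide_eq]
    rintro _ ⟨q, hq, rfl⟩
    refine ⟨P q, ?_, fun p => S.string q hq p, ?_⟩
    · rcases hq.2.1.eq_or_lt with h0 | h0
      · exact (S.P_zero q hq h0.symm).ge
      · exact (S.P_pos q hq h0).le
    · simp only [(S.left_inv q hq).self_of_nhds]
      exact S.isArcTangentTo hq (hr0 q hq) (hr q hq)
  · have hG : ContDiffOn ℝ (k / 2 - 1 + 1 : ℕ) (sideMap h x) (sideBox δ) := fun q hq =>
      ((contDiffAt_sideMap (S.smooth q hq)).of_le (by norm_cast; omega)).contDiffWithinAt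
    have hJ := contDiffOn_lieIterate (uniqueDiffOn_sideBox δ) S.contDiffOn_unitField hG j
      (by omega)
    refine (hJ.continuousOn.comp S.continuousOn_sideChart S.mapsTo_sideChart).congr fun C hC => ?_
    have hq := S.mapsTo_sideChart hC
    have := (iteratedDeriv_integralCurve (uniqueDiffOn_sideBox δ) S.contDiffOn_unitField hG
      ((hr _ hq).mono fun t ht => ht.1) j (by omega)).self_of_nhds
    rw [hr0 _ hq] at this
    exact this

end IsStringSystem

/-! ### From the surface to local coordinates. -/

section Surface

variable {M : Type*} [TopologicalSpace M] [ChartedSpace Plane M] [IsManifold (𝓡 2) 1 M]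

open Bundle in
-- In the trivialization at `O` this section is the constant `v`.
theorem contMDiffAt_symmL (n : ℕ∞ω) (O : M) (v : Plane) :
    ContMDiffAt (𝓡 2) ((𝓡 2).prod 𝓘(ℝ, Plane)) n
      (fun y : M => TotalSpace.mk' Plane (E := fun y : M => TangentSpace (𝓡 2) y) y
        ((trivializationAt Plane (fun y : M => TangentSpace (𝓡 2) y) O).symmL ℝ y v)) O := by
  rw [contMDiffAt_section]
  refine (contMDiffAt_const (c := v)).congr_of_eventuallyEq ?_
  have hmem : (trivializationAt Plane (fun y : M => TangentSpace (𝓡 2) y) O).baseSet ∈ 𝓝 O :=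
    (trivializationAt Plane (fun y : M => TangentSpace (𝓡 2) y) O).open_baseSet.mem_nhds
      (FiberBundle.mem_baseSet_trivializationAt' O)
  filter_upwards [hmem] with y hy
  rw [Trivialization.symmL_apply _ hy, Trivialization.apply_mk_symm _ hy]

variable {k : ℕ} [IsManifold (𝓡 2) (k : ℕ∞ω) M]
  (g : Bundle.ContMDiffRiemannianMetric (𝓡 2) (k : ℕ∞ω) Plane
    (fun x : M => TangentSpace (𝓡 2) x)) (O : M)

/-- The coordinate fields of the chart are the sections that are constant in the trivialization at
`O`. Evaluating the metric on them therefore loses no derivative, and its coefficients remain `C^k`.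
-/
theorem mfderiv_extChartAt_symm_eq {u : Plane} (hu : u ∈ (extChartAt (𝓡 2) O).target) :
    mfderiv (𝓡 2) (𝓡 2) (extChartAt (𝓡 2) O).symm u =
      (trivializationAt Plane (fun y : M => TangentSpace (𝓡 2) y) O).symmL ℝ
        ((extChartAt (𝓡 2) O).symm u) := by
  have h1 : (extChartAt (𝓡 2) O).symm u ∈ (chartAt Plane O).source := by
    rw [← extChartAt_source (𝓡 2)]
    exact (extChartAt (𝓡 2) O).map_target hu
  rw [TangentBundle.symmL_trivializationAt h1, (extChartAt (𝓡 2) O).right_inv hu]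
  rw [ModelWithCorners.range_eq_univ, mfderivWithin_univ]

theorem isRegularAt_localMetric :
    (localMetric g O).IsRegularAt k (extChartAt (𝓡 2) O O) := by
  have htarget : (extChartAt (𝓡 2) O).target ∈ 𝓝 (extChartAt (𝓡 2) O O) :=
    extChartAt_target_mem_nhds O
  refine ⟨htarget, fun i j => ?_, ?_, ?_⟩
  · have h1 := ContMDiffAt.clm_bundle_apply₂ (F₃ := ℝ) (E₃ := Bundle.Trivial M ℝ) (b := fun y : M => y)
      (ψ := g.inner) (g.contMDiff.contMDiffAt (x := O))
      (contMDiffAt_symmL k O (coordVec i)) (contMDiffAt_symmL k O (coordVec j))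
    have h2 := (Bundle.contMDiffAt_totalSpace.1 h1).2
    have h3 : ContMDiffAt (𝓡 2) (𝓡 2) k (extChartAt (𝓡 2) O).symm (extChartAt (𝓡 2) O O) :=
      (contMDiffOn_extChartAt_symm O).contMDiffAt htarget
    have h4 := ContMDiffAt.comp (extChartAt (𝓡 2) O O)
      (by rw [(extChartAt (𝓡 2) O).left_inv (mem_extChartAt_source O)]; exact h2) h3
    refine h4.contDiffAt.congr_of_eventuallyEq ?_
    filter_upwards [htarget] with u hu
    simp only [localMetric, Matrix.of_apply, mfderiv_extChartAt_symm_eq O hu]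
    rfl
  · filter_upwards with u i j
    exact g.symm _ _ _
  · filter_upwards [htarget] with u hu v hv
    have hinj : Function.Injective (mfderiv (𝓡 2) (𝓡 2) (extChartAt (𝓡 2) O).symm u) := by
      have := isInvertible_mfderivWithin_extChartAt_symm (I := 𝓡 2) hu
      rw [ModelWithCorners.range_eq_univ, mfderivWithin_univ] at this
      exact this.injective
    have hne : mfderiv (𝓡 2) (𝓡 2) (extChartAt (𝓡 2) O).symm u v ≠ 0 := fun h0 =>
      hv (hinj (h0.trans (map_zero _).symm))
    have h1 := g.pos _ _ hne
    have hv2 : v = v 0 • coordVec 0 + v 1 • coordVec 1 := by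
      ext i
      fin_cases i <;> simp [coordVec]
    have h2 : mfderiv (𝓡 2) (𝓡 2) (extChartAt (𝓡 2) O).symm u v =
        v 0 • mfderiv (𝓡 2) (𝓡 2) (extChartAt (𝓡 2) O).symm u (coordVec 0) +
        v 1 • mfderiv (𝓡 2) (𝓡 2) (extChartAt (𝓡 2) O).symm u (coordVec 1) := by
      conv_lhs => rw [hv2]
      erw [map_add, map_smul, map_smul]
    rw [h2] at h1
    rw [LocalMetric.ip_eq]
    simp only [localMetric, Matrix.of_apply]
    simp only [map_add, map_smul, add_apply, smul_apply, smul_eq_mul] at h1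
    convert h1 using 1
    ring

theorem isCurvedAt_localMetric (hk : 2 ≤ k) {γ : ℝ → M} (hO : γ 0 = O)
    (hγ : ContMDiffAt 𝓘(ℝ, ℝ) (𝓡 2) (k : ℕ∞ω) γ 0) (hreg : mfderiv 𝓘(ℝ, ℝ) (𝓡 2) γ 0 ≠ 0)
    (hκ : 0 < (localMetric g O).geodesicCurvature (localCurve O γ) 0) :
    IsCurvedAt (localMetric g O) k (localCurve O γ) := by
  have hk0 : (k : ℕ∞ω) ≠ 0 := by
    have : k ≠ 0 := by omega
    exact_mod_cast this
  have hφ : ContMDiffAt (𝓡 2) (𝓡 2) k (extChartAt (𝓡 2) O) (γ 0) := by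
    rw [hO]; exact contMDiffAt_extChartAt
  have hx : ContDiffAt ℝ k (localCurve O γ) 0 := (hφ.comp 0 hγ).contDiffAt
  refine ⟨hk, ?_, hx, fun h0 => hreg ?_, hκ⟩
  · have : localCurve O γ 0 = extChartAt (𝓡 2) O O := by rw [localCurve, hO]
    rw [this]
    exact isRegularAt_localMetric g O
  · have h1 : mfderiv 𝓘(ℝ, ℝ) (𝓡 2) (localCurve O γ) 0 = 0 := by
      rw [mfderiv_eq_fderiv]
      exact ContinuousLinearMap.ext_ring ((fderiv_apply_one_eq_deriv).trans h0)
    have h2 := mfderiv_comp (0 : ℝ) (hφ.mdifferentiableAt hk0) (hγ.mdifferentiableAt hk0)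
    have hinj := (isInvertible_mfderiv_extChartAt (I := 𝓡 2) (x := O) (y := γ 0)
      (by rw [hO]; exact mem_extChartAt_source O)).injective
    refine ContinuousLinearMap.ext fun v => hinj ?_
    have h3 := DFunLike.congr_fun (h2.symm.trans h1) v
    exact h3.trans (map_zero _).symm

end Surface

/-! ### Conclusion. -/

theorem IsCurvedAt.string_foliation {h : LocalMetric} {k : ℕ} {x : ℝ → Plane}
    (H : IsCurvedAt h k x) : ∀ᶠ ε in 𝓝[>] (0 : ℝ), ∃ δ > 0,
      (∀ C ∈ concaveSide h x δ, (tangencySet h x ε C).ncard = 2) ∧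
      IsLineFieldOn (k - 1) (bisectorField h x ε) (concaveSide h x δ) ∧
      IsLineFieldOn (k / 2 - 1) (bisectorField h x ε) (closedConcaveSide h x δ) ∧
      ∃ c : Plane → ℝ → Plane,
        (∀ C ∈ closedConcaveSide h x δ, ∃ p ≥ 0, (∀ q, C ∈ stringCurve h x ε q ↔ q = p) ∧
          IsArcTangentTo h (k / 2) (bisectorField h x ε) (stringCurve h x ε p) C (c C)) ∧
        ∀ j ≤ k / 2, ContinuousOn (fun C => iteratedDeriv j (c C) 0)
          (closedConcaveSide h x δ) := by
  obtain ⟨Θ, X, P, hev⟩ := H.exists_stringSystem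
  filter_upwards [hev] with ε ⟨δ, S⟩
  refine ⟨δ, S.δ_pos, ?_, ?_, ?_, S.exists_curves⟩
  · intro C hC
    obtain ⟨q, hq, h0, rfl⟩ := (mem_concaveSide_iff δ C).1 hC
    exact S.ncard q hq h0
  · have : concaveSide h x δ = sideMap h x '' {q ∈ sideBox δ | 0 < q.2} := by
      ext C
      simp only [mem_concaveSide_iff, mem_image, mem_ofPred_eq, and_assoc]
    rw [this]
    exact S.isLineFieldOn (fun q hq => hq.1) (by omega) fun q hq =>
      (S.contDiffX q hq.1 hq.2).contDiffWithinAt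
  · rw [closedConcaveSide_eq]
    exact S.isLineFieldOn le_rfl (by omega) S.contDiffOnX

end StringFoliation

end

theorem theorem1p3 {M : Type*} [TopologicalSpace M] [ChartedSpace StringFoliation.Plane M]
    [IsManifold (𝓡 2) 1 M] (k : ℕ) (hk : 2 ≤ k) [IsManifold (𝓡 2) (k : ℕ∞ω) M]
    (g : Bundle.ContMDiffRiemannianMetric (𝓡 2) (k : ℕ∞ω) StringFoliation.Plane
      (fun x : M => TangentSpace (𝓡 2) x))
    (O : M) (γ : ℝ → M) (hO : γ 0 = O)
    (hγ : ContMDiffAt 𝓘(ℝ, ℝ) (𝓡 2) (k : ℕ∞ω) γ 0)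
    (hreg : mfderiv 𝓘(ℝ, ℝ) (𝓡 2) γ 0 ≠ 0)
    (h : StringFoliation.LocalMetric) (hh : h = StringFoliation.localMetric g O)
    (x : ℝ → StringFoliation.Plane) (hx : x = StringFoliation.localCurve O γ)
    (hκ : 0 < h.geodesicCurvature x 0) :
    ∀ᶠ ε in 𝓝[>] (0 : ℝ), ∃ δ > 0,
      -- through each point of the concave side pass exactly two geodesics tangent to the curve
      (∀ C ∈ StringFoliation.concaveSide h x δ,
        (StringFoliation.tangencySet h x ε C).ncard = 2) ∧
      -- smoothness of the line field on the concave side, and up to the curve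
      StringFoliation.IsLineFieldOn (k - 1) (StringFoliation.bisectorField h x ε)
        (StringFoliation.concaveSide h x δ) ∧
      StringFoliation.IsLineFieldOn (k / 2 - 1) (StringFoliation.bisectorField h x ε)
        (StringFoliation.closedConcaveSide h x δ) ∧
      -- the string curves: tangency, smoothness and continuity of jets
      ∃ c : StringFoliation.Plane → ℝ → StringFoliation.Plane,
        (∀ C ∈ StringFoliation.closedConcaveSide h x δ, ∃ p ≥ 0,
          (∀ q, C ∈ StringFoliation.stringCurve h x ε q ↔ q = p) ∧
          StringFoliation.IsArcTangentTo h (k / 2) (StringFoliation.bisectorField h x ε)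
            (StringFoliation.stringCurve h x ε p) C (c C)) ∧
        ∀ j ≤ k / 2, ContinuousOn (fun C => iteratedDeriv j (c C) 0)
          (StringFoliation.closedConcaveSide h x δ) := by
  subst hh hx
  exact (StringFoliation.isCurvedAt_localMetric g O hk hO hγ hreg hκ).string_foliation
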